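/- Let $(\cdot,\cdot)$ be the Hilbert symbol of $\mathbb{Q}_2$. For $g=\begin{pmatrix}a&b\\c&d\end{pmatrix}\in \mathrm{SL}_2(\mathbb{Q}_2)$ put $\tau(g)=c$ if $c\neq 0$ and $\tau(g)=d$ if $c=0$; put $s(g)=(c,d)$ if $cd\ne 0$ and $\mathrm{ord}_2(c)$ is odd, and $s(g)=1$ otherwise; and put \[\sigma(g,h)=\bigl(\tau(gh)\tau(g),\tau(gh)\tau(h)\bigr)\,s(g)s(h)s(gh).\] Let $\widetilde{\mathrm{SL}}_2(\mathbb{Q}_2)$ be the double cover $\mathrm{SL}_2(\mathbb{Q}_2)\times\{\pm1\}$ with the multiplication $(g,\epsilon_1)(h,\epsilon_2)=(gh,\epsilon_1\epsilon_2\sigma(g,h))$ and with its topology as a locally compact group, in which the translates of the sets $\{(k,1): k\equiv I \bmod 2^n\}$, $n\ge2$, form a basis. Write $\overline{g}=(g,1)$, and $y(s)=\begin{pmatrix}1&0\\s&1\end{pmatrix}$, $w(t)=\begin{pmatrix}0&t\\-t^{-1}&0\end{pmatrix}$, $h(t)=\begin{pmatrix}t&0\\0&t^{-1}\end{pmatrix}$.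 Let $K_0=K_0^2(8)=\{\begin{pmatrix}a&b\\c&d\end{pmatrix}\in\mathrm{SL}_2(\mathbb{Z}_2): c\in 8\mathbb{Z}_2\}$, let $K_1=\{\begin{pmatrix}a&b\\c&d\end{pmatrix}\in K_0: a\equiv1 \bmod 8\}$, and let $\overline{K}_0$ be the complete inverse image of $K_0$ in the double cover. Let $\chi_2$ be a genuine character of $\overline{K}_0$ that is trivial on $K_1\times\{1\}$, takes $(-I,1)$ to a primitive fourth root of unity, and satisfies $\chi_2(\overline{h(5)})=-1$. Let $H(\overline{K}_0,\chi_2)$ be the algebra of locally constant, compactly supported functions $f:\widetilde{\mathrm{SL}}_2(\mathbb{Q}_2)\to\mathbb{C}$ with $f(kgk')=\overline{\chi_2(k)}\,\overline{\chi_2(k')}f(g)$ for all $k,k'\in\overline{K}_0$, under the convolution $f_1*f_2(h)=\int f_1(g)f_2(g^{-1}h)\,dg$, where the Haar measure gives $\overline{K}_0$ volume $1$. Let $\zeta=(1+\chi_2((-I,1)))/\sqrt2$. Then there are unique elements of $H(\overline{K}_0,\chi_2)$ as follows: for $n=1,2$ an element $\mathcal{U}_n$ that is supported on $\overline{K}_0\,\overline{w(2^{-n})}\,\overline{K}_0$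 with $\mathcal{U}_n(k\,\overline{w(2^{-n})}\,k')=\overline{\chi_2(k)}\,\overline{\zeta}\,\overline{\chi_2(k')}$ for $k,k'\in\overline{K}_0$, and an element $\mathcal{Z}_1'$ that is supported on the double coset of $z=\overline{y(2)}\,\overline{w(2^{-1})}\,\overline{y(2)}$ with $\mathcal{Z}_1'(z)=1$. Put $\widehat{\mathcal{U}_n}=\frac1{\sqrt2}\mathcal{U}_n$. As a unital associative $\mathbb{C}$-algebra, $H(\overline{K}_0,\chi_2)$ is generated by $\widehat{\mathcal{U}_1}$, $\widehat{\mathcal{U}_2}$ and $\mathcal{Z}_1'$ with the defining relations \[\widehat{\mathcal{U}_1}^2=1,\qquad \widehat{\mathcal{U}_2}^2=1+\mathcal{Z}_1',\qquad \widehat{\mathcal{U}_2}\mathcal{Z}_1'=\widehat{\mathcal{U}_2}=\mathcal{Z}_1'\widehat{\mathcal{U}_2},\qquad \widehat{\mathcal{U}_1}\mathcal{Z}_1'\widehat{\mathcal{U}_1}=\mathcal{Z}_1'\widehat{\mathcal{U}_1}\mathcal{Z}_1'.\] -/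

import Mathlib

open scoped ComplexConjugate

namespace Metaplectic

/-! ### The Hilbert symbol of `ℚ₂` -/

/-- `a x² + b y² = z²` has a nontrivial solution over `ℚ₂`. -/
def HilbertSolvable (a b : ℚ_[2]) : Prop :=
  ∃ x y z : ℚ_[2], (x ≠ 0 ∨ y ≠ 0 ∨ z ≠ 0) ∧ z ^ 2 = a * x ^ 2 + b * y ^ 2

open Classical in
/-- The quadratic Hilbert symbol `(a, b)` of `ℚ₂` (for nonzero `a`, `b`). -/
noncomputable def hilbert (a b : ℚ_[2]) : ℤˣ :=
  if HilbertSolvable a b then 1 else -1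

theorem solvable_iff_norm {a b : ℚ_[2]} (ha : a ≠ 0) :
    HilbertSolvable a b ↔ ∃ u v, b = u ^ 2 - a * v ^ 2 := by
  constructor
  · rintro ⟨x, y, z, hne, h⟩
    by_cases hy : y = 0
    · subst hy
      have hx : x ≠ 0 := by
        rintro rfl
        have : z = 0 := by
          have : z ^ 2 = 0 := by rw [h]; ring
          exact pow_eq_zero_iff (two_ne_zero) |>.1 this
        simp_all
      have hz : z ≠ 0 := by
        rintro rfl
        have : a * x ^ 2 = 0 := by linear_combination -h
        simp_all
      refine ⟨(b + 1) / 2, (b - 1) / 2 * (x / z), ?_⟩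
      have : a = z ^ 2 / x ^ 2 := by field_simp; linear_combination -h
      rw [this]; field_simp; ring
    · refine ⟨z / y, x / y, ?_⟩
      field_simp; linear_combination -h
  · rintro ⟨u, v, h⟩
    exact ⟨v, 1, u, by simp, by rw [h]; ring⟩

theorem solvable_comm {a b : ℚ_[2]} : HilbertSolvable a b ↔ HilbertSolvable b a := by
  constructor <;> rintro ⟨x, y, z, hne, h⟩ <;>
    exact ⟨y, x, z, by tauto, by rw [h]; ring⟩

theorem solvable_mul_of_solvable {a b c : ℚ_[2]} (ha : a ≠ 0)
    (h1 : HilbertSolvable a b) (h2 : HilbertSolvable a c) : HilbertSolvable a (b * c) := by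
  rw [solvable_iff_norm ha] at h1
  rw [solvable_iff_norm ha] at h2
  rw [solvable_iff_norm ha]
  obtain ⟨u, v, rfl⟩ := h1
  obtain ⟨s, t, rfl⟩ := h2
  exact ⟨u * s + a * v * t, u * t + v * s, by ring⟩

theorem solvable_mul_sq {a b s : ℚ_[2]} (hs : s ≠ 0) :
    HilbertSolvable a (b * s ^ 2) ↔ HilbertSolvable a b := by
  constructor
  · rintro ⟨x, y, z, hne, h⟩
    exact ⟨x, y * s, z, by simpa [hs] using hne, by rw [h]; ring⟩
  · rintro ⟨x, y, z, hne, h⟩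
    exact ⟨x, y / s, z, by simpa [hs] using hne, by rw [h]; field_simp⟩

theorem isSquare_of_mod_eight {u : ℤ_[2]} (hu : PadicInt.toZModPow 3 u = 1) :
    ∃ z : ℤ_[2], u = z ^ 2 := by
  have h8 : ‖1 - u‖ ≤ (2 : ℝ) ^ (-(3 : ℤ)) := by
    have : (1 - u) ∈ RingHom.ker (PadicInt.toZModPow (p := 2) 3) := by
      rw [RingHom.mem_ker, map_sub, hu, map_one, sub_self]
    rw [PadicInt.ker_toZModPow] at this
    have := (PadicInt.norm_le_pow_iff_mem_span_pow (1 - u) 3).2 this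
    exact_mod_cast this
  have h2 : ‖(2 : ℤ_[2])‖ = 2⁻¹ := by
    have := PadicInt.norm_p (p := 2)
    exact_mod_cast this
  obtain ⟨z, hz, -⟩ := hensels_lemma (p := 2) (R := ℤ_[2])
    (F := (Polynomial.X ^ 2 - Polynomial.C u : Polynomial ℤ_[2])) (a := 1) (by
      simp [one_add_one_eq_two]
      rw [h2]
      refine lt_of_le_of_lt h8 ?_
      norm_num)
  refine ⟨z, ?_⟩
  simp at hz
  linear_combination -hz

theorem exists_rep {b : ℚ_[2]} (hb : b ≠ 0) :
    ∃ r ∈ ([1, 3, 5, 7, 2, 6, 10, 14] : List ℕ), ∃ s : ℚ_[2], s ≠ 0 ∧ b = r * s ^ 2 := by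
  have key : ∀ c : ℚ_[2], c.valuation = 0 → c ≠ 0 →
      ∃ r ∈ ([1, 3, 5, 7] : List ℕ), ∃ s : ℚ_[2], s ≠ 0 ∧ c = r * s ^ 2 := by
    intro c hc hc0
    have hn : ‖c‖ = 1 := by rw [Padic.norm_eq_zpow_neg_valuation hc0, hc]; simp
    set u : ℤ_[2] := ⟨c, hn.le⟩ with hu
    have huu : IsUnit u := PadicInt.isUnit_iff.2 (by simpa [hu] using hn)
    have huz := huu.map (PadicInt.toZModPow (p := 2) 3)
    have hinv : ∀ x : ZMod (2 ^ 3), IsUnit x →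
        ∃ r ∈ ([1, 3, 5, 7] : List ℕ), x * r = 1 := by decide
    obtain ⟨r, hr, hxr⟩ := hinv _ huz
    obtain ⟨z, hz⟩ := isSquare_of_mod_eight (u := u * r) (by simpa using hxr)
    have hr0 : (r : ℚ_[2]) ≠ 0 := by
      have : r ≠ 0 := by rintro rfl; simp at hr
      exact_mod_cast this
    have hz' : c * r = (z : ℚ_[2]) ^ 2 := by
      have := congrArg (fun t : ℤ_[2] => (t : ℚ_[2])) hz
      rw [PadicInt.coe_mul, PadicInt.coe_pow] at this
      simpa [hu] using this
    have hc' : c = r * ((z : ℚ_[2]) / r) ^ 2 := by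
      field_simp; exact hz'
    refine ⟨r, hr, z / r, ?_, hc'⟩
    intro h0
    rw [h0] at hc'
    exact hc0 (by simpa using hc')
  have h2 : (2 : ℚ_[2]) ≠ 0 := two_ne_zero
  have hv2 : (2 : ℚ_[2]).valuation = 1 := by exact_mod_cast Padic.valuation_p (p := 2)
  obtain ⟨r, hr, s, hs, h⟩ := key (b * 2 ^ (-b.valuation)) (by
    rw [Padic.valuation_mul hb (zpow_ne_zero _ h2), Padic.valuation_zpow, hv2]; ring)
    (mul_ne_zero hb (zpow_ne_zero _ h2))
  have hb' : b = r * s ^ 2 * 2 ^ b.valuation := by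
    rw [← h, mul_assoc, ← zpow_add₀ h2]; simp
  obtain ⟨k, hk⟩ | ⟨k, hk⟩ := Int.even_or_odd b.valuation
  · refine ⟨r, by simp at hr ⊢; tauto, s * 2 ^ k, mul_ne_zero hs (zpow_ne_zero _ h2), ?_⟩
    rw [hk, zpow_add₀ h2] at hb'
    rw [hb']; ring
  · refine ⟨2 * r, by simp at hr ⊢; omega, s * 2 ^ k, mul_ne_zero hs (zpow_ne_zero _ h2), ?_⟩
    rw [hk, zpow_add₀ h2, two_mul, zpow_add₀ h2] at hb'
    rw [hb']; push_cast; ring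

theorem solvable_of_nat {a b : ℕ}
    (h : ∃ x ∈ List.range 10, ∃ y ∈ List.range 10, ∃ k ∈ List.range 3,
      (a * x ^ 2 + b * y ^ 2) % (8 * 4 ^ k) = 4 ^ k) :
    HilbertSolvable (a : ℚ_[2]) b := by
  obtain ⟨x, -, y, -, k, -, h⟩ := h
  obtain ⟨m, hm⟩ : ∃ m, a * x ^ 2 + b * y ^ 2 = 4 ^ k * (8 * m + 1) :=
    ⟨(a * x ^ 2 + b * y ^ 2) / (8 * 4 ^ k), by
      conv_lhs => rw [← Nat.div_add_mod (a * x ^ 2 + b * y ^ 2) (8 * 4 ^ k), h]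
      ring⟩
  obtain ⟨z, hz⟩ := isSquare_of_mod_eight (u := ((8 * m + 1 : ℕ) : ℤ_[2])) (by
    have : (8 : ZMod (2 ^ 3)) = 0 := by decide
    rw [map_natCast]
    push_cast
    rw [this]; simp)
  have hz' : (8 * (m : ℚ_[2]) + 1) = (z : ℚ_[2]) ^ 2 := by
    have := congrArg (fun t : ℤ_[2] => (t : ℚ_[2])) hz
    rw [PadicInt.coe_natCast] at this
    simpa using this
  refine ⟨x, y, 2 ^ k * z, ?_, ?_⟩
  · by_contra hcon
    push Not at hcon
    obtain ⟨hx, hy, -⟩ := hcon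
    have hx : x = 0 := by exact_mod_cast hx
    have hy : y = 0 := by exact_mod_cast hy
    subst hx hy
    have := Nat.pow_pos (n := k) (show 0 < 4 by norm_num)
    simp at hm
  · have h4 : (4 : ℚ_[2]) ^ k = (2 ^ k) ^ 2 := by rw [← pow_mul, mul_comm, pow_mul]; norm_num
    have : (a : ℚ_[2]) * x ^ 2 + b * y ^ 2 = 4 ^ k * (8 * m + 1) := by exact_mod_cast hm
    rw [this, mul_pow, ← h4, hz']

theorem solvable_trichotomy {a b c : ℚ_[2]} (ha : a ≠ 0) (hb : b ≠ 0) (hc : c ≠ 0) :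
    HilbertSolvable a b ∨ HilbertSolvable a c ∨ HilbertSolvable a (b * c) := by
  have fin : ∀ p ∈ ([1, 3, 5, 7, 2, 6, 10, 14] : List ℕ),
      ∀ q ∈ ([1, 3, 5, 7, 2, 6, 10, 14] : List ℕ), ∀ r ∈ ([1, 3, 5, 7, 2, 6, 10, 14] : List ℕ),
      (∃ x ∈ List.range 10, ∃ y ∈ List.range 10, ∃ k ∈ List.range 3,
        (p * x ^ 2 + q * y ^ 2) % (8 * 4 ^ k) = 4 ^ k) ∨
      (∃ x ∈ List.range 10, ∃ y ∈ List.range 10, ∃ k ∈ List.range 3,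
        (p * x ^ 2 + r * y ^ 2) % (8 * 4 ^ k) = 4 ^ k) ∨
      (∃ x ∈ List.range 10, ∃ y ∈ List.range 10, ∃ k ∈ List.range 3,
        (p * x ^ 2 + (q * r) * y ^ 2) % (8 * 4 ^ k) = 4 ^ k) := by decide +kernel
  obtain ⟨p, hp, s, hs, rfl⟩ := exists_rep ha
  obtain ⟨q, hq, t, ht, rfl⟩ := exists_rep hb
  obtain ⟨r, hr, w, hw, rfl⟩ := exists_rep hc
  have e : (q : ℚ_[2]) * t ^ 2 * (r * w ^ 2) = (q * r : ℕ) * (t * w) ^ 2 := by push_cast; ring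
  rw [e]
  simp only [solvable_mul_sq ht, solvable_mul_sq hw, solvable_mul_sq (mul_ne_zero ht hw)]
  simp only [solvable_comm (a := (p : ℚ_[2]) * s ^ 2), solvable_mul_sq hs]
  simp only [solvable_comm (b := (p : ℚ_[2]))]
  rcases fin p hp q hq r hr with h | h | h
  · exact Or.inl (solvable_of_nat h)
  · exact Or.inr (Or.inl (solvable_of_nat h))
  · exact Or.inr (Or.inr (solvable_of_nat h))

theorem hilbert_comm (a b : ℚ_[2]) : hilbert a b = hilbert b a := by
  unfold hilbert
  rw [solvable_comm]

theorem hilbert_mul_right {a b c : ℚ_[2]} (ha : a ≠ 0) (hb : b ≠ 0) (hc : c ≠ 0) :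
    hilbert a (b * c) = hilbert a b * hilbert a c := by
  have h0 := solvable_trichotomy ha hb hc
  have h1 := solvable_mul_of_solvable (b := b) (c := c) ha
  have h2 := solvable_mul_of_solvable (b := b * c) (c := b) ha
  have h3 := solvable_mul_of_solvable (b := b * c) (c := c) ha
  rw [show b * c * b = c * b ^ 2 by ring, solvable_mul_sq hb] at h2
  rw [show b * c * c = b * c ^ 2 by ring, solvable_mul_sq hc] at h3
  unfold hilbert
  by_cases hab : HilbertSolvable a b <;> by_cases hac : HilbertSolvable a c <;>
    by_cases habc : HilbertSolvable a (b * c) <;> simp_all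

theorem hilbert_mul_left {a b c : ℚ_[2]} (ha : a ≠ 0) (hb : b ≠ 0) (hc : c ≠ 0) :
    hilbert (a * b) c = hilbert a c * hilbert b c := by
  rw [hilbert_comm, hilbert_mul_right hc ha hb, hilbert_comm c a, hilbert_comm c b]

theorem hilbert_neg_self (a : ℚ_[2]) : hilbert a (-a) = 1 :=
  if_pos ⟨1, 1, 0, by simp, by ring⟩

theorem hilbert_of_add_eq_one {a b : ℚ_[2]} (h : a + b = 1) : hilbert a b = 1 :=
  if_pos ⟨1, 1, 1, by simp, by rw [one_pow, mul_one, mul_one, h]⟩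


/-! ### The cocycle and the double cover -/

/-- `SL₂(ℚ₂)`. -/
abbrev SL2 : Type := Matrix.SpecialLinearGroup (Fin 2) ℚ_[2]

open Classical in
/-- `τ(g) = c` if `c ≠ 0`, and `d` otherwise. -/
noncomputable def tau (g : SL2) : ℚ_[2] :=
  if g.1 1 0 ≠ 0 then g.1 1 0 else g.1 1 1

open Classical in
/-- `s(g) = (c, d)` if `c d ≠ 0` and `ord₂ c` is odd, and `1` otherwise. -/
noncomputable def sgn (g : SL2) : ℤˣ :=
  if g.1 1 0 * g.1 1 1 ≠ 0 ∧ Odd (g.1 1 0).valuation then hilbert (g.1 1 0) (g.1 1 1) else 1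

/-- The Kubota–Gelbart cocycle on `SL₂(ℚ₂)`. -/
noncomputable def sigma (g h : SL2) : ℤˣ :=
  hilbert (tau (g * h) * tau g) (tau (g * h) * tau h) * sgn g * sgn h * sgn (g * h)

theorem det_eq (g : SL2) : g.1 0 0 * g.1 1 1 - g.1 0 1 * g.1 1 0 = 1 := by
  have := g.2
  rwa [Matrix.det_fin_two] at this

theorem tau_ne_zero (g : SL2) : tau g ≠ 0 := by
  unfold tau
  split_ifs with h
  · exact h
  · intro h1
    have := det_eq g
    simp_all

theorem tau_one : tau 1 = 1 := by simp [tau]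

theorem sgn_one : sgn 1 = 1 := by simp [sgn]

theorem mul_c (g h : SL2) :
    (g * h).1 1 0 = g.1 1 0 * h.1 0 0 + g.1 1 1 * h.1 1 0 := by
  simp [Matrix.mul_apply, Fin.sum_univ_two]

theorem mul_d (g h : SL2) :
    (g * h).1 1 1 = g.1 1 0 * h.1 0 1 + g.1 1 1 * h.1 1 1 := by
  simp [Matrix.mul_apply, Fin.sum_univ_two]

/-- The Hilbert symbol with additive values. -/
noncomputable def hilbertAdd (a b : ℚ_[2]) : ZMod 2 := if hilbert a b = 1 then 0 else 1

theorem hilbertAdd_comm (a b : ℚ_[2]) : hilbertAdd a b = hilbertAdd b a := by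
  unfold hilbertAdd; rw [hilbert_comm]

theorem hilbertAdd_mul_right {a b c : ℚ_[2]} (ha : a ≠ 0) (hb : b ≠ 0) (hc : c ≠ 0) :
    hilbertAdd a (b * c) = hilbertAdd a b + hilbertAdd a c := by
  unfold hilbertAdd
  rw [hilbert_mul_right ha hb hc]
  rcases Int.units_eq_one_or (hilbert a b) with h | h <;>
    rcases Int.units_eq_one_or (hilbert a c) with h' | h' <;> rw [h, h'] <;> decide

theorem hilbertAdd_mul_left {a b c : ℚ_[2]} (ha : a ≠ 0) (hb : b ≠ 0) (hc : c ≠ 0) :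
    hilbertAdd (a * b) c = hilbertAdd a c + hilbertAdd b c := by
  rw [hilbertAdd_comm, hilbertAdd_mul_right hc ha hb, hilbertAdd_comm c a, hilbertAdd_comm c b]

theorem hilbertAdd_self {a : ℚ_[2]} (ha : a ≠ 0) : hilbertAdd a a = hilbertAdd (-1) a := by
  have h1 : hilbertAdd a (-a) = 0 := by simp [hilbertAdd, hilbert_neg_self]
  rw [show -a = a * (-1) by ring, hilbertAdd_mul_right ha ha (by simp)] at h1
  rw [hilbertAdd_comm (-1) a]
  revert h1
  generalize hilbertAdd a a = u
  generalize hilbertAdd a (-1) = v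
  revert u v
  decide

theorem hilbertAdd_of_mul {a b c : ℚ_[2]} (ha : a ≠ 0) (hb : b ≠ 0) (h : a * b = c)
    (w : ℚ_[2]) (hw : w ≠ 0) : hilbertAdd a w = hilbertAdd b w + hilbertAdd c w := by
  rw [← h, hilbertAdd_mul_left ha hb hw]
  generalize hilbertAdd a w = u
  generalize hilbertAdd b w = v
  revert u v
  decide

/-- The six-variable form of the cocycle identity, given enough multiplicative relations. -/
theorem six_term {x y z p q t : ℚ_[2]} (hx : x ≠ 0) (hy : y ≠ 0) (hz : z ≠ 0) (hp : p ≠ 0)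
    (hq : q ≠ 0) (ht : t ≠ 0)
    (h : (p = x * y ∧ t = x * q) ∨
      ((p * y = x ∨ p = x * y) ∧ q = y * z) ∨
      ((q * z = y ∨ q = y * z) ∧ (t * z = p ∨ t = p * z)) ∨
      (t * z = -p ∧ z * x = q * p) ∨
      (y * p = -x ∧ t = p * z) ∨
      (y = -(q * z) ∧ t * q = x) ∨
      z * x + t * y = q * p) :
    hilbertAdd (p * x) (p * y) + hilbertAdd (t * p) (t * z) =
    hilbertAdd (t * x) (t * q) + hilbertAdd (q * y) (q * z) := by
  have hm : (-1 : ℚ_[2]) ≠ 0 := by simp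
  have two : ∀ u : ZMod 2, u + u = 0 := by decide
  have hL : ∀ {a b c : ℚ_[2]}, a ≠ 0 → b ≠ 0 → c ≠ 0 →
    hilbertAdd (a * b) c = hilbertAdd a c + hilbertAdd b c := hilbertAdd_mul_left
  rw [hilbertAdd_mul_left hp hx (mul_ne_zero hp hy), hilbertAdd_mul_left ht hp (mul_ne_zero ht hz),
    hilbertAdd_mul_left ht hx (mul_ne_zero ht hq), hilbertAdd_mul_left hq hy (mul_ne_zero hq hz),
    hilbertAdd_mul_right hp hp hy, hilbertAdd_mul_right hx hp hy,
    hilbertAdd_mul_right ht ht hz, hilbertAdd_mul_right hp ht hz,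
    hilbertAdd_mul_right ht ht hq, hilbertAdd_mul_right hx ht hq,
    hilbertAdd_mul_right hq hq hz, hilbertAdd_mul_right hy hq hz]
  -- linear consequences of a relation `a * b = c`
  have two' : (2 : ZMod 2) = 0 := rfl
  have lin : ∀ {a b c : ℚ_[2]}, a ≠ 0 → b ≠ 0 → c ≠ 0 → a * b = c → ∀ w, w ≠ 0 →
      hilbertAdd a w = hilbertAdd b w + hilbertAdd c w :=
    fun ha hb _ h w hw => hilbertAdd_of_mul ha hb h w hw
  have sx := hilbertAdd_self hx
  have sy := hilbertAdd_self hy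
  have sz := hilbertAdd_self hz
  have sp := hilbertAdd_self hp
  have sq := hilbertAdd_self hq
  have st := hilbertAdd_self ht
  have neg : ∀ {a : ℚ_[2]}, a ≠ 0 → ∀ w, w ≠ 0 →
      hilbertAdd (-a) w = hilbertAdd (-1) w + hilbertAdd a w := fun {a} ha w hw => by
    rw [show -a = -1 * a by ring, hilbertAdd_mul_left hm ha hw]
  have := hilbertAdd_comm x y
  have := hilbertAdd_comm x z
  have := hilbertAdd_comm x p
  have := hilbertAdd_comm x q
  have := hilbertAdd_comm x t
  have := hilbertAdd_comm x (-1)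
  have := hilbertAdd_comm y z
  have := hilbertAdd_comm y p
  have := hilbertAdd_comm y q
  have := hilbertAdd_comm y t
  have := hilbertAdd_comm y (-1)
  have := hilbertAdd_comm z p
  have := hilbertAdd_comm z q
  have := hilbertAdd_comm z t
  have := hilbertAdd_comm z (-1)
  have := hilbertAdd_comm p q
  have := hilbertAdd_comm p t
  have := hilbertAdd_comm p (-1)
  have := hilbertAdd_comm q t
  have := hilbertAdd_comm q (-1)
  have := hilbertAdd_comm t (-1)
  have zx := mul_ne_zero hz hx
  have ty := mul_ne_zero ht hy
  have qp := mul_ne_zero hq hp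
  rcases h with ⟨h1, h2⟩ | ⟨h1, h2⟩ | ⟨h1, h2⟩ | ⟨h1, h2⟩ | ⟨h1, h2⟩ | ⟨h1, h2⟩ | h1
  · have r1 := lin hx hy hp h1.symm
    have r2 := lin hx hq ht h2.symm
    have := r1 x hx; have := r1 y hy; have := r1 z hz; have := r1 p hp; have := r1 q hq; have := r1 t ht; have := r1 (-1) hm
    have := r2 x hx; have := r2 y hy; have := r2 z hz; have := r2 p hp; have := r2 q hq; have := r2 t ht; have := r2 (-1) hm
    clear lin neg r1 r2 two two'
    grind
  · have r1 : ∀ w, w ≠ 0 → hilbertAdd x w = hilbertAdd y w + hilbertAdd p w := by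
      rcases h1 with h1 | h1
      · intro w hw
        rw [lin hp hy hx h1 w hw]
        linear_combination -hilbertAdd y w * two'
      · exact lin hx hy hp h1.symm
    have r2 := lin hy hz hq h2.symm
    have := r1 x hx; have := r1 y hy; have := r1 z hz; have := r1 p hp; have := r1 q hq; have := r1 t ht; have := r1 (-1) hm
    have := r2 x hx; have := r2 y hy; have := r2 z hz; have := r2 p hp; have := r2 q hq; have := r2 t ht; have := r2 (-1) hm
    clear lin neg r1 r2 two two'
    grind
  · have r1 : ∀ w, w ≠ 0 → hilbertAdd q w = hilbertAdd y w + hilbertAdd z w := by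
      rcases h1 with h1 | h1
      · intro w hw
        rw [lin hq hz hy h1 w hw, add_comm]
      · intro w hw
        rw [h1, hilbertAdd_mul_left hy hz hw]
    have r2 : ∀ w, w ≠ 0 → hilbertAdd t w = hilbertAdd p w + hilbertAdd z w := by
      rcases h2 with h2 | h2
      · intro w hw
        rw [lin ht hz hp h2 w hw, add_comm]
      · intro w hw
        rw [h2, hilbertAdd_mul_left hp hz hw]
    have := r1 x hx; have := r1 y hy; have := r1 z hz; have := r1 p hp; have := r1 q hq; have := r1 t ht; have := r1 (-1) hm
    have := r2 x hx; have := r2 y hy; have := r2 z hz; have := r2 p hp; have := r2 q hq; have := r2 t ht; have := r2 (-1) hm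
    clear lin neg r1 r2 two two'
    grind
  · have r1 : ∀ w, w ≠ 0 → hilbertAdd t w = hilbertAdd z w + (hilbertAdd (-1) w + hilbertAdd p w) :=
      fun w hw => by rw [lin ht hz (neg_ne_zero.2 hp) h1 w hw, neg hp w hw]
    have r2 : ∀ w, w ≠ 0 → hilbertAdd z w + hilbertAdd x w = hilbertAdd q w + hilbertAdd p w :=
      fun w hw => by
        rw [← hilbertAdd_mul_left hz hx hw, h2, hilbertAdd_mul_left hq hp hw]
    have := r1 x hx; have := r1 y hy; have := r1 z hz; have := r1 p hp; have := r1 q hq; have := r1 t ht; have := r1 (-1) hm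
    have := r2 x hx; have := r2 y hy; have := r2 z hz; have := r2 p hp; have := r2 q hq; have := r2 t ht; have := r2 (-1) hm
    clear lin neg r1 r2 two two'
    grind
  · have r1 : ∀ w, w ≠ 0 → hilbertAdd y w = hilbertAdd p w + (hilbertAdd (-1) w + hilbertAdd x w) :=
      fun w hw => by rw [lin hy hp (neg_ne_zero.2 hx) h1 w hw, neg hx w hw]
    have r2 : ∀ w, w ≠ 0 → hilbertAdd t w = hilbertAdd p w + hilbertAdd z w :=
      fun w hw => by rw [h2, hilbertAdd_mul_left hp hz hw]
    have := r1 x hx; have := r1 y hy; have := r1 z hz; have := r1 p hp; have := r1 q hq; have := r1 t ht; have := r1 (-1) hm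
    have := r2 x hx; have := r2 y hy; have := r2 z hz; have := r2 p hp; have := r2 q hq; have := r2 t ht; have := r2 (-1) hm
    clear lin neg r1 r2 two two'
    grind
  · have r1 : ∀ w, w ≠ 0 → hilbertAdd y w = hilbertAdd (-1) w + (hilbertAdd q w + hilbertAdd z w) :=
      fun w hw => by
        rw [h1, neg (mul_ne_zero hq hz) w hw, hilbertAdd_mul_left hq hz hw]
    have r2 : ∀ w, w ≠ 0 → hilbertAdd x w = hilbertAdd t w + hilbertAdd q w :=
      fun w hw => by rw [← h2, hilbertAdd_mul_left ht hq hw]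
    have := r1 x hx; have := r1 y hy; have := r1 z hz; have := r1 p hp; have := r1 q hq; have := r1 t ht; have := r1 (-1) hm
    have := r2 x hx; have := r2 y hy; have := r2 z hz; have := r2 p hp; have := r2 q hq; have := r2 t ht; have := r2 (-1) hm
    clear lin neg r1 r2 two two'
    grind
  · have h0 : hilbert (z * x * (q * p)) (t * y * (q * p)) = 1 :=
      if_pos ⟨1, 1, q * p, by simp, by linear_combination (-(q * p)) * h1⟩
    have h0' : hilbertAdd (z * x * (q * p)) (t * y * (q * p)) = 0 := if_pos h0
    have typq := mul_ne_zero ty qp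
    rw [hilbertAdd_mul_left zx qp typq, hilbertAdd_mul_left hz hx typq,
      hilbertAdd_mul_left hq hp typq, hilbertAdd_mul_right hz ty qp, hilbertAdd_mul_right hx ty qp,
      hilbertAdd_mul_right hq ty qp, hilbertAdd_mul_right hp ty qp] at h0'
    simp only [hilbertAdd_mul_right hz ht hy, hilbertAdd_mul_right hz hq hp,
      hilbertAdd_mul_right hx ht hy, hilbertAdd_mul_right hx hq hp,
      hilbertAdd_mul_right hq ht hy, hilbertAdd_mul_right hq hq hp,
      hilbertAdd_mul_right hp ht hy, hilbertAdd_mul_right hp hq hp] at h0'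
    clear lin neg two two'
    grind

/-- The reduced cocycle identity, in additive form. -/
theorem tau_cocycle_add (g h k : SL2) :
    hilbertAdd (tau (g * h) * tau g) (tau (g * h) * tau h) +
      hilbertAdd (tau (g * h * k) * tau (g * h)) (tau (g * h * k) * tau k) =
    hilbertAdd (tau (g * (h * k)) * tau g) (tau (g * (h * k)) * tau (h * k)) +
      hilbertAdd (tau (h * k) * tau h) (tau (h * k) * tau k) := by
  rw [← mul_assoc g h k]
  refine six_term (tau_ne_zero g) (tau_ne_zero h) (tau_ne_zero k) (tau_ne_zero (g * h))
    (tau_ne_zero (h * k)) (tau_ne_zero (g * h * k)) ?_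
  have c1 := mul_c g h
  have d1 := mul_d g h
  have c2 := mul_c h k
  have d2 := mul_d h k
  have c3 := mul_c (g * h) k
  have d3 := mul_d (g * h) k
  have c4 := mul_c g (h * k)
  have d4 := mul_d g (h * k)
  rw [← mul_assoc g h k] at c4 d4
  have D1 := det_eq g
  have D2 := det_eq h
  have D3 := det_eq k
  have D4 := det_eq (g * h)
  have D5 := det_eq (h * k)
  have D6 := det_eq (g * h * k)
  have tauz : ∀ a : SL2, a.1 1 0 = 0 → tau a = a.1 1 1 := fun a ha => if_neg (not_not.2 ha)
  have taun : ∀ a : SL2, a.1 1 0 ≠ 0 → tau a = a.1 1 0 := fun a ha => if_pos ha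
  have hmulR : ∀ a b : SL2, b.1 1 0 = 0 →
      tau (a * b) * tau b = tau a ∨ tau (a * b) = tau a * tau b := by
    intro a b hb
    have c := mul_c a b
    have d := mul_d a b
    have D := det_eq b
    by_cases ha : a.1 1 0 = 0
    · right
      have hc : (a * b).1 1 0 = 0 := by rw [c, ha, hb]; ring
      rw [tauz _ hc, tauz _ ha, tauz _ hb, d, ha]; ring
    · left
      have hb0 : b.1 0 0 ≠ 0 := by
        intro h0
        rw [h0, hb] at D
        norm_num at D
      have hc : (a * b).1 1 0 = a.1 1 0 * b.1 0 0 := by rw [c, hb]; ring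
      have hc' : (a * b).1 1 0 ≠ 0 := by rw [hc]; exact mul_ne_zero ha hb0
      rw [taun _ hc', taun _ ha, tauz _ hb, hc]
      linear_combination a.1 1 0 * D + a.1 1 0 * b.1 0 1 * hb
  have hmulL : ∀ a b : SL2, a.1 1 0 = 0 → tau (a * b) = tau a * tau b := by
    intro a b ha
    have c := mul_c a b
    have d := mul_d a b
    have D := det_eq a
    have ha1 : a.1 1 1 ≠ 0 := by
      intro h0
      rw [h0, ha] at D
      norm_num at D
    have hc : (a * b).1 1 0 = a.1 1 1 * b.1 1 0 := by rw [c, ha]; ring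
    by_cases hb : b.1 1 0 = 0
    · have hc' : (a * b).1 1 0 = 0 := by rw [hc, hb]; ring
      rw [tauz _ hc', tauz _ ha, tauz _ hb, d, ha]; ring
    · have hc' : (a * b).1 1 0 ≠ 0 := by rw [hc]; exact mul_ne_zero ha1 hb
      rw [taun _ hc', tauz _ ha, taun _ hb, hc]
  by_cases hg : g.1 1 0 = 0
  · left
    exact ⟨hmulL g h hg, by rw [mul_assoc]; exact hmulL g (h * k) hg⟩
  by_cases hh : h.1 1 0 = 0
  · right; left
    exact ⟨hmulR g h hh, hmulL h k hh⟩
  by_cases hk : k.1 1 0 = 0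
  · right; right; left
    exact ⟨hmulR h k hk, hmulR (g * h) k hk⟩
  right; right; right
  have tg : tau g = g.1 1 0 := if_pos hg
  have th : tau h = h.1 1 0 := if_pos hh
  have tk : tau k = k.1 1 0 := if_pos hk
  have P1 : (g * h).1 1 0 * h.1 1 1 - (g * h).1 1 1 * h.1 1 0 = g.1 1 0 := by
    rw [c1, d1]; linear_combination g.1 1 0 * D2
  have P2 : (h * k).1 1 0 * k.1 1 1 - (h * k).1 1 1 * k.1 1 0 = h.1 1 0 := by
    rw [c2, d2]; linear_combination h.1 1 0 * D3
  have P3 : (g * h * k).1 1 0 * k.1 1 1 - (g * h * k).1 1 1 * k.1 1 0 = (g * h).1 1 0 := by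
    rw [c3, d3]; linear_combination (g * h).1 1 0 * D3
  have P4 : k.1 1 0 * g.1 1 0 + (g * h * k).1 1 0 * h.1 1 0
      = (h * k).1 1 0 * (g * h).1 1 0 := by
    rw [c3, c2]; linear_combination -(k.1 1 0) * P1
  by_cases hghk : (g * h * k).1 1 0 = 0
  · left
    have P4' : k.1 1 0 * g.1 1 0 = (h * k).1 1 0 * (g * h).1 1 0 := by
      linear_combination P4 - h.1 1 0 * hghk
    have n1 : (g * h).1 1 0 ≠ 0 := by
      intro h0
      rw [h0, mul_zero] at P4'
      exact mul_ne_zero hk hg P4'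
    have n2 : (h * k).1 1 0 ≠ 0 := by
      intro h0
      rw [h0, zero_mul] at P4'
      exact mul_ne_zero hk hg P4'
    rw [tg, tk, taun _ n1, taun _ n2, tauz _ hghk]
    exact ⟨by linear_combination -P3 + k.1 1 1 * hghk, P4'⟩
  by_cases hgh : (g * h).1 1 0 = 0
  · right; left
    rw [tg, th, tk, tauz _ hgh, taun _ hghk]
    exact ⟨by linear_combination -P1 + h.1 1 1 * hgh, by linear_combination c3 + k.1 0 0 * hgh⟩
  by_cases hhk : (h * k).1 1 0 = 0
  · right; right; left
    rw [tg, th, tk, tauz _ hhk, taun _ hghk]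
    exact ⟨by linear_combination -P2 + k.1 1 1 * hhk,
      by linear_combination (h * k).1 1 1 * c4 + g.1 1 0 * D5 +
        (g.1 1 1 * (h * k).1 1 1 + g.1 1 0 * (h * k).1 0 1) * hhk⟩
  right; right; right
  rw [tg, th, tk, taun _ hgh, taun _ hhk, taun _ hghk]
  exact P4

theorem tau_cocycle (g h k : SL2) :
    hilbert (tau (g * h) * tau g) (tau (g * h) * tau h) *
      hilbert (tau (g * h * k) * tau (g * h)) (tau (g * h * k) * tau k) =
    hilbert (tau (g * (h * k)) * tau g) (tau (g * (h * k)) * tau (h * k)) *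
      hilbert (tau (h * k) * tau h) (tau (h * k) * tau k) := by
  have := tau_cocycle_add g h k
  unfold hilbertAdd at this
  revert this
  generalize hilbert _ _ = a
  generalize hilbert _ _ = b
  generalize hilbert _ _ = c
  generalize hilbert _ _ = d
  revert a b c d
  decide

theorem sigma_cocycle (g h k : SL2) :
    sigma g h * sigma (g * h) k = sigma g (h * k) * sigma h k := by
  have := tau_cocycle g h k
  unfold sigma
  rw [mul_assoc g h k] at this ⊢
  have e : ∀ a b c d p q r s t u : ℤˣ, a * b = c * d →
      a * p * q * s * (b * s * r * t) = c * p * u * t * (d * q * r * u) := by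
    decide
  exact e _ _ _ _ _ _ _ _ _ _ this

theorem sigma_one_left (g : SL2) : sigma 1 g = 1 := by
  unfold sigma
  have : hilbert (tau g) (tau g * tau g) = 1 := by
    rw [hilbert_mul_right (tau_ne_zero g) (tau_ne_zero g) (tau_ne_zero g), Int.units_mul_self]
  rw [one_mul, tau_one, mul_one, this, sgn_one, one_mul, one_mul, Int.units_mul_self]

theorem sigma_inv_comm (g : SL2) : sigma g⁻¹ g = sigma g g⁻¹ := by
  unfold sigma
  rw [inv_mul_cancel, mul_inv_cancel, hilbert_comm, mul_right_comm (hilbert _ _)]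

/-- The double cover of `SL₂(ℚ₂)`: the set `SL₂(ℚ₂) × {±1}` with the multiplication
twisted by the cocycle. -/
@[ext] structure Mp where
  /-- the underlying matrix -/
  mat : SL2
  /-- the sign -/
  sign : ℤˣ

namespace Mp

noncomputable instance : Mul Mp := ⟨fun x y => ⟨x.mat * y.mat, x.sign * y.sign * sigma x.mat y.mat⟩⟩

noncomputable instance : One Mp := ⟨⟨1, 1⟩⟩

noncomputable instance : Inv Mp := ⟨fun x => ⟨x.mat⁻¹, x.sign * sigma x.mat x.mat⁻¹⟩⟩

theorem mat_mul (x y : Mp) : (x * y).mat = x.mat * y.mat := rfl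
theorem sign_mul (x y : Mp) : (x * y).sign = x.sign * y.sign * sigma x.mat y.mat := rfl
theorem mat_one : (1 : Mp).mat = 1 := rfl
theorem sign_one : (1 : Mp).sign = 1 := rfl
theorem mat_inv (x : Mp) : (x⁻¹).mat = x.mat⁻¹ := rfl
theorem sign_inv (x : Mp) : (x⁻¹).sign = x.sign * sigma x.mat x.mat⁻¹ := rfl

noncomputable instance : Group Mp :=
  Group.ofLeftAxioms
    (fun x y z => by
      ext1
      · simp only [mat_mul, mul_assoc]
      · simp only [sign_mul, mat_mul]
        have := sigma_cocycle x.mat y.mat z.mat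
        have e : ∀ a b c p q r s : ℤˣ, p * q = r * s →
          a * b * p * c * q = a * (b * c * s) * r := by decide
        exact e _ _ _ _ _ _ _ this)
    (fun x => by
      ext1
      · simp only [mat_mul, mat_one, one_mul]
      · simp only [sign_mul, sign_one, mat_one, sigma_one_left, one_mul, mul_one])
    (fun x => by
      ext1
      · simp only [mat_mul, mat_inv, mat_one, inv_mul_cancel]
      · simp only [sign_mul, sign_inv, mat_inv, sign_one, sigma_inv_comm]
        have e : ∀ a b : ℤˣ, a * b * a * b = 1 := by decide
        exact e _ _)

end Mp


/-! ### Topology and Haar measure -/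

namespace Mp

/-- The projection to `SL₂(ℚ₂)`. -/
noncomputable def proj : Mp →* SL2 where
  toFun := Mp.mat
  map_one' := rfl
  map_mul' _ _ := rfl

/-- The set of `(k, 1)` where `k ≡ 1 mod 2ⁿ`. For `n ≥ 2` it is a subgroup, since the cover
splits over the matrices with `a ≡ d ≡ 1` and `c ≡ 0` modulo `4` through `k ↦ (k, 1)`. -/
def smallNhd (n : ℕ) : Set Mp :=
  {x | x.sign = 1 ∧ ∀ i j, ‖x.mat.1 i j - (1 : Matrix (Fin 2) (Fin 2) ℚ_[2]) i j‖ ≤ 2 ^ (-(n : ℤ))}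

/-- The topology of the double cover: a basis is given by the translates `g · smallNhd n`
with `n ≥ 2`, so that `{(k, 1) : k ≡ 1 mod 4}` is an open subgroup which is homeomorphic
to its image in `SL₂(ℚ₂)`. -/
instance : TopologicalSpace Mp :=
  TopologicalSpace.generateFrom
    {U | ∃ (g : Mp) (n : ℕ), 2 ≤ n ∧ U = (fun x => g * x) '' smallNhd n}

instance : MeasurableSpace Mp := borel Mp

instance : BorelSpace Mp := ⟨rfl⟩

end Mp

/-! ### Subgroups and elements -/

/-- `K₀(2ⁿ)`: the matrices in `SL₂(ℤ₂)` with `c ∈ 2ⁿ ℤ₂`. -/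
noncomputable def K0 (n : ℕ) : Subgroup SL2 where
  carrier := {g | (∀ i j, ‖g.1 i j‖ ≤ 1) ∧ ‖g.1 1 0‖ ≤ 2 ^ (-(n : ℤ))}
  one_mem' := by
    constructor
    · intro i j
      fin_cases i <;> fin_cases j <;> simp
    · simp
  mul_mem' := by
    rintro g h ⟨hg, hg'⟩ ⟨hh, hh'⟩
    refine ⟨fun i j => ?_, ?_⟩
    · have : (g * h).1 i j = g.1 i 0 * h.1 0 j + g.1 i 1 * h.1 1 j := by
        simp [Matrix.mul_apply, Fin.sum_univ_two]
      rw [this]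
      refine (Padic.nonarchimedean _ _).trans (max_le ?_ ?_) <;> rw [norm_mul] <;>
        exact mul_le_one₀ (hg _ _) (norm_nonneg _) (hh _ _)
    · rw [mul_c]
      refine (Padic.nonarchimedean _ _).trans (max_le ?_ ?_) <;> rw [norm_mul]
      · exact (mul_le_of_le_one_right (norm_nonneg _) (hh _ _)).trans hg'
      · exact (mul_le_of_le_one_left (norm_nonneg _) (hg _ _)).trans hh'
  inv_mem' := by
    rintro g ⟨hg, hg'⟩
    have e : g⁻¹.1 = !![g.1 1 1, -g.1 0 1; -g.1 1 0, g.1 0 0] := by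
      rw [Matrix.SpecialLinearGroup.SL2_inv_expl]
      rfl
    refine ⟨fun i j => ?_, ?_⟩
    · rw [e]
      fin_cases i <;> fin_cases j <;> simpa using hg _ _
    · rw [e]; simpa using hg'

/-- The complete inverse image of `K₀(2ⁿ)` in the double cover. -/
noncomputable def K0bar (n : ℕ) : Subgroup Mp := (K0 n).comap Mp.proj

/-- `y(s) = (1, 0; s, 1)`. -/
noncomputable def matY (s : ℚ_[2]) : SL2 := ⟨!![1, 0; s, 1], by simp [Matrix.det_fin_two]⟩

/-- `w(t) = (0, t; -t⁻¹, 0)`, for `t ≠ 0`. -/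
noncomputable def matW (t : ℚ_[2]ˣ) : SL2 :=
  ⟨!![0, (t : ℚ_[2]); -((t⁻¹ : ℚ_[2]ˣ) : ℚ_[2]), 0], by simp [Matrix.det_fin_two]⟩

/-- `h(t) = (t, 0; 0, t⁻¹)`, for `t ≠ 0`. -/
noncomputable def matH (t : ℚ_[2]ˣ) : SL2 :=
  ⟨!![(t : ℚ_[2]), 0; 0, ((t⁻¹ : ℚ_[2]ˣ) : ℚ_[2])], by simp [Matrix.det_fin_two]⟩

/-- The lift `(g, 1)` of `g` to the double cover. -/
def lift (g : SL2) : Mp := ⟨g, 1⟩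

/-- The number `2` as a unit of `ℚ₂`. -/
noncomputable def two : ℚ_[2]ˣ := Units.mk0 2 (by norm_num)

/-- The number `5` as a unit of `ℚ₂`. -/
noncomputable def five : ℚ_[2]ˣ := Units.mk0 5 (by norm_num)

theorem norm_five : ‖(5 : ℚ_[2])‖ = 1 := by
  have : ‖((5 : ℕ) : ℚ_[2])‖ = 1 := by
    rw [Padic.norm_natCast_eq_one_iff]; norm_num
  simpa using this

/-- `(-I, 1)` as an element of the inverse image of `K₀(8)`. -/
noncomputable def negOne : K0bar 3 := ⟨lift (-1), by
  refine ⟨fun i j => ?_, ?_⟩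
  · fin_cases i <;> fin_cases j <;> simp [Mp.proj, lift]
  · simp [Mp.proj, lift]⟩

/-- `(I, -1)` as an element of the inverse image of `K₀(8)`. -/
noncomputable def oneNeg : K0bar 3 := ⟨⟨1, -1⟩, (K0 3).one_mem⟩

/-- `(h(5), 1)` as an element of the inverse image of `K₀(8)`. -/
noncomputable def hFive : K0bar 3 := ⟨lift (matH five), by
  refine ⟨fun i j => ?_, ?_⟩
  · fin_cases i <;> fin_cases j <;> simp [Mp.proj, lift, matH, five, norm_five]
  · simp [Mp.proj, lift, matH]⟩

/-! ### Genuine characters and Hecke algebras -/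

/-- `χ` is (one of the two choices of) the genuine character `χ₂` of the inverse image of `K₀(8)`:
it is trivial on `K₁(8) × {1}`, it sends `(-I, 1)` to a primitive fourth root of unity, and it
sends `(h(5), 1)` to `-1`. -/
structure IsChiTwo (χ : K0bar 3 →* ℂˣ) : Prop where
  genuine : χ oneNeg = -1
  trivial_on_K1 : ∀ k : K0bar 3, ‖k.1.mat.1 0 0 - 1‖ ≤ 2 ^ (-(3 : ℤ)) → k.1.sign = 1 → χ k = 1
  negOne_primitive : IsPrimitiveRoot (χ negOne) 4
  hFive_eq : χ hFive = -1

/-- The space underlying the Hecke algebra `H(S, γ)`: the locally constant functions with compact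
support such that `f(k g k') = conj γ(k) · conj γ(k') · f(g)` for `k, k' ∈ S`. -/
def heckeSpace (S : Subgroup Mp) (γ : S →* ℂˣ) : Submodule ℂ (Mp → ℂ) where
  carrier := {f | IsLocallyConstant f ∧ HasCompactSupport f ∧
    ∀ (g : Mp) (k k' : S), f (k * g * k') = conj (γ k : ℂ) * conj (γ k' : ℂ) * f g}
  zero_mem' := ⟨IsLocallyConstant.const 0, HasCompactSupport.zero, by simp⟩
  add_mem' := by
    rintro f f' ⟨h1, h2, h3⟩ ⟨h1', h2', h3'⟩
    refine ⟨h1.add h1', h2.add h2', fun g k k' => ?_⟩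
    simp only [Pi.add_apply, h3, h3']; ring
  smul_mem' := by
    rintro c f ⟨h1, h2, h3⟩
    refine ⟨h1.comp (fun z => c • z), h2.comp_left (g := fun z : ℂ => c • z) (smul_zero c),
      fun g k k' => ?_⟩
    simp only [Pi.smul_apply, h3, smul_eq_mul]; ring

/-- Convolution of functions on the double cover with respect to the measure `μ`. -/
noncomputable def convolve (μ : MeasureTheory.Measure Mp) (f₁ f₂ : Mp → ℂ) : Mp → ℂ :=
  fun h => ∫ g, f₁ g * f₂ (g⁻¹ * h) ∂μ

/-- `f` is the function that is supported on the double coset `S x S` and is given there by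
`f(k x k') = conj γ(k) · c · conj γ(k')`. -/
def IsSupportedOn (S : Subgroup Mp) (γ : S →* ℂˣ) (x : Mp) (c : ℂ) (f : Mp → ℂ) : Prop :=
  (∀ k k' : S, f (k * x * k') = conj (γ k : ℂ) * c * conj (γ k' : ℂ)) ∧
    ∀ g, g ∉ DoubleCoset.doubleCoset x (S : Set Mp) S → f g = 0

/-- The value at `(w(2ⁿ), 1) = (h(2ⁿ), 1) (w(1), 1)` of the extension of the central character
with `γ((h(2ⁿ), 1)) = 1` and `γ((w(1), 1)) = (1 + γ((-I, 1))) / √2`. -/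
noncomputable def valW (χ : K0bar 3 →* ℂˣ) : ℂ := (1 + (χ negOne : ℂ)) / (Real.sqrt 2 : ℝ)

/-! ### The algebra given by generators and relations -/

/-- Names of the generators. -/
inductive Gen
  | U1
  | U2
  | Z

/-- The free generators. -/
noncomputable def fgen (i : Gen) : FreeAlgebra ℂ Gen := FreeAlgebra.ι ℂ i

/-- The defining relations. -/
inductive Rel : FreeAlgebra ℂ Gen → FreeAlgebra ℂ Gen → Prop
  | U1_sq : Rel (fgen .U1 * fgen .U1) 1
  | U2_sq : Rel (fgen .U2 * fgen .U2) (1 + fgen .Z)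
  | U2_Z : Rel (fgen .U2 * fgen .Z) (fgen .U2)
  | Z_U2 : Rel (fgen .Z * fgen .U2) (fgen .U2)
  | braid : Rel (fgen .U1 * fgen .Z * fgen .U1) (fgen .Z * fgen .U1 * fgen .Z)

/-- The unital associative `ℂ`-algebra given by the generators and the relations. -/
abbrev PresentedAlgebra : Type := RingQuot Rel

/-- The generators of the presented algebra. -/
noncomputable def gen (i : Gen) : PresentedAlgebra := RingQuot.mkAlgHom ℂ Rel (fgen i)

end Metaplectic

open Metaplectic

namespace Metaplectic

-- Write δ for the complex conjugate of χ, extended by zero from K to the cover; it is the unit of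
-- the Hecke algebra. The element z₀ = x(1/2) normalizes K and preserves χ (`delta_conj_z₀`), and
-- y(2) w(1/2) y(2) = z₀ in the cover (`Y_two_s₁_Y_two`), so left convolution with Z is translation
-- by z₀. The double cosets of s₁ = w(1/2) and s₂ = w(1/4) each consist of two left cosets of K,
-- represented by s₁, x(1)s₁ and by s₂, y(8)s₂. Hence the normalized U₁ and U₂ act on functions with
-- f(kg) = δ(k) f(g) as sums of two translations, scaled by (1 + δ(-I))/2.
--
-- The defining relations thereby become identities between group elements modulo K. Two facts about
-- χ enter: δ(-I)² = -1, and the commutator of x(1) and y(4) lies in K with δ = -1 there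
-- (`exists_X_mul_Y_four`). The second makes the cross terms of U₁² cancel, while those of U₂²
-- produce Z. The braid relation reflects s₁ = z₀ y(-2) z₀ and z₀ s₁ = s₁ y(-2). So the presented
-- algebra acts on left equivariant functions (`act`), and a ↦ a·δ turns products into convolutions,
-- because left translations commute with convolution by a function on the right (`toHecke_mul`).
--
-- For bijectivity, the relations force Z² = 1, and the words {1, U₁, Z U₁} (U₂U₁)^r {1, Z, U₂} span
-- the presented algebra (`wordSpan_eq_top`). Put T₀ = s₂s₁. Among the points {1, s₁, z₀s₁} T₀^r {1,
-- z₀, s₂}, the image of a word is nonzero exactly at the matching one (`supportedAt_word`), which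
-- gives injectivity. Conversely, an equivariant function that vanishes at all these points is zero
-- (`BiEquivariant.eq_zero`): factoring a matrix around a dominant entry reduces it modulo K to a
-- monomial matrix flanked by 1, z₀ or y(4), and each y(4) is either absorbed into K or forces the
-- value zero through the commutator. Surjectivity follows by subtracting a finite combination of
-- words.

local notation "K" => K0bar 3

/-! ### Hilbert symbols and squares -/

theorem hilbert_mul_sq {a b s : ℚ_[2]} (hs : s ≠ 0) : hilbert a (b * s ^ 2) = hilbert a b := by
  unfold hilbert
  rw [solvable_mul_sq hs]

theorem hilbert_sq_mul {a b s : ℚ_[2]} (hs : s ≠ 0) : hilbert (a * s ^ 2) b = hilbert a b := by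
  rw [hilbert_comm, hilbert_mul_sq hs, hilbert_comm]

theorem hilbert_sq_right (a : ℚ_[2]) {s : ℚ_[2]} : hilbert a (s ^ 2) = 1 :=
  if_pos ⟨0, 1, s, by simp, by ring⟩

theorem hilbert_sq_left (a : ℚ_[2]) {s : ℚ_[2]} : hilbert (s ^ 2) a = 1 := by
  rw [hilbert_comm, hilbert_sq_right]

theorem hilbert_one_right (a : ℚ_[2]) : hilbert a 1 = 1 :=
  if_pos ⟨0, 1, 1, by simp, by ring⟩

theorem hilbert_one_left (a : ℚ_[2]) : hilbert 1 a = 1 := by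
  rw [hilbert_comm, hilbert_one_right]

theorem norm_two : ‖(2 : ℚ_[2])‖ = 2⁻¹ := by
  have := Padic.norm_p (p := 2)
  exact_mod_cast this

theorem norm_two_inv : ‖(2 : ℚ_[2])⁻¹‖ = 2 := by rw [norm_inv, norm_two, inv_inv]

theorem valuation_two : (2 : ℚ_[2]).valuation = 1 := by
  exact_mod_cast Padic.valuation_p (p := 2)

/-- Elements of norm less than one have norm at most one half. -/
theorem norm_le_half_of_lt {a : ℚ_[2]} (h : ‖a‖ < 1) : ‖a‖ ≤ 2⁻¹ := by
  have := (Padic.norm_le_pow_iff_norm_lt_pow_add_one a (-1)).2 (by simpa using h)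
  simpa using this

theorem norm_sub_le_max (a b : ℚ_[2]) : ‖a - b‖ ≤ max ‖a‖ ‖b‖ := by
  rw [sub_eq_add_neg, ← norm_neg b]
  exact Padic.nonarchimedean _ _

theorem norm_add_le_of {a b : ℚ_[2]} {r : ℝ} (ha : ‖a‖ ≤ r) (hb : ‖b‖ ≤ r) : ‖a + b‖ ≤ r :=
  (Padic.nonarchimedean _ _).trans (max_le ha hb)

theorem norm_sub_le_of {a b : ℚ_[2]} {r : ℝ} (ha : ‖a‖ ≤ r) (hb : ‖b‖ ≤ r) : ‖a - b‖ ≤ r :=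
  (norm_sub_le_max _ _).trans (max_le ha hb)

theorem norm_mul_le_of {a b : ℚ_[2]} {r s t : ℝ} (ha : ‖a‖ ≤ r) (hb : ‖b‖ ≤ s) (h : r * s ≤ t) :
    ‖a * b‖ ≤ t := by
  rw [norm_mul]
  exact (mul_le_mul ha hb (norm_nonneg _) ((norm_nonneg _).trans ha)).trans h

theorem even_or_odd_of_norm_le_one {a : ℚ_[2]} (h : ‖a‖ ≤ 1) : ‖a‖ ≤ 2⁻¹ ∨ ‖a - 1‖ ≤ 2⁻¹ := by
  set u : ℤ_[2] := ⟨a, h⟩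
  have h2 : ∀ x : ZMod 2, x = 0 ∨ x = 1 := by decide
  rcases h2 (PadicInt.toZMod u) with h0 | h0
  · left
    have : u ∈ RingHom.ker (PadicInt.toZMod (p := 2)) := h0
    rw [PadicInt.ker_toZMod, IsLocalRing.mem_maximalIdeal, PadicInt.mem_nonunits] at this
    exact norm_le_half_of_lt this
  · right
    have : u - 1 ∈ RingHom.ker (PadicInt.toZMod (p := 2)) := by
      rw [RingHom.mem_ker, map_sub, h0, map_one, sub_self]
    rw [PadicInt.ker_toZMod, IsLocalRing.mem_maximalIdeal, PadicInt.mem_nonunits] at this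
    exact norm_le_half_of_lt this

theorem norm_sub_one_of_norm_eq_one {a : ℚ_[2]} (h : ‖a‖ = 1) : ‖a - 1‖ ≤ 2⁻¹ := by
  rcases even_or_odd_of_norm_le_one h.le with h' | h'
  · rw [h] at h'; norm_num at h'
  · exact h'

theorem norm_eq_one_of_sub_one {a : ℚ_[2]} (h : ‖a - 1‖ ≤ 2⁻¹) : ‖a‖ = 1 := by
  have h1 : ‖a - 1‖ ≠ ‖(1 : ℚ_[2])‖ := by
    rw [norm_one]; intro h'; rw [h'] at h; norm_num at h
  have := Padic.add_eq_max_of_ne h1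
  rw [sub_add_cancel, norm_one] at this
  rw [this, max_eq_right (h.trans (by norm_num))]

/-- The square of a unit is `1` modulo `8`. -/
theorem norm_sq_sub_one {a : ℚ_[2]} (h : ‖a‖ = 1) : ‖a ^ 2 - 1‖ ≤ 8⁻¹ := by
  obtain ⟨v, rfl⟩ : ∃ v, a = 1 + 2 * v := ⟨(a - 1) / 2, by ring⟩
  have hv : ‖v‖ ≤ 1 := by
    have := norm_sub_one_of_norm_eq_one h
    rw [add_sub_cancel_left, norm_mul, norm_two] at this
    linarith
  have h4 : ‖(4 : ℚ_[2])‖ = 4⁻¹ := by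
    rw [show (4 : ℚ_[2]) = 2 * 2 by norm_num, norm_mul, norm_two]; norm_num
  have e : (1 + 2 * v) ^ 2 - 1 = 4 * (v * (v + 1)) := by ring
  rw [e, norm_mul, h4]
  have : ‖v * (v + 1)‖ ≤ 2⁻¹ := by
    rcases even_or_odd_of_norm_le_one hv with h' | h'
    · exact norm_mul_le_of h' (norm_add_le_of hv norm_one.le) (by norm_num)
    · refine norm_mul_le_of hv ?_ (one_mul _).le
      rw [show v + 1 = (v - 1) + 2 by ring]
      exact norm_add_le_of h' norm_two.le
  linarith

theorem exists_sq_of_norm_sub_one {a : ℚ_[2]} (h : ‖a - 1‖ ≤ 8⁻¹) : ∃ s, s ≠ 0 ∧ a = s ^ 2 := by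
  have h1 : ‖a‖ = 1 := norm_eq_one_of_sub_one (h.trans (by norm_num))
  set u : ℤ_[2] := ⟨a, h1.le⟩ with hu
  have hk : u - 1 ∈ RingHom.ker (PadicInt.toZModPow (p := 2) 3) := by
    rw [PadicInt.ker_toZModPow]
    refine (PadicInt.norm_le_pow_iff_mem_span_pow (u - 1) 3).1 ?_
    have : ‖u - 1‖ = ‖a - 1‖ := rfl
    rw [this]
    refine h.trans ?_
    norm_num
  rw [RingHom.mem_ker, map_sub, map_one, sub_eq_zero] at hk
  obtain ⟨z, hz⟩ := isSquare_of_mod_eight hk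
  have hz' : a = (z : ℚ_[2]) ^ 2 := by
    have := congrArg (fun t : ℤ_[2] => (t : ℚ_[2])) hz
    simpa [hu] using this
  refine ⟨z, ?_, hz'⟩
  intro h0
  rw [h0] at hz'
  rw [hz'] at h1
  simp at h1

/-- The quotient is congruent to 1 modulo 8, hence a square. -/
theorem hilbert_congr_right {a b b' : ℚ_[2]} (hb : b ≠ 0) (h : ‖b' / b - 1‖ ≤ 8⁻¹) :
    hilbert a b' = hilbert a b := by
  obtain ⟨s, hs, h⟩ := exists_sq_of_norm_sub_one h
  rw [div_eq_iff hb, mul_comm] at h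
  rw [h, hilbert_mul_sq hs]

theorem hilbert_eq_one_of_near_one {a b : ℚ_[2]} (h : ‖b - 1‖ ≤ 8⁻¹) : hilbert a b = 1 := by
  rw [hilbert_congr_right one_ne_zero (by simpa using h), hilbert_one_right]

/-! ### Elements of `SL₂(ℚ₂)` -/

theorem SL2.ext_iff' {g h : SL2} : g = h ↔ g.1 0 0 = h.1 0 0 ∧ g.1 0 1 = h.1 0 1 ∧
    g.1 1 0 = h.1 1 0 ∧ g.1 1 1 = h.1 1 1 := by
  constructor
  · rintro rfl; simp
  · rintro ⟨h1, h2, h3, h4⟩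
    ext i j
    fin_cases i <;> fin_cases j <;> assumption

theorem mul_a (g h : SL2) : (g * h).1 0 0 = g.1 0 0 * h.1 0 0 + g.1 0 1 * h.1 1 0 := by
  simp [Matrix.mul_apply, Fin.sum_univ_two]

theorem mul_b (g h : SL2) : (g * h).1 0 1 = g.1 0 0 * h.1 0 1 + g.1 0 1 * h.1 1 1 := by
  simp [Matrix.mul_apply, Fin.sum_univ_two]

/-- `x(s) = (1, s; 0, 1)`. -/
noncomputable def matX (s : ℚ_[2]) : SL2 := ⟨!![1, s; 0, 1], by simp [Matrix.det_fin_two]⟩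

section entries
variable (s : ℚ_[2]) (t : ℚ_[2]ˣ)
@[simp] theorem matX_a : (matX s).1 0 0 = 1 := rfl
@[simp] theorem matX_b : (matX s).1 0 1 = s := rfl
@[simp] theorem matX_c : (matX s).1 1 0 = 0 := rfl
@[simp] theorem matX_d : (matX s).1 1 1 = 1 := rfl
@[simp] theorem matY_a : (matY s).1 0 0 = 1 := rfl
@[simp] theorem matY_b : (matY s).1 0 1 = 0 := rfl
@[simp] theorem matY_c : (matY s).1 1 0 = s := rfl
@[simp] theorem matY_d : (matY s).1 1 1 = 1 := rfl
@[simp] theorem matH_a : (matH t).1 0 0 = t := rfl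
@[simp] theorem matH_b : (matH t).1 0 1 = 0 := rfl
@[simp] theorem matH_c : (matH t).1 1 0 = 0 := rfl
@[simp] theorem matH_d : (matH t).1 1 1 = (t : ℚ_[2])⁻¹ := by simp [matH]
@[simp] theorem matW_a : (matW t).1 0 0 = 0 := rfl
@[simp] theorem matW_b : (matW t).1 0 1 = t := rfl
@[simp] theorem matW_c : (matW t).1 1 0 = -(t : ℚ_[2])⁻¹ := by simp [matW]
@[simp] theorem matW_d : (matW t).1 1 1 = 0 := rfl
end entries

theorem one_entries : (1 : SL2).1 0 0 = 1 ∧ (1 : SL2).1 0 1 = 0 ∧ (1 : SL2).1 1 0 = 0 ∧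
    (1 : SL2).1 1 1 = 1 := by simp

theorem tau_of_c_ne {g : SL2} (h : g.1 1 0 ≠ 0) : tau g = g.1 1 0 := if_pos h
theorem tau_of_c_eq {g : SL2} (h : g.1 1 0 = 0) : tau g = g.1 1 1 := if_neg (not_not.2 h)

theorem sgn_of_mul_eq_zero {g : SL2} (h : g.1 1 0 * g.1 1 1 = 0) : sgn g = 1 :=
  if_neg fun h' => h'.1 h

theorem sgn_of_even {g : SL2} (h : Even (g.1 1 0).valuation) : sgn g = 1 :=
  if_neg fun h' => (Int.not_odd_iff_even.2 h) h'.2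

theorem sgn_of_odd {g : SL2} (h : g.1 1 0 * g.1 1 1 ≠ 0) (ho : Odd (g.1 1 0).valuation) :
    sgn g = hilbert (g.1 1 0) (g.1 1 1) := if_pos ⟨h, ho⟩

theorem sgn_eq_one {g : SL2} (h : hilbert (g.1 1 0) (g.1 1 1) = 1) : sgn g = 1 := by
  unfold sgn
  split_ifs
  · exact h
  · rfl

theorem sgn_matX (s : ℚ_[2]) : sgn (matX s) = 1 := sgn_of_mul_eq_zero (by simp)
theorem sgn_matH (t : ℚ_[2]ˣ) : sgn (matH t) = 1 := sgn_of_mul_eq_zero (by simp)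
theorem sgn_matW (t : ℚ_[2]ˣ) : sgn (matW t) = 1 := sgn_of_mul_eq_zero (by simp)
theorem sgn_matY (s : ℚ_[2]) : sgn (matY s) = 1 := sgn_eq_one (by simp [hilbert_one_right])
theorem tau_matX (s : ℚ_[2]) : tau (matX s) = 1 := tau_of_c_eq (by simp)
theorem tau_matH (t : ℚ_[2]ˣ) : tau (matH t) = (t : ℚ_[2])⁻¹ := by
  rw [tau_of_c_eq (by simp), matH_d]
theorem tau_matW (t : ℚ_[2]ˣ) : tau (matW t) = -(t : ℚ_[2])⁻¹ := by
  rw [tau_of_c_ne (by simp), matW_c]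

theorem sigma_one_right (g : SL2) : sigma g 1 = 1 := by
  unfold sigma
  have : hilbert (tau g * tau g) (tau g) = 1 := by
    rw [← pow_two, hilbert_sq_left]
  rw [mul_one, tau_one, mul_one, this, sgn_one, one_mul, mul_one, Int.units_mul_self]

theorem tau_congr {g h : SL2} (hc : g.1 1 0 = h.1 1 0) (hd : g.1 1 1 = h.1 1 1) :
    tau g = tau h := by
  by_cases h0 : h.1 1 0 = 0
  · rw [tau_of_c_eq h0, tau_of_c_eq (hc.trans h0), hd]
  · rw [tau_of_c_ne h0, tau_of_c_ne (hc ▸ h0), hc]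

open Classical in
theorem sgn_congr {g h : SL2} (hc : g.1 1 0 = h.1 1 0) (hd : g.1 1 1 = h.1 1 1) :
    sgn g = sgn h := by
  unfold sgn
  exact if_congr (by rw [hc, hd]) (by rw [hc, hd]) rfl

theorem tau_matX_mul (s : ℚ_[2]) (g : SL2) : tau (matX s * g) = tau g :=
  tau_congr (by rw [mul_c, matX_c, matX_d]; ring) (by rw [mul_d, matX_c, matX_d]; ring)

theorem sgn_matX_mul (s : ℚ_[2]) (g : SL2) : sgn (matX s * g) = sgn g :=
  sgn_congr (by rw [mul_c, matX_c, matX_d]; ring) (by rw [mul_d, matX_c, matX_d]; ring)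

theorem tau_mul_matX (s : ℚ_[2]) (g : SL2) : tau (g * matX s) = tau g := by
  have hc : (g * matX s).1 1 0 = g.1 1 0 := by rw [mul_c, matX_a, matX_c]; ring
  by_cases h0 : g.1 1 0 = 0
  · rw [tau_of_c_eq h0, tau_of_c_eq (hc.trans h0), mul_d, h0, matX_d]; ring
  · rw [tau_of_c_ne h0, tau_of_c_ne (hc.symm ▸ h0), hc]

/-- `tau` and `sgn` see only the bottom row, which left multiplication by an upper unipotent matrix
preserves. -/
theorem sigma_matX_left (s : ℚ_[2]) (g : SL2) : sigma (matX s) g = 1 := by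
  unfold sigma
  rw [tau_matX_mul, sgn_matX_mul, sgn_matX, tau_matX, ← pow_two, hilbert_sq_right]
  simp

/-- Here the lower right entry may change, so a ratio of `sgn` values survives. This is the sign
that appears when K is conjugated by x(1/2). -/
theorem sigma_matX_right (s : ℚ_[2]) (g : SL2) : sigma g (matX s) = sgn g * sgn (g * matX s) := by
  unfold sigma
  rw [tau_mul_matX, sgn_matX, tau_matX, ← pow_two, hilbert_sq_left]
  simp

/-! ### Elements of the double cover -/

theorem lift_mat (g : SL2) : (lift g).mat = g := rfl
theorem lift_sign (g : SL2) : (lift g).sign = 1 := rfl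

theorem lift_mul_lift (g h : SL2) : lift g * lift h = ⟨g * h, sigma g h⟩ := by
  ext1
  · rfl
  · simp [Mp.sign_mul, lift]

theorem lift_mul_lift_of {g h : SL2} (H : sigma g h = 1) : lift g * lift h = lift (g * h) := by
  rw [lift_mul_lift, H]; rfl

theorem lift_one : lift 1 = 1 := rfl

/-- The element `(1, ε)` of the double cover. -/
noncomputable def central (e : ℤˣ) : Mp := ⟨1, e⟩

theorem mul_central (g : Mp) (e : ℤˣ) : g * central e = ⟨g.mat, g.sign * e⟩ := by
  ext1
  · simp [Mp.mat_mul, central]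
  · simp [Mp.sign_mul, central, sigma_one_right]

theorem central_mul (g : Mp) (e : ℤˣ) : central e * g = ⟨g.mat, g.sign * e⟩ := by
  ext1
  · simp [Mp.mat_mul, central]
  · simp [Mp.sign_mul, central, sigma_one_left, mul_comm]

theorem central_comm (g : Mp) (e : ℤˣ) : central e * g = g * central e := by
  rw [mul_central, central_mul]

theorem exists_central {g h : Mp} (H : g.mat = h.mat) : ∃ e, g = h * central e := by
  refine ⟨h.sign * g.sign, ?_⟩
  rw [mul_central, ← mul_assoc, Int.units_mul_self, one_mul]
  ext1
  · exact H
  · rfl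

theorem sq_eq_of_mat_eq {g h : Mp} (H : g.mat = h.mat) : g * g = h * h := by
  ext1
  · simp [Mp.mat_mul, H]
  · simp [Mp.sign_mul, H]

/-- The lift of `x(s)`. -/
noncomputable def X (s : ℚ_[2]) : Mp := lift (matX s)

/-- The lift of `y(s)`. -/
noncomputable def Y (s : ℚ_[2]) : Mp := lift (matY s)

/-- The lift of `h(t)`. -/
noncomputable def H (t : ℚ_[2]ˣ) : Mp := lift (matH t)

theorem X_mul_lift (s : ℚ_[2]) (g : SL2) : X s * lift g = lift (matX s * g) :=
  lift_mul_lift_of (sigma_matX_left s g)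

theorem lift_mul_X (s : ℚ_[2]) (g : SL2) :
    lift g * X s = ⟨g * matX s, sgn g * sgn (g * matX s)⟩ := by
  rw [X, lift_mul_lift, sigma_matX_right]

theorem matX_mul (s t : ℚ_[2]) : matX s * matX t = matX (s + t) := by
  rw [SL2.ext_iff', mul_a, mul_b, mul_c, mul_d]; simp [add_comm]

theorem matY_mul (s t : ℚ_[2]) : matY s * matY t = matY (s + t) := by
  rw [SL2.ext_iff', mul_a, mul_b, mul_c, mul_d]; simp

theorem X_add (s t : ℚ_[2]) : X (s + t) = X s * X t := by
  rw [X, ← matX_mul, ← X_mul_lift, X, X]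

theorem matX_zero : matX 0 = 1 := by
  rw [SL2.ext_iff']; simp

theorem matY_zero : matY 0 = 1 := by
  rw [SL2.ext_iff']; simp

theorem X_zero : X 0 = 1 := by rw [X, matX_zero, lift_one]

theorem Y_zero : Y 0 = 1 := by rw [Y, matY_zero, lift_one]

theorem sigma_matY (s t : ℚ_[2]) : sigma (matY s) (matY t) = 1 := by
  by_cases hs : s = 0
  · rw [hs, matY_zero, sigma_one_left]
  by_cases ht : t = 0
  · rw [ht, matY_zero, sigma_one_right]
  unfold sigma
  rw [matY_mul, sgn_matY, sgn_matY, sgn_matY]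
  rw [tau_of_c_ne (g := matY s) (by simpa), tau_of_c_ne (g := matY t) (by simpa)]
  simp only [matY_c, mul_one]
  by_cases h : s + t = 0
  · rw [h, matY_zero, tau_one, one_mul, one_mul, eq_neg_of_add_eq_zero_right h, hilbert_neg_self]
  · rw [tau_of_c_ne (g := matY (s + t)) (by simpa)]
    simp only [matY_c]
    -- Modulo the square (s + t)² the two arguments are s/(s + t) and t/(s + t), which add up to 1.
    have e1 : (s + t) * s = s / (s + t) * (s + t) ^ 2 := by field_simp
    have e2 : (s + t) * t = t / (s + t) * (s + t) ^ 2 := by field_simp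
    rw [e1, e2, hilbert_mul_sq h, hilbert_sq_mul h]
    exact hilbert_of_add_eq_one (by field_simp)

theorem Y_add (s t : ℚ_[2]) : Y (s + t) = Y s * Y t := by
  rw [Y, Y, Y, lift_mul_lift_of (sigma_matY s t), matY_mul]

theorem X_neg (s : ℚ_[2]) : X (-s) = (X s)⁻¹ := by
  rw [eq_inv_iff_mul_eq_one, ← X_add, neg_add_cancel, X_zero]

theorem Y_neg (s : ℚ_[2]) : Y (-s) = (Y s)⁻¹ := by
  rw [eq_inv_iff_mul_eq_one, ← Y_add, neg_add_cancel, Y_zero]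

/-- Since `ℚ₂` is divisible by two, the lifts of unipotent one-parameter subgroups obey the
same commutation rules as the matrices. -/
theorem one_parameter_comm {A B : ℚ_[2] → Mp} (hA : ∀ s t, A (s + t) = A s * A t)
    (hB : ∀ s t, B (s + t) = B s * B t) {g : Mp} {k : ℚ_[2]}
    (h : ∀ s, (A s).mat * g.mat = g.mat * (B (k * s)).mat) (s : ℚ_[2]) :
    A s * g = g * B (k * s) := by
  have h1 : (g⁻¹ * A (s / 2) * g).mat = (B (k * (s / 2))).mat := by
    rw [Mp.mat_mul, Mp.mat_mul, mul_assoc, h, Mp.mat_inv, inv_mul_cancel_left]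
  have h2 := sq_eq_of_mat_eq h1
  rw [← hB, show k * (s / 2) + k * (s / 2) = k * s by ring] at h2
  rw [← h2, show s = s / 2 + s / 2 by ring, hA]
  rw [show s / 2 + s / 2 = s by ring]
  group

/-- The lift of `w(t)`. -/
noncomputable def W (t : ℚ_[2]ˣ) : Mp := lift (matW t)

theorem X_mul_W (t : ℚ_[2]ˣ) (b : ℚ_[2]) : X b * W t = W t * Y (-((t : ℚ_[2]) ^ 2)⁻¹ * b) := by
  refine one_parameter_comm X_add Y_add (fun s => ?_) b
  simp only [X, Y, W, lift_mat]
  rw [SL2.ext_iff', mul_a, mul_b, mul_c, mul_d, mul_a, mul_b, mul_c, mul_d]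
  have := t.ne_zero
  simp
  field_simp

theorem Y_mul_W (t : ℚ_[2]ˣ) (c : ℚ_[2]) : Y c * W t = W t * X (-(t : ℚ_[2]) ^ 2 * c) := by
  refine one_parameter_comm Y_add X_add (fun s => ?_) c
  simp only [X, Y, W, lift_mat]
  rw [SL2.ext_iff', mul_a, mul_b, mul_c, mul_d, mul_a, mul_b, mul_c, mul_d]
  have := t.ne_zero
  simp
  field_simp

theorem X_mul_H (t : ℚ_[2]ˣ) (b : ℚ_[2]) : X b * H t = H t * X (((t : ℚ_[2]) ^ 2)⁻¹ * b) := by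
  refine one_parameter_comm X_add X_add (fun s => ?_) b
  simp only [X, H, lift_mat]
  rw [SL2.ext_iff', mul_a, mul_b, mul_c, mul_d, mul_a, mul_b, mul_c, mul_d]
  have := t.ne_zero
  simp
  field_simp

theorem H_mul_W (u t : ℚ_[2]ˣ) : H u * W t = W t * H u⁻¹ := by
  have hu := u.ne_zero
  have ht := t.ne_zero
  have e : matH u * matW t = matW (t * u) := by
    rw [SL2.ext_iff', mul_a, mul_b, mul_c, mul_d]
    simp; exact mul_comm _ _
  have e' : matW t * matH u⁻¹ = matW (t * u) := by
    rw [SL2.ext_iff', mul_a, mul_b, mul_c, mul_d]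
    simp [mul_comm]
  rw [H, W, H, lift_mul_lift, lift_mul_lift]
  ext1
  · simp only [e, e']
  · simp only [sigma, e, e', sgn_matW, sgn_matH, tau_matW, tau_matH, mul_one]
    have e2 : -((t * u : ℚ_[2]ˣ) : ℚ_[2])⁻¹ * (((u⁻¹ : ℚ_[2]ˣ) : ℚ_[2]))⁻¹ =
        -((t * u : ℚ_[2]ˣ) : ℚ_[2])⁻¹ * ((u : ℚ_[2]))⁻¹ * (u : ℚ_[2]) ^ 2 := by
      simp; field_simp
    rw [e2, hilbert_mul_sq hu, hilbert_comm]

/-- No sign arises because τ(gh)τ(g) = 1. The factor h(u⁻²) is split off because u⁻² is congruent to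
1 modulo 8 when u is a unit. -/
theorem H_inv_eq (u : ℚ_[2]ˣ) : H u⁻¹ = H u * H (u⁻¹ * u⁻¹) := by
  have hu := u.ne_zero
  have e : matH u * matH (u⁻¹ * u⁻¹) = matH u⁻¹ := by
    rw [SL2.ext_iff', mul_a, mul_b, mul_c, mul_d]
    simp
  rw [H, H, H, lift_mul_lift, e]
  ext1
  · rfl
  · simp only [sigma, e, sgn_matH, tau_matH, mul_one, lift_sign]
    have : (((u⁻¹ : ℚ_[2]ˣ) : ℚ_[2]))⁻¹ * ((u : ℚ_[2]))⁻¹ = 1 := by simp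
    rw [this, hilbert_one_left]

/-- The left factor x(t) costs no sign, and the right one costs none because y(-t⁻¹) x(t) has lower
right entry 0. -/
theorem W_eq (t : ℚ_[2]ˣ) : W t = X t * Y (-(t : ℚ_[2])⁻¹) * X t := by
  have ht := t.ne_zero
  rw [mul_assoc, Y, lift_mul_X, sgn_matY, sgn_of_mul_eq_zero (g := matY _ * _)]
  · change lift _ = X t * lift _
    rw [X_mul_lift]
    congr 1
    rw [SL2.ext_iff']
    simp only [mul_a, mul_b, mul_c, mul_d]
    simp
  · rw [mul_d]; simp

theorem sigma_matW_self (t : ℚ_[2]ˣ) (h : hilbert (t : ℚ_[2])⁻¹ (t : ℚ_[2])⁻¹ = 1) :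
    W t * W t = lift (-1) := by
  have ht := t.ne_zero
  have e : matW t * matW t = -1 := by
    rw [SL2.ext_iff', mul_a, mul_b, mul_c, mul_d]
    simp
  have h1 : tau (-1) = -1 := by rw [tau_of_c_eq] <;> simp
  have h2 : sgn (-1) = 1 := sgn_of_mul_eq_zero (by simp)
  rw [W, lift_mul_lift, e]
  simp only [sigma, e, h1, h2, sgn_matW, tau_matW, neg_mul_neg, one_mul, h]
  rfl

/-! ### Some particular elements -/

/-- The element `w(1/2)` of the double cover. -/
noncomputable def s₁ : Mp := W (two ^ (-1 : ℤ))

/-- The element `w(1/4)` of the double cover. -/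
noncomputable def s₂ : Mp := W (two ^ (-2 : ℤ))

/-- The element `x(1/2)` of the double cover. -/
noncomputable def z₀ : Mp := X 2⁻¹

/-- The lift of `-I`. -/
noncomputable def negI : Mp := lift (-1)

theorem coe_half : ((two ^ (-1 : ℤ) : ℚ_[2]ˣ) : ℚ_[2]) = 2⁻¹ := by simp [two]

theorem coe_quarter : ((two ^ (-2 : ℤ) : ℚ_[2]ˣ) : ℚ_[2]) = 4⁻¹ := by
  have : ((two ^ (-2 : ℤ) : ℚ_[2]ˣ) : ℚ_[2]) = (2 ^ (2 : ℤ))⁻¹ := by simp [two]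
  rw [this]; norm_num

theorem X_s₁ (b : ℚ_[2]) : X b * s₁ = s₁ * Y (-4 * b) := by
  rw [s₁, X_mul_W, coe_half]; norm_num

theorem Y_s₁ (c : ℚ_[2]) : Y c * s₁ = s₁ * X (-4⁻¹ * c) := by
  rw [s₁, Y_mul_W, coe_half]; norm_num

theorem X_s₂ (b : ℚ_[2]) : X b * s₂ = s₂ * Y (-16 * b) := by
  rw [s₂, X_mul_W, coe_quarter]; norm_num

theorem Y_s₂ (c : ℚ_[2]) : Y c * s₂ = s₂ * X (-16⁻¹ * c) := by
  rw [s₂, Y_mul_W, coe_quarter]; norm_num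

theorem s₁_mul_self : s₁ * s₁ = negI := by
  refine sigma_matW_self _ ?_
  rw [coe_half, inv_inv]
  -- (2, 2) = 1 because 2·1² + 2·1² = 2².
  exact if_pos ⟨1, 1, 2, by simp, by norm_num⟩

theorem s₂_mul_self : s₂ * s₂ = negI := by
  refine sigma_matW_self _ ?_
  rw [coe_quarter, inv_inv, show (4 : ℚ_[2]) = 2 ^ 2 by norm_num, hilbert_sq_left]

theorem X_negI (b : ℚ_[2]) : X b * negI = negI * X b := by
  have := one_parameter_comm X_add X_add (g := negI) (k := 1) (fun s => ?_) b
  · rwa [one_mul] at this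
  · rw [one_mul]
    simp only [negI, lift_mat, X]
    simp

theorem Y_negI (b : ℚ_[2]) : Y b * negI = negI * Y b := by
  have := one_parameter_comm Y_add Y_add (g := negI) (k := 1) (fun s => ?_) b
  · rwa [one_mul] at this
  · rw [one_mul]
    simp only [negI, lift_mat, Y]
    simp

theorem s₁_eq : s₁ = z₀ * Y (-2) * z₀ := by
  rw [s₁, W_eq, coe_half, inv_inv]; rfl

theorem Y_two : Y 2 = z₀ * s₁⁻¹ * z₀ := by
  rw [s₁_eq, Y_neg]; group

theorem Y_neg_two : Y (-2) = z₀⁻¹ * s₁ * z₀⁻¹ := by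
  rw [s₁_eq]; group

/-- This replaces the given representative for Z by x(1/2). After y(2) = z₀ s₁⁻¹ z₀ and z₀ s₁ = s₁
y(-2) with y(-2) = z₀⁻¹ s₁ z₀⁻¹, everything but one z₀ cancels. -/
theorem Y_two_s₁_Y_two : Y 2 * s₁ * Y 2 = z₀ := by
  have h : z₀ * s₁ = s₁ * Y (-2) := by rw [z₀, X_s₁]; norm_num
  have : z₀ * s₁⁻¹ * (z₀ * s₁) * (z₀ * s₁⁻¹ * z₀) = z₀ := by
    rw [h, Y_neg_two]; group
  rw [Y_two]
  simpa only [mul_assoc] using this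

/-! ### The group `K` and its character -/

theorem mem_K {g : Mp} : g ∈ K ↔ ‖g.mat.1 0 0‖ ≤ 1 ∧ ‖g.mat.1 0 1‖ ≤ 1 ∧ ‖g.mat.1 1 0‖ ≤ 8⁻¹ ∧
    ‖g.mat.1 1 1‖ ≤ 1 := by
  have e : (2 : ℝ) ^ (-((3 : ℕ) : ℤ)) = 8⁻¹ := by norm_num
  constructor
  · rintro ⟨h1, h2⟩
    rw [e] at h2
    exact ⟨h1 0 0, h1 0 1, h2, h1 1 1⟩
  · rintro ⟨h1, h2, h3, h4⟩
    refine ⟨fun i j => ?_, by rw [e]; exact h3⟩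
    fin_cases i <;> fin_cases j
    · exact h1
    · exact h2
    · exact h3.trans (by norm_num)
    · exact h4

theorem X_mem {b : ℚ_[2]} (h : ‖b‖ ≤ 1) : X b ∈ K := mem_K.2 (by simpa [X, lift_mat] using h)

theorem Y_mem {c : ℚ_[2]} (h : ‖c‖ ≤ 8⁻¹) : Y c ∈ K := mem_K.2 (by simpa [Y, lift_mat] using h)

theorem H_mem {u : ℚ_[2]ˣ} (h : ‖(u : ℚ_[2])‖ = 1) : H u ∈ K :=
  mem_K.2 (by simp [H, lift_mat, h])

theorem central_mem (e : ℤˣ) : central e ∈ K := mem_K.2 (by simp [central])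

theorem negI_mem : negI ∈ K := mem_K.2 (by simp [negI, lift_mat])

theorem norm_diag_of_mem {g : Mp} (h : g ∈ K) : ‖g.mat.1 0 0‖ = 1 ∧ ‖g.mat.1 1 1‖ = 1 := by
  obtain ⟨h1, h2, h3, h4⟩ := mem_K.1 h
  have hd := det_eq g.mat
  have h5 : ‖g.mat.1 0 0 * g.mat.1 1 1‖ = 1 := by
    apply norm_eq_one_of_sub_one
    rw [show g.mat.1 0 0 * g.mat.1 1 1 - 1 = g.mat.1 0 1 * g.mat.1 1 0 by linear_combination hd]
    exact norm_mul_le_of h2 h3 (by norm_num)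
  rw [norm_mul] at h5
  have := norm_nonneg (g.mat.1 0 0)
  have := norm_nonneg (g.mat.1 1 1)
  constructor <;> nlinarith

/-- The Iwahori factorization of `K`. -/
theorem exists_factorization {g : Mp} (h : g ∈ K) : ∃ (u : ℚ_[2]ˣ) (b c : ℚ_[2]) (e : ℤˣ),
    ‖(u : ℚ_[2])‖ = 1 ∧ ‖b‖ = ‖g.mat.1 0 1‖ ∧ ‖c‖ = ‖g.mat.1 1 0‖ ∧
    g = Y c * H u * X b * central e := by
  have h1 := (norm_diag_of_mem h).1
  have h0 : g.mat.1 0 0 ≠ 0 := by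
    intro h0; rw [h0] at h1; simp at h1
  obtain ⟨e, he⟩ := exists_central (g := g) (h := Y (g.mat.1 1 0 / g.mat.1 0 0) *
    H (Units.mk0 _ h0) * X (g.mat.1 0 1 / g.mat.1 0 0)) (by
      simp only [Mp.mat_mul, X, Y, H, lift_mat]
      rw [SL2.ext_iff']
      simp only [mul_a, mul_b, mul_c, mul_d]
      simp only [matX_a, matX_b, matX_c, matX_d, matY_a, matY_b, matY_c, matY_d, matH_a, matH_b,
        matH_c, matH_d, Units.val_mk0]
      refine ⟨by ring, by field_simp; ring, by field_simp; ring, ?_⟩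
      field_simp
      linear_combination det_eq g.mat)
  exact ⟨_, _, _, e, by simpa using h1, by rw [norm_div, h1, div_one],
    by rw [norm_div, h1, div_one], he⟩

open Classical in
/-- The complex conjugate of the character `χ` of `K`, extended by zero to the double cover. It is
the unit element of the Hecke algebra. -/
noncomputable def delta (χ : K →* ℂˣ) (g : Mp) : ℂ := if h : g ∈ K then conj (χ ⟨g, h⟩ : ℂ) else 0

variable {χ : K →* ℂˣ}

theorem delta_coe (k : K) : delta χ k = conj (χ k : ℂ) := dif_pos k.2

theorem delta_of_notMem {g : Mp} (h : g ∉ K) : delta χ g = 0 := dif_neg h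

theorem delta_ne_zero {g : Mp} (h : g ∈ K) : delta χ g ≠ 0 := by
  rw [delta_coe ⟨g, h⟩]; simp

theorem delta_mul_left {k : Mp} (h : k ∈ K) (g : Mp) : delta χ (k * g) = delta χ k * delta χ g := by
  by_cases hg : g ∈ K
  · have := delta_coe (χ := χ) (⟨k, h⟩ * ⟨g, hg⟩)
    rw [map_mul, Units.val_mul, map_mul, ← delta_coe, ← delta_coe] at this
    exact this
  · rw [delta_of_notMem hg, delta_of_notMem (by rwa [Subgroup.mul_mem_cancel_left _ h]), mul_zero]

theorem delta_mul_right {k : Mp} (h : k ∈ K) (g : Mp) :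
    delta χ (g * k) = delta χ g * delta χ k := by
  by_cases hg : g ∈ K
  · exact delta_mul_left hg k
  · rw [delta_of_notMem hg, delta_of_notMem (by rwa [Subgroup.mul_mem_cancel_right _ h]), zero_mul]

theorem delta_one : delta χ 1 = 1 := by
  have := delta_coe (χ := χ) 1
  simpa using this

theorem delta_mul_inv {k : Mp} (h : k ∈ K) : delta χ k * delta χ k⁻¹ = 1 := by
  rw [← delta_mul_left h, mul_inv_cancel, delta_one]

theorem delta_central_neg (hχ : IsChiTwo χ) : delta χ (central (-1)) = -1 := by
  have := delta_coe (χ := χ) oneNeg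
  rw [hχ.genuine] at this
  change delta χ (central (-1)) = _ at this
  simpa using this

theorem delta_near_one (hχ : IsChiTwo χ) {g : SL2} (h : lift g ∈ K) (h1 : ‖g.1 0 0 - 1‖ ≤ 8⁻¹) :
    delta χ (lift g) = 1 := by
  have e : (2 : ℝ) ^ (-(3 : ℤ)) = 8⁻¹ := by norm_num
  have := delta_coe (χ := χ) ⟨lift g, h⟩
  rw [hχ.trivial_on_K1 ⟨lift g, h⟩ (by rw [e]; exact h1) rfl] at this
  simpa using this

theorem delta_X (hχ : IsChiTwo χ) {b : ℚ_[2]} (h : ‖b‖ ≤ 1) : delta χ (X b) = 1 :=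
  delta_near_one hχ (X_mem h) (by simp)

theorem delta_Y (hχ : IsChiTwo χ) {c : ℚ_[2]} (h : ‖c‖ ≤ 8⁻¹) : delta χ (Y c) = 1 :=
  delta_near_one hχ (Y_mem h) (by simp)

theorem delta_H_five (hχ : IsChiTwo χ) : delta χ (H five) = -1 := by
  have := delta_coe (χ := χ) hFive
  rw [hχ.hFive_eq] at this
  change delta χ (H five) = _ at this
  simpa using this

theorem delta_negI_sq (hχ : IsChiTwo χ) : delta χ negI ^ 2 = -1 := by
  have h1 := hχ.negOne_primitive
  have h2 : (χ negOne) ^ 2 = -1 := by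
    have h4 : ((χ negOne) ^ 2) ^ 2 = 1 := by rw [← pow_mul]; exact h1.pow_eq_one
    have h5 : (χ negOne) ^ 2 ≠ 1 := h1.pow_ne_one_of_pos_of_lt (by norm_num) (by norm_num)
    have h6 : (((χ negOne) ^ 2 : ℂˣ) : ℂ) ^ 2 = 1 := by
      rw [← Units.val_pow_eq_pow_val, h4]; rfl
    rcases mul_self_eq_one_iff.1 ((pow_two _).symm.trans h6) with h | h
    · exact absurd (Units.ext h) h5
    · exact Units.ext h
  have := delta_coe (χ := χ) negOne
  change delta χ negI = _ at this
  rw [this, ← map_pow, ← Units.val_pow_eq_pow_val, h2]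
  simp

theorem conj_valW : conj (valW χ) = (1 + delta χ negI) / (Real.sqrt 2 : ℝ) := by
  have := delta_coe (χ := χ) negOne
  change delta χ negI = _ at this
  rw [this, valW]
  simp

/-- h(u) and h(u⁻¹) differ by h(u⁻²), which lies in K₁ since the square of a 2-adic unit is 1 modulo
8. -/
theorem delta_H_inv (hχ : IsChiTwo χ) {u : ℚ_[2]ˣ} (h : ‖(u : ℚ_[2])‖ = 1) :
    delta χ (H u⁻¹) = delta χ (H u) := by
  have hi : ‖((u⁻¹ : ℚ_[2]ˣ) : ℚ_[2])‖ = 1 := by simp [h]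
  have h2 : ‖((u⁻¹ * u⁻¹ : ℚ_[2]ˣ) : ℚ_[2])‖ = 1 := by simp [h]
  rw [H_inv_eq, delta_mul_left (H_mem h), H, H, delta_near_one hχ (H_mem h2), mul_one]
  have := norm_sq_sub_one hi
  rw [pow_two] at this
  simpa using this

/-! ### Computations with the Hilbert symbol -/

theorem valuation_of_unit_mul {x u : ℚ_[2]} (n : ℕ) (hu : ‖u‖ = 1) (h : x = u * 2 ^ n) :
    x.valuation = n := by
  have hu0 : u ≠ 0 := by rintro rfl; simp at hu
  have hv : u.valuation = 0 := by
    rw [Padic.norm_eq_zpow_neg_valuation hu0] at hu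
    have := zpow_eq_one_iff_right₀ (a := ((2 : ℕ) : ℝ)) (by norm_num) (by norm_num) |>.1 hu
    simpa using this
  rw [h, Padic.valuation_mul hu0 (by simp), Padic.valuation_pow, hv, valuation_two]
  simp

theorem norm_sq_ne_half (t : ℚ_[2]) : ‖t‖ ^ 2 ≠ 2⁻¹ := by
  intro h
  rcases lt_or_ge ‖t‖ 1 with h1 | h1
  · have := norm_le_half_of_lt h1
    nlinarith [norm_nonneg t]
  · nlinarith

/-- Suppose u² = 5 + 2v². If v is not integral, then |u|² = |v|²/2, which parity of valuations
excludes. Otherwise u is a unit, so u² is 1 modulo 8 and 4 divides v² + 2; this fails for v even and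
for v odd. -/
theorem hilbert_two_five : hilbert 2 5 = -1 := by
  refine if_neg fun h => ?_
  rw [solvable_iff_norm two_ne_zero] at h
  obtain ⟨u, v, h⟩ := h
  have h5 := norm_five
  have hv : ‖v‖ ≤ 1 := by
    by_contra! hv
    have hv2 : 2 ≤ ‖v‖ := by
      by_contra! h'
      have := (Padic.norm_le_pow_iff_norm_lt_pow_add_one v 0).2 (by simpa using h')
      simp at this
      linarith
    have h1 : ‖2 * v ^ 2‖ = 2⁻¹ * ‖v‖ ^ 2 := by rw [norm_mul, norm_pow, norm_two]
    have h2 : ‖(5 : ℚ_[2])‖ ≠ ‖2 * v ^ 2‖ := by rw [h5, h1]; nlinarith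
    have h3 := Padic.add_eq_max_of_ne h2
    rw [show 5 + 2 * v ^ 2 = u ^ 2 by rw [h]; ring, h5, h1, max_eq_right (by nlinarith),
      norm_pow] at h3
    apply norm_sq_ne_half (u / v)
    rw [norm_div, div_pow, h3]
    field_simp
  have h1 : ‖2 * v ^ 2‖ ≤ 2⁻¹ := by
    rw [norm_mul, norm_pow, norm_two]; nlinarith [norm_nonneg v]
  have hu : ‖u‖ = 1 := by
    have h3 := Padic.add_eq_max_of_ne (q := (5 : ℚ_[2])) (r := 2 * v ^ 2) (by
      rw [h5]; intro h'; rw [← h'] at h1; norm_num at h1)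
    rw [show 5 + 2 * v ^ 2 = u ^ 2 by rw [h]; ring, h5, max_eq_left (h1.trans (by norm_num)),
      norm_pow] at h3
    exact (pow_eq_one_iff_of_nonneg (norm_nonneg _) two_ne_zero).1 h3
  have h2 := norm_sq_sub_one hu
  rw [show u ^ 2 - 1 = 2 * (v ^ 2 + 2) by linear_combination -h, norm_mul, norm_two] at h2
  have hn : ‖v ^ 2‖ = ‖v‖ ^ 2 := norm_pow _ _
  rcases lt_or_eq_of_le hv with hv | hv
  · have h3 := norm_le_half_of_lt hv
    have h4 : ‖(2 : ℚ_[2])‖ ≤ 4⁻¹ := by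
      rw [show (2 : ℚ_[2]) = (v ^ 2 + 2) - v ^ 2 by ring]
      refine norm_sub_le_of (by linarith) ?_
      rw [hn]; nlinarith [norm_nonneg v]
    rw [norm_two] at h4; norm_num at h4
  · have h3 := Padic.add_eq_max_of_ne (q := v ^ 2) (r := 2) (by
      rw [hn, hv, norm_two]; norm_num)
    rw [h3, hn, hv, norm_two] at h2
    norm_num at h2

theorem hilbert_eight_five : hilbert 8 5 = -1 := by
  rw [show (8 : ℚ_[2]) = 2 * 2 ^ 2 by norm_num, hilbert_sq_mul two_ne_zero, hilbert_two_five]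

theorem H_five_mul_lift {g : SL2} (hc : g.1 1 0 ≠ 0) : H five * lift g =
    ⟨matH five * g, hilbert (g.1 1 0) 5 * sgn g * sgn (matH five * g)⟩ := by
  rw [H, lift_mul_lift]
  ext1
  · rfl
  · have e : (matH five * g).1 1 0 = g.1 1 0 / 5 := by
      rw [mul_c]; simp [five]; ring
    have h5 : (5 : ℚ_[2]) ≠ 0 := by norm_num
    simp only [sigma, tau_matH, sgn_matH, mul_one]
    rw [tau_of_c_ne hc, tau_of_c_ne (by rw [e]; exact div_ne_zero hc h5), e]
    have e1 : g.1 1 0 / 5 * ((five : ℚ_[2]ˣ) : ℚ_[2])⁻¹ = g.1 1 0 * (1 / 5) ^ 2 := by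
      simp [five]; ring
    have e2 : g.1 1 0 / 5 * g.1 1 0 = 5 * (g.1 1 0 / 5) ^ 2 := by ring
    rw [e1, e2, hilbert_mul_sq (div_ne_zero hc h5), hilbert_sq_mul (by norm_num)]

theorem norm_eight : ‖(8 : ℚ_[2])‖ = 8⁻¹ := by
  rw [show (8 : ℚ_[2]) = 2 * 2 * 2 by norm_num, norm_mul, norm_mul, norm_two]; norm_num

theorem norm_four : ‖(4 : ℚ_[2])‖ = 4⁻¹ := by
  rw [show (4 : ℚ_[2]) = 2 * 2 by norm_num, norm_mul, norm_two]; norm_num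

theorem norm_sixteen : ‖(16 : ℚ_[2])‖ = 16⁻¹ := by
  rw [show (16 : ℚ_[2]) = 4 * 4 by norm_num, norm_mul, norm_four]; norm_num

/-- The matrix `h(5)⁻¹ g`. -/
noncomputable def matFive (g : SL2) : SL2 :=
  ⟨!![g.1 0 0 / 5, g.1 0 1 / 5; 5 * g.1 1 0, 5 * g.1 1 1], by
    rw [Matrix.det_fin_two_of]
    have := det_eq g
    field_simp
    linear_combination this⟩

/-- Factor g as h(5) times `matFive g`, whose upper left entry is 1 modulo 8. The hypothesis `hs`
says that the lifts multiply without a sign, so the value is that at h(5). -/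
theorem delta_lift_of_five (hχ : IsChiTwo χ) {g : SL2} (hg : lift g ∈ K)
    (ha : ‖g.1 0 0 / 5 - 1‖ ≤ 8⁻¹) (hc : g.1 1 0 ≠ 0)
    (hs : hilbert (5 * g.1 1 0) 5 * sgn (matFive g) * sgn g = 1) :
    delta χ (lift g) = -1 := by
  set g' := matFive g with hg'
  have e : matH five * g' = g := by
    rw [SL2.ext_iff']
    simp only [mul_a, mul_b, mul_c, mul_d, matH_a, matH_b, matH_c, matH_d]
    simp [hg', matFive, five]
    refine ⟨by field_simp, by field_simp⟩
  have h1 := H_five_mul_lift (g := g') (by simpa [hg', matFive] using hc)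
  rw [e] at h1
  have h2 : H five * lift g' = lift g := by
    rw [h1]
    ext1
    · rfl
    · exact hs
  have hH : H five ∈ K := H_mem norm_five
  have h3 : lift g' ∈ K := by
    rw [← Subgroup.mul_mem_cancel_left K hH, h2]; exact hg
  rw [← h2, delta_mul_left hH, delta_H_five hχ, delta_near_one hχ h3 ha, mul_one]

/-! ### Conjugation by x(1/2). -/

theorem sl_eq_mul_matX (g : SL2) (s : ℚ_[2]) : (matX (-s) * (g * matX s)).1 0 0 =
    g.1 0 0 - s * g.1 1 0 ∧ (matX (-s) * (g * matX s)).1 0 1 =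
    g.1 0 1 + s * (g.1 0 0 - g.1 1 1) - s ^ 2 * g.1 1 0 ∧
    (matX (-s) * (g * matX s)).1 1 0 = g.1 1 0 ∧
    (matX (-s) * (g * matX s)).1 1 1 = g.1 1 1 + s * g.1 1 0 := by
  simp only [mul_a, mul_b, mul_c, mul_d, matX_a, matX_b, matX_c, matX_d]
  refine ⟨by ring, by ring, by ring, by ring⟩

theorem conj_z₀_lift (g : SL2) : z₀⁻¹ * lift g * z₀ =
    lift (matX (-2⁻¹) * (g * matX 2⁻¹)) * central (sgn g * sgn (g * matX 2⁻¹)) := by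
  rw [z₀, ← X_neg, mul_assoc, lift_mul_X, mul_central]
  ext1
  · rfl
  · simp [Mp.sign_mul, X, lift, sigma_matX_left]

theorem conj_z₀_mem {g : Mp} (hg : g ∈ K) : z₀⁻¹ * g * z₀ ∈ K := by
  obtain ⟨ha, hd⟩ := norm_diag_of_mem hg
  obtain ⟨-, hb, hc, -⟩ := mem_K.1 hg
  have e : (z₀⁻¹ * g * z₀).mat = matX (-2⁻¹) * (g.mat * matX 2⁻¹) := by
    rw [z₀, ← X_neg, mul_assoc]; rfl
  obtain ⟨h1, h2, h3, h4⟩ := sl_eq_mul_matX g.mat 2⁻¹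
  rw [mem_K, e, h1, h2, h3, h4]
  have hc' : ‖2⁻¹ * g.mat.1 1 0‖ ≤ 1 := norm_mul_le_of norm_two_inv.le hc (by norm_num)
  refine ⟨norm_sub_le_of ha.le hc', norm_sub_le_of (norm_add_le_of hb ?_) ?_, hc,
    norm_add_le_of hd.le hc'⟩
  -- Both diagonal entries are units, so their difference is even and absorbs the factor 1/2.
  · refine norm_mul_le_of (s := 2⁻¹) norm_two_inv.le ?_ (by norm_num)
    rw [show g.mat.1 0 0 - g.mat.1 1 1 = (g.mat.1 0 0 - 1) - (g.mat.1 1 1 - 1) by ring]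
    exact norm_sub_le_of (norm_sub_one_of_norm_eq_one ha) (norm_sub_one_of_norm_eq_one hd)
  · rw [pow_two, mul_assoc]
    exact norm_mul_le_of norm_two_inv.le
      (norm_mul_le_of (t := 4⁻¹) norm_two_inv.le hc (by norm_num)) (by norm_num)

/-- Here c/2 is divisible by 8, so the diagonal stays 1 modulo 8 and `sgn` does not change. -/
theorem delta_conj_z₀_Y_small (hχ : IsChiTwo χ) {c : ℚ_[2]} (h : ‖c‖ ≤ 16⁻¹) :
    delta χ (z₀⁻¹ * Y c * z₀) = 1 := by
  have hm : z₀⁻¹ * Y c * z₀ ∈ K := conj_z₀_mem (Y_mem (h.trans (by norm_num)))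
  have h2 : ‖2⁻¹ * c‖ ≤ 8⁻¹ := norm_mul_le_of norm_two_inv.le h (by norm_num)
  have hs : sgn (matY c) * sgn (matY c * matX 2⁻¹) = 1 := by
    rw [sgn_matY, one_mul]
    apply sgn_eq_one
    apply hilbert_eq_one_of_near_one
    rw [mul_d]
    simpa [mul_comm] using h2
  have e := conj_z₀_lift (matY c)
  rw [hs] at e
  change z₀⁻¹ * Y c * z₀ = _ * 1 at e
  rw [mul_one] at e
  rw [e] at hm ⊢
  apply delta_near_one hχ hm
  rw [(sl_eq_mul_matX _ _).1]
  simpa using h2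

/-- Two signs cancel. The conjugate has upper left entry -3, which is 5 modulo 8, so χ(h(5)) = -1
contributes one; the cocycle contributes (8, 5) = -1. -/
theorem delta_conj_z₀_Y_eight (hχ : IsChiTwo χ) : delta χ (z₀⁻¹ * Y 8 * z₀) = 1 := by
  have hm : z₀⁻¹ * Y 8 * z₀ ∈ K := conj_z₀_mem (Y_mem norm_eight.le)
  have v8 : (8 : ℚ_[2]).valuation = 3 :=
    valuation_of_unit_mul 3 norm_one (by norm_num)
  have hs : sgn (matY 8) * sgn (matY 8 * matX 2⁻¹) = -1 := by
    rw [sgn_matY, one_mul, sgn_of_odd]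
    · rw [mul_c, mul_d]
      simp only [matX_a, matX_b, matX_c, matX_d, matY_c, matY_d]
      rw [← hilbert_eight_five]; norm_num
    · rw [mul_c, mul_d]; simp; norm_num
    · have : (matY 8 * matX 2⁻¹).1 1 0 = 8 := by rw [mul_c]; simp
      rw [this, v8]; decide
  have e := conj_z₀_lift (matY 8)
  obtain ⟨h1, h2, h3, h4⟩ := sl_eq_mul_matX (matY 8) 2⁻¹
  rw [hs] at e
  change z₀⁻¹ * Y 8 * z₀ = _ at e
  set g := matX (-2⁻¹) * (matY 8 * matX 2⁻¹)
  simp only [matY_a, matY_b, matY_c, matY_d] at h1 h2 h3 h4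
  have hg : lift g ∈ K := by
    rw [e] at hm
    rwa [Subgroup.mul_mem_cancel_right _ (central_mem _)] at hm
  rw [e, delta_mul_right (central_mem _), delta_central_neg hχ,
    delta_lift_of_five hχ hg]
  · norm_num
  · rw [h1, show (1 - 2⁻¹ * 8) / 5 - 1 = -(8 / 5 : ℚ_[2]) by norm_num, norm_neg, norm_div,
      norm_eight, norm_five]
    norm_num
  · rw [h3]; norm_num
  · have s1 : sgn (matFive g) = 1 := by
      apply sgn_eq_one
      have : (matFive g).1 1 1 = 5 ^ 2 := by
        simp only [matFive]
        simp [h4]; norm_num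
      rw [this, hilbert_sq_right]
    have s2 : sgn g = hilbert 8 5 := by
      rw [sgn_of_odd]
      · rw [h3, h4]; norm_num
      · rw [h3, h4]; norm_num
      · rw [h3, v8]; decide
    rw [s1, s2, h3, mul_one, ← hilbert_mul_left (by norm_num) (by norm_num) (by norm_num),
      show (5 * 8 * 8 : ℚ_[2]) = 5 * 8 ^ 2 by norm_num, hilbert_sq_mul (by norm_num)]
    -- (5, 5) = 1 because 5·1² + 5·2² = 5².
    exact if_pos ⟨1, 2, 5, by simp, by norm_num⟩

theorem delta_conj_z₀_Y (hχ : IsChiTwo χ) {c : ℚ_[2]} (h : ‖c‖ ≤ 8⁻¹) :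
    delta χ (z₀⁻¹ * Y c * z₀) = 1 := by
  have h8 : ‖c / 8‖ ≤ 1 := by
    rw [norm_div, norm_eight, div_inv_eq_mul]; linarith
  rcases even_or_odd_of_norm_le_one h8 with h' | h'
  · apply delta_conj_z₀_Y_small hχ
    rw [norm_div, norm_eight, div_inv_eq_mul] at h'; linarith
  · have h1 : ‖c - 8‖ ≤ 16⁻¹ := by
      rw [show c - 8 = 8 * (c / 8 - 1) by ring, norm_mul, norm_eight]; linarith
    have e : z₀⁻¹ * Y c * z₀ = (z₀⁻¹ * Y 8 * z₀) * (z₀⁻¹ * Y (c - 8) * z₀) := by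
      rw [show c = 8 + (c - 8) by ring, Y_add]
      rw [show 8 + (c - 8) - 8 = c - 8 by ring]
      group
    rw [e, delta_mul_left (conj_z₀_mem (Y_mem norm_eight.le)), delta_conj_z₀_Y_eight hχ,
      delta_conj_z₀_Y_small hχ h1, one_mul]

/-- The element `z₀` normalizes the pair `(K, χ)`. -/
theorem delta_conj_z₀ (hχ : IsChiTwo χ) {g : Mp} (hg : g ∈ K) :
    delta χ (z₀⁻¹ * g * z₀) = delta χ g := by
  obtain ⟨u, b, c, e, hu, hb, hc, he⟩ := exists_factorization hg
  obtain ⟨-, hb', hc', -⟩ := mem_K.1 hg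
  rw [← hb] at hb'
  rw [← hc] at hc'
  have h1 : z₀⁻¹ * H u * z₀ = H u * X (-((((u : ℚ_[2]) ^ 2)⁻¹ - 1) * 2⁻¹)) := by
    rw [z₀, ← X_neg, X_mul_H, mul_assoc, ← X_add]
    congr 2; ring
  have hi : ‖((u⁻¹ : ℚ_[2]ˣ) : ℚ_[2])‖ = 1 := by simp [hu]
  -- Conjugating h(u) creates an x-factor with argument (1 - u⁻²)/2, which is integral because u⁻²
  -- is 1 modulo 8.
  have h2 : ‖-((((u : ℚ_[2]) ^ 2)⁻¹ - 1) * 2⁻¹)‖ ≤ 1 := by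
    rw [norm_neg]
    refine norm_mul_le_of (r := 8⁻¹) ?_ norm_two_inv.le (by norm_num)
    have := norm_sq_sub_one hi
    simpa using this
  have h3 : z₀⁻¹ * g * z₀ = (z₀⁻¹ * Y c * z₀) * (z₀⁻¹ * H u * z₀) * X b * central e := by
    have hx : z₀⁻¹ * X b * z₀ = X b := by
      rw [z₀, ← X_neg, ← X_add, ← X_add]; congr 1; ring
    have hz : z₀⁻¹ * central e * z₀ = central e := by
      rw [mul_assoc, central_comm, inv_mul_cancel_left]
    calc z₀⁻¹ * g * z₀ = (z₀⁻¹ * Y c * z₀) * (z₀⁻¹ * H u * z₀) * (z₀⁻¹ * X b * z₀) *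
          (z₀⁻¹ * central e * z₀) := by rw [he]; group
      _ = _ := by rw [hx, hz]
  rw [h3, h1, he, delta_mul_right (central_mem e), delta_mul_right (central_mem e),
    delta_mul_right (X_mem hb'), delta_mul_right (X_mem hb'),
    delta_mul_left (conj_z₀_mem (Y_mem hc')), delta_mul_left (Y_mem hc'),
    delta_mul_left (H_mem hu), delta_conj_z₀_Y hχ hc', delta_Y hχ hc', delta_X hχ h2, mul_one]

theorem exists_mul_z₀ (hχ : IsChiTwo χ) {g : Mp} (hg : g ∈ K) :
    ∃ g' ∈ K, g * z₀ = z₀ * g' ∧ delta χ g' = delta χ g :=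
  ⟨z₀⁻¹ * g * z₀, conj_z₀_mem hg, by group, delta_conj_z₀ hχ hg⟩

theorem z₀_sq : z₀ * z₀ = X 1 := by rw [z₀, ← X_add]; norm_num

/-- Since z₀² = x(1) lies in K, conjugation by z₀ and by z₀⁻¹ differ by an inner automorphism of K,
which does not affect χ. -/
theorem exists_z₀_mul (hχ : IsChiTwo χ) {g : Mp} (hg : g ∈ K) :
    ∃ g' ∈ K, z₀ * g = g' * z₀ ∧ delta χ g' = delta χ g := by
  have h1 : X 1 ∈ K := X_mem norm_one.le
  refine ⟨X 1 * (z₀⁻¹ * g * z₀) * (X 1)⁻¹, mul_mem (mul_mem h1 (conj_z₀_mem hg)) (inv_mem h1),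
    by rw [← z₀_sq]; group, ?_⟩
  have h2 := delta_mul_inv (χ := χ) h1
  rw [delta_mul_right (inv_mem h1), delta_mul_left h1, delta_conj_z₀ hχ hg]
  linear_combination delta χ g * h2

/-- The element `w(1/2)` intertwines `χ` on the subgroup of `K` with even upper right entry. -/
theorem exists_mul_s₁ (hχ : IsChiTwo χ) {g : Mp} (hg : g ∈ K) (h : ‖g.mat.1 0 1‖ ≤ 2⁻¹) :
    ∃ g' ∈ K, g * s₁ = s₁ * g' ∧ delta χ g' = delta χ g := by
  obtain ⟨u, b, c, e, hu, hb, hc, he⟩ := exists_factorization hg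
  obtain ⟨-, -, hc', -⟩ := mem_K.1 hg
  rw [← hb] at h
  rw [← hc] at hc'
  have hb1 : ‖b‖ ≤ 1 := h.trans (by norm_num)
  have n4 : ‖(-4 : ℚ_[2])‖ = 4⁻¹ := by rw [norm_neg, norm_four]
  have hi : ‖((u⁻¹ : ℚ_[2]ˣ) : ℚ_[2])‖ = 1 := by simp [hu]
  have h1 : ‖-4⁻¹ * c‖ ≤ 1 := by
    refine norm_mul_le_of (r := 4) ?_ hc' (by norm_num)
    rw [norm_neg, norm_inv, norm_four, inv_inv]
  have h2 : ‖-4 * b‖ ≤ 8⁻¹ := norm_mul_le_of n4.le h (by norm_num)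
  refine ⟨X (-4⁻¹ * c) * H u⁻¹ * Y (-4 * b) * central e, mul_mem (mul_mem (mul_mem (X_mem h1)
    (H_mem hi)) (Y_mem h2)) (central_mem e), ?_, ?_⟩
  · rw [he, mul_assoc _ (central e), central_comm, ← mul_assoc, mul_assoc _ (X b), X_s₁,
      ← mul_assoc, mul_assoc _ (H u), show H u * s₁ = s₁ * H u⁻¹ from H_mul_W _ _, ← mul_assoc,
      Y_s₁]
    group
  · rw [he, delta_mul_right (central_mem e), delta_mul_right (central_mem e),
      delta_mul_right (X_mem hb1), delta_mul_right (Y_mem h2), delta_mul_left (X_mem h1),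
      delta_mul_left (Y_mem hc'), delta_H_inv hχ hu, delta_X hχ hb1, delta_X hχ h1,
      delta_Y hχ h2, delta_Y hχ hc']

/-- The element `w(1/4)` intertwines `χ` on the subgroup of `K` with lower left entry divisible by
`16`. -/
theorem exists_mul_s₂ (hχ : IsChiTwo χ) {g : Mp} (hg : g ∈ K) (h : ‖g.mat.1 1 0‖ ≤ 16⁻¹) :
    ∃ g' ∈ K, g * s₂ = s₂ * g' ∧ delta χ g' = delta χ g := by
  obtain ⟨u, b, c, e, hu, hb, hc, he⟩ := exists_factorization hg
  obtain ⟨-, hb1, hc', -⟩ := mem_K.1 hg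
  rw [← hc] at h
  rw [← hc] at hc'
  rw [← hb] at hb1
  have n4 : ‖(-16 : ℚ_[2])‖ = 16⁻¹ := by rw [norm_neg, norm_sixteen]
  have hi : ‖((u⁻¹ : ℚ_[2]ˣ) : ℚ_[2])‖ = 1 := by simp [hu]
  have h1 : ‖-16⁻¹ * c‖ ≤ 1 := by
    refine norm_mul_le_of (r := 16) ?_ h (by norm_num)
    rw [norm_neg, norm_inv, norm_sixteen, inv_inv]
  have h2 : ‖-16 * b‖ ≤ 8⁻¹ := norm_mul_le_of n4.le hb1 (by norm_num)
  refine ⟨X (-16⁻¹ * c) * H u⁻¹ * Y (-16 * b) * central e, mul_mem (mul_mem (mul_mem (X_mem h1)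
    (H_mem hi)) (Y_mem h2)) (central_mem e), ?_, ?_⟩
  · rw [he, mul_assoc _ (central e), central_comm, ← mul_assoc, mul_assoc _ (X b), X_s₂,
      ← mul_assoc, mul_assoc _ (H u), show H u * s₂ = s₂ * H u⁻¹ from H_mul_W _ _, ← mul_assoc,
      Y_s₂]
    group
  · rw [he, delta_mul_right (central_mem e), delta_mul_right (central_mem e),
      delta_mul_right (X_mem hb1), delta_mul_right (Y_mem h2), delta_mul_left (X_mem h1),
      delta_mul_left (Y_mem hc'), delta_H_inv hχ hu, delta_X hχ hb1, delta_X hχ h1,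
      delta_Y hχ h2, delta_Y hχ hc']

/-- The commutator of `x(1)` and `y(4)` lies in `K`, and `χ` is not trivial there. -/
theorem exists_X_mul_Y_four (hχ : IsChiTwo χ) :
    ∃ g ∈ K, X 1 * Y 4 = Y 4 * g ∧ delta χ g = -1 := by
  set g := matY (-4) * (matX 1 * matY 4) with hg
  have h1 : (matX 1 * matY 4).1 0 0 = 5 := by rw [mul_a]; simp; norm_num
  have h2 : (matX 1 * matY 4).1 0 1 = 1 := by rw [mul_b]; simp
  have h3 : (matX 1 * matY 4).1 1 0 = 4 := by rw [mul_c]; simp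
  have h4 : (matX 1 * matY 4).1 1 1 = 1 := by rw [mul_d]; simp
  have k1 : g.1 0 0 = 5 := by rw [hg, mul_a, h1, h3]; simp
  have k2 : g.1 0 1 = 1 := by rw [hg, mul_b, h2, h4]; simp
  have k3 : g.1 1 0 = -16 := by rw [hg, mul_c, h1, h3]; simp; norm_num
  have k4 : g.1 1 1 = -3 := by rw [hg, mul_d, h2, h4]; simp; norm_num
  -- The lower left entries 4, -16 and -80 that occur have even valuation, so every `sgn` involved
  -- is trivial.
  have v4 : (4 : ℚ_[2]).valuation = 2 := valuation_of_unit_mul 2 norm_one (by norm_num)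
  have v16 : (-16 : ℚ_[2]).valuation = 4 :=
    valuation_of_unit_mul (u := -1) 4 (by simp) (by norm_num)
  have hmem : lift g ∈ K := by
    rw [mem_K, lift_mat, k1, k2, k3, k4]
    refine ⟨norm_five.le, norm_one.le, ?_, ?_⟩
    · rw [norm_neg, norm_sixteen]; norm_num
    · rw [norm_neg]
      exact_mod_cast Padic.norm_int_le_one (p := 2) 3
  have hsg : sgn g = 1 := sgn_of_even (by rw [k3, v16]; decide)
  have hsi : sigma (matY (-4)) (matX 1 * matY 4) = 1 := by
    simp only [sigma]
    rw [← hg, hsg, sgn_matY, sgn_of_even (g := matX 1 * matY 4) (by rw [h3, v4]; decide),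
      tau_of_c_ne (g := g) (by rw [k3]; norm_num), tau_of_c_ne (g := matX 1 * matY 4)
      (by rw [h3]; norm_num), tau_of_c_ne (g := matY (-4)) (by simp), k3, h3]
    simp only [matY_c, mul_one]
    rw [show (-16 * -4 : ℚ_[2]) = 8 ^ 2 by norm_num, hilbert_sq_left]
  have e : Y (-4) * (X 1 * Y 4) = lift g := by
    rw [Y, Y, X_mul_lift, lift_mul_lift_of hsi]
  refine ⟨lift g, hmem, by rw [← e, Y_neg, mul_inv_cancel_left], ?_⟩
  refine delta_lift_of_five hχ hmem ?_ ?_ ?_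
  · rw [k1]; norm_num
  · rw [k3]; norm_num
  · rw [hsg, mul_one, k3, sgn_of_even, mul_one]
    · rw [show (5 * -16 : ℚ_[2]) = (-5) * 4 ^ 2 by norm_num, hilbert_sq_mul (by norm_num),
        hilbert_comm, hilbert_neg_self]
    · have : (matFive g).1 1 0 = -5 * 2 ^ 4 := by
        simp only [matFive]
        simp [k3]; norm_num
      rw [valuation_of_unit_mul 4 (by rw [norm_neg, norm_five]) this]
      decide

theorem exists_Y_four_mul_X (hχ : IsChiTwo χ) :
    ∃ g ∈ K, Y 4 * X 1 = g * Y 4 ∧ delta χ g = -1 := by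
  obtain ⟨g, hg, h1, h2⟩ := exists_X_mul_Y_four hχ
  have h8 : Y 8 ∈ K := Y_mem norm_eight.le
  -- Conjugation by y(8) = y(4)², an element of K, interchanges the two orders of the commutator.
  have e : Y 8 = Y 4 * Y 4 := by rw [← Y_add]; norm_num
  refine ⟨Y 8 * g * (Y 8)⁻¹, mul_mem (mul_mem h8 hg) (inv_mem h8), ?_, ?_⟩
  · rw [e, mul_assoc (Y 4) (Y 4) g, ← h1]; group
  · have h3 := delta_mul_inv (χ := χ) h8
    rw [delta_mul_right (inv_mem h8), delta_mul_left h8, h2]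
    linear_combination (-1 : ℂ) * h3

/-! ### The generators as operators on left equivariant functions -/

/-- Functions `F` with `F(x k) = δ(k)⁻¹ F(x)` for `k` in `K`. -/
def RightCovariant (χ : K →* ℂˣ) (F : Mp → ℂ) : Prop :=
  ∀ x, ∀ k ∈ K, F (x * k) = (delta χ k)⁻¹ * F x

theorem RightCovariant.of_eq_one {F : Mp → ℂ} (hF : RightCovariant χ F) (x : Mp) {k : Mp}
    (hk : k ∈ K) (h : delta χ k = 1) : F (x * k) = F x := by
  rw [hF x k hk, h, inv_one, one_mul]

/-- The scalar `conj ζ / √2`. -/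
noncomputable def opCoeff (χ : K →* ℂˣ) : ℂ := (1 + delta χ negI) / 2

/-- With i = δ(-I) a square root of -1, this is (1 + i)² = 2i. -/
theorem opCoeff_sq (hχ : IsChiTwo χ) : opCoeff χ * opCoeff χ = delta χ negI / 2 := by
  rw [opCoeff]
  linear_combination (1 / 4 : ℂ) * delta_negI_sq hχ

theorem delta_negI_inv (hχ : IsChiTwo χ) : (delta χ negI)⁻¹ = -delta χ negI :=
  inv_eq_of_mul_eq_one_right (by linear_combination -delta_negI_sq hχ)

theorem opCoeff_ne_zero (hχ : IsChiTwo χ) : opCoeff χ ≠ 0 := by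
  intro h
  have h1 := opCoeff_sq hχ
  have := delta_ne_zero (χ := χ) negI_mem
  rw [h, zero_mul] at h1
  apply this
  linear_combination (-2 : ℂ) * h1

/-! ### The defining relations as identities for right covariant functions. -/

section relations
variable {F : Mp → ℂ}

theorem exists_X_mul_Y_neg_four (hχ : IsChiTwo χ) :
    ∃ g ∈ K, X 1 * Y (-4) = Y (-4) * g ∧ delta χ g = -1 := by
  obtain ⟨g, hg, h1, h2⟩ := exists_X_mul_Y_four hχ
  have h8 : Y 8 ∈ K := Y_mem norm_eight.le
  have e : Y (-4) = Y 4 * (Y 8)⁻¹ := by rw [← Y_neg, ← Y_add]; norm_num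
  refine ⟨Y 8 * g * (Y 8)⁻¹, mul_mem (mul_mem h8 hg) (inv_mem h8), ?_, ?_⟩
  · rw [e, ← mul_assoc, h1]; group
  · have h3 := delta_mul_inv (χ := χ) h8
    rw [delta_mul_right (inv_mem h8), delta_mul_left h8, h2]
    linear_combination (-1 : ℂ) * h3

/-- The terms ending in s₁s₁ = -I each give a multiple of F(1). The other two involve y(-4) and
x(1)y(-4), on which F takes opposite values because the commutator has δ = -1. -/
theorem relation_U₁_sq (hχ : IsChiTwo χ) (hF : RightCovariant χ F) :
    opCoeff χ * opCoeff χ * (F (s₁ * s₁) + F (s₁ * (X 1 * s₁)) + F (X 1 * s₁ * s₁) +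
      F (X 1 * s₁ * (X 1 * s₁))) = F 1 := by
  obtain ⟨g, hg, h1, h2⟩ := exists_X_mul_Y_neg_four hχ
  have e1 : F (s₁ * s₁) = -delta χ negI * F 1 := by
    have := hF 1 negI negI_mem
    rw [one_mul] at this
    rw [s₁_mul_self, this, delta_negI_inv hχ]
  have e2 : F (X 1 * s₁ * s₁) = -delta χ negI * F 1 := by
    rw [mul_assoc, s₁_mul_self, hF _ _ negI_mem, delta_negI_inv hχ, ← one_mul (X 1),
      hF.of_eq_one _ (X_mem norm_one.le) (delta_X hχ norm_one.le)]
  have e3 : F (X 1 * s₁ * (X 1 * s₁)) = -F (s₁ * (X 1 * s₁)) := by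
    have h3 : s₁ * (X 1 * s₁) = Y (-4) * negI := by
      rw [X_s₁, ← mul_assoc, s₁_mul_self, Y_negI, mul_one]
    rw [mul_assoc, h3, ← mul_assoc, h1, hF _ _ negI_mem, hF _ _ negI_mem, hF _ _ hg, h2]
    norm_num
  rw [e1, e2, e3, opCoeff_sq hχ]
  linear_combination (-F 1) * delta_negI_sq hχ

/-- In contrast to U₁², the cross terms do not cancel: s₂ y(8) s₂ lies in z₀K, and y(8) passes
through z₀ inside the kernel of χ, so both give the value at z₀. -/
theorem relation_U₂_sq (hχ : IsChiTwo χ) (hF : RightCovariant χ F) :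
    opCoeff χ * opCoeff χ * (F (s₂ * s₂) + F (s₂ * (Y 8 * s₂)) + F (Y 8 * s₂ * s₂) +
      F (Y 8 * s₂ * (Y 8 * s₂))) = F 1 + F z₀ := by
  have h8 : ‖(8 : ℚ_[2])‖ ≤ 8⁻¹ := norm_eight.le
  have e1 : F (s₂ * s₂) = -delta χ negI * F 1 := by
    have := hF 1 negI negI_mem
    rw [one_mul] at this
    rw [s₂_mul_self, this, delta_negI_inv hχ]
  have e2 : F (Y 8 * s₂ * s₂) = -delta χ negI * F 1 := by
    rw [mul_assoc, s₂_mul_self, hF _ _ negI_mem, delta_negI_inv hχ, ← one_mul (Y 8),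
      hF.of_eq_one _ (Y_mem h8) (delta_Y hχ h8)]
  have h3 : s₂ * (Y 8 * s₂) = z₀ * X (-1) * negI := by
    rw [Y_s₂, ← mul_assoc, s₂_mul_self, z₀, ← X_add, X_negI]; norm_num
  have e3 : F (s₂ * (Y 8 * s₂)) = -delta χ negI * F z₀ := by
    have : ‖(-1 : ℚ_[2])‖ ≤ 1 := by simp
    rw [h3, hF _ _ negI_mem, delta_negI_inv hχ, hF.of_eq_one _ (X_mem this) (delta_X hχ this)]
  have e4 : F (Y 8 * s₂ * (Y 8 * s₂)) = -delta χ negI * F z₀ := by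
    obtain ⟨g, hg, h5, h6⟩ := exists_mul_z₀ hχ (Y_mem h8)
    have : ‖(-1 : ℚ_[2])‖ ≤ 1 := by simp
    rw [mul_assoc, h3, ← mul_assoc, ← mul_assoc, h5, hF _ _ negI_mem, delta_negI_inv hχ,
      hF.of_eq_one _ (X_mem this) (delta_X hχ this), hF.of_eq_one _ hg (h6.trans (delta_Y hχ h8))]
  rw [e1, e2, e3, e4, opCoeff_sq hχ]
  linear_combination (-F 1 - F z₀) * delta_negI_sq hχ

theorem s₂_z₀ : s₂ * z₀ = Y (-8) * s₂ := by rw [Y_s₂, z₀]; norm_num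

theorem z₀_s₂ : z₀ * s₂ = s₂ * Y (-8) := by rw [z₀, X_s₂]; norm_num

theorem norm_neg_eight : ‖(-8 : ℚ_[2])‖ ≤ 8⁻¹ := by rw [norm_neg, norm_eight]

/-- Right multiplication by z₀ interchanges the left cosets of s₂ and y(8)s₂, with trivial
characters. -/
theorem relation_U₂_Z (hχ : IsChiTwo χ) (hF : RightCovariant χ F) :
    F (s₂ * z₀) + F (Y 8 * s₂ * z₀) = F s₂ + F (Y 8 * s₂) := by
  have e1 : s₂ * z₀ = Y 8 * s₂ * X 1 := by
    rw [s₂_z₀, mul_assoc, show s₂ * X 1 = Y (-16) * s₂ by rw [Y_s₂]; norm_num, ← mul_assoc,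
      ← Y_add]
    norm_num
  have e2 : Y 8 * s₂ * z₀ = s₂ := by
    rw [mul_assoc, s₂_z₀, ← mul_assoc, ← Y_add]; norm_num [Y_zero]
  rw [e2, e1, hF.of_eq_one _ (X_mem norm_one.le) (delta_X hχ norm_one.le), add_comm]

/-- Left multiplication by z₀ fixes both left cosets. For y(8)s₂ this holds because z₀ y(8) z₀⁻¹
agrees with y(8) up to an element whose lower left entry is divisible by 16, and such elements pass
through s₂. -/
theorem relation_Z_U₂ (hχ : IsChiTwo χ) (hF : RightCovariant χ F) :
    F (z₀ * s₂) + F (z₀ * (Y 8 * s₂)) = F s₂ + F (Y 8 * s₂) := by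
  have h8 : ‖(8 : ℚ_[2])‖ ≤ 8⁻¹ := norm_eight.le
  rw [z₀_s₂, hF.of_eq_one _ (Y_mem norm_neg_eight) (delta_Y hχ norm_neg_eight)]
  obtain ⟨g, hg, h1, h2⟩ := exists_z₀_mul hχ (Y_mem h8)
  rw [delta_Y hχ h8] at h2
  have hm : Y (-8) * g ∈ K := mul_mem (Y_mem norm_neg_eight) hg
  -- The conjugate g has first column (5, 8), so the entry in question is -8·5 + 8 = -32.
  have hc : ‖(Y (-8) * g).mat.1 1 0‖ ≤ 16⁻¹ := by
    have e : g.mat = matX (-(-2⁻¹)) * (matY 8 * matX (-2⁻¹)) := by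
      have h3 : g = z₀ * Y 8 * X (-2⁻¹) := by rw [h1, X_neg, z₀, mul_inv_cancel_right]
      rw [h3, neg_neg, ← mul_assoc]; rfl
    obtain ⟨k1, -, k3, -⟩ := sl_eq_mul_matX (matY 8) (-2⁻¹)
    rw [Mp.mat_mul, mul_c, e, k1, k3]
    simp only [Y, lift_mat, matY_a, matY_c, matY_d]
    rw [show (-8 * (1 - -2⁻¹ * 8) + 1 * 8 : ℚ_[2]) = -2 * 16 by norm_num, norm_mul, norm_neg,
      norm_two, norm_sixteen]
    norm_num
  obtain ⟨g', hg', h3, h4⟩ := exists_mul_s₂ hχ hm hc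
  rw [delta_mul_left (Y_mem norm_neg_eight), delta_Y hχ norm_neg_eight, h2, one_mul] at h4
  have e : z₀ * (Y 8 * s₂) = Y 8 * s₂ * g' * Y (-8) := by
    rw [← mul_assoc, h1, mul_assoc, z₀_s₂, mul_assoc (Y 8), ← h3, ← mul_assoc, ← mul_assoc,
      ← mul_assoc, ← Y_add]
    norm_num [Y_zero]
  rw [e, hF.of_eq_one _ (Y_mem norm_neg_eight) (delta_Y hχ norm_neg_eight), hF.of_eq_one _ hg' h4]

theorem RightCovariant.mul_s₁_inv_z₀ (hF : RightCovariant χ F) (x : Mp) :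
    F (x * (s₁⁻¹ * z₀)) = delta χ negI * F (x * (s₁ * z₀)) := by
  have h : s₁ * z₀ = s₁⁻¹ * z₀ * negI := by
    rw [mul_assoc, z₀, X_negI, ← s₁_mul_self]; group
  rw [h, ← mul_assoc x _ negI, hF _ _ negI_mem, mul_inv_cancel_left₀ (delta_ne_zero negI_mem)]

theorem RightCovariant.mul_z₀_inv (hχ : IsChiTwo χ) (hF : RightCovariant χ F) (x : Mp) :
    F (x * z₀⁻¹) = F (x * z₀) := by
  have h : z₀ = z₀⁻¹ * X 1 := by rw [← z₀_sq]; group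
  nth_rewrite 2 [h]
  rw [← mul_assoc, hF.of_eq_one _ (X_mem norm_one.le) (delta_X hχ norm_one.le)]

/-- In the group, s₁ z₀ s₁ equals z₀⁻¹ s₁ z₀⁻¹ times -I. Modulo K the four products on the left thus
become x(±1/2) s₁ z₀, each occurring twice with total weight 1 - δ(-I); the right side has the same
two points with weight one. -/
theorem relation_braid (hχ : IsChiTwo χ) (hF : RightCovariant χ F) :
    opCoeff χ * opCoeff χ * (F (s₁ * (z₀ * s₁)) + F (s₁ * (z₀ * (X 1 * s₁))) +
      F (X 1 * s₁ * (z₀ * s₁)) + F (X 1 * s₁ * (z₀ * (X 1 * s₁)))) =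
    opCoeff χ * (F (z₀ * (s₁ * z₀)) + F (z₀ * (X 1 * s₁ * z₀))) := by
  have key1 : ∀ x, F (x * (s₁ * (z₀ * s₁))) = -delta χ negI * F (x * (z₀⁻¹ * s₁ * z₀)) := by
    intro x
    have : s₁ * (z₀ * s₁) = z₀⁻¹ * s₁ * z₀⁻¹ * negI := by
      rw [← Y_neg_two, z₀, X_s₁, Y_negI, ← mul_assoc, s₁_mul_self]; norm_num
    rw [this, ← mul_assoc, hF _ _ negI_mem, delta_negI_inv hχ, ← mul_assoc x _ z₀⁻¹,
      hF.mul_z₀_inv hχ, mul_assoc]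
  have key2 : ∀ x, F (x * (s₁ * (z₀ * (X 1 * s₁)))) = F (x * (z₀ * s₁ * z₀)) := by
    intro x
    have : s₁ * (z₀ * (X 1 * s₁)) = z₀ * s₁⁻¹ * z₀ * Y (-8) * negI := by
      rw [← Y_two, ← Y_add, Y_negI, z₀, ← mul_assoc (X _), ← X_add, X_s₁, ← mul_assoc,
        s₁_mul_self]
      norm_num
    rw [this, ← mul_assoc, hF _ _ negI_mem, ← mul_assoc,
      hF.of_eq_one _ (Y_mem norm_neg_eight) (delta_Y hχ norm_neg_eight), mul_assoc z₀, ← mul_assoc x,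
      hF.mul_s₁_inv_z₀, inv_mul_cancel_left₀ (delta_ne_zero negI_mem)]
    simp only [mul_assoc]
  -- The arguments 3/2 and -1/2 differ by 2, and x(2) crosses s₁ as y(-8), which z₀ carries into the
  -- kernel of χ.
  have key3 : F (X (3 / 2) * (s₁ * z₀)) = F (X (-2⁻¹) * (s₁ * z₀)) := by
    obtain ⟨g, hg, h1, h2⟩ := exists_mul_z₀ hχ (Y_mem norm_neg_eight)
    have : X (3 / 2) * (s₁ * z₀) = X (-2⁻¹) * (s₁ * z₀) * g := by
      rw [show (3 / 2 : ℚ_[2]) = -2⁻¹ + 2 by norm_num, X_add, mul_assoc, ← mul_assoc (X 2), X_s₁]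
      rw [show (-4 * 2 : ℚ_[2]) = -8 by norm_num, mul_assoc, h1]
      simp only [mul_assoc]
    rw [this, hF.of_eq_one _ hg (h2.trans (delta_Y hχ norm_neg_eight))]
  have a1 := key1 1
  have a2 := key2 1
  have a3 := key1 (X 1)
  have a4 := key2 (X 1)
  rw [one_mul, one_mul] at a1 a2
  rw [mul_assoc (X 1), mul_assoc (X 1), a1, a2, a3, a4]
  have b1 : z₀⁻¹ * s₁ * z₀ = X (-2⁻¹) * (s₁ * z₀) := by rw [X_neg, z₀, mul_assoc]
  have b2 : X 1 * (z₀⁻¹ * s₁ * z₀) = X 2⁻¹ * (s₁ * z₀) := by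
    rw [b1, ← mul_assoc, ← X_add]; norm_num
  have b3 : z₀ * s₁ * z₀ = X 2⁻¹ * (s₁ * z₀) := by rw [mul_assoc, z₀]
  have b4 : X 1 * (z₀ * s₁ * z₀) = X (3 / 2) * (s₁ * z₀) := by
    rw [b3, ← mul_assoc, ← X_add]; norm_num
  have b5 : z₀ * (X 1 * s₁ * z₀) = X (3 / 2) * (s₁ * z₀) := by
    rw [z₀, mul_assoc (X 1), ← mul_assoc, ← X_add]; norm_num
  rw [b2, b4, b5, b1, b3, key3, ← mul_assoc z₀, b3]
  -- The weights match because (1 + δ(-I))(1 - δ(-I))/2 = 1.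
  rw [opCoeff]
  linear_combination (-(1 + delta χ negI) / 4 * (F (X 2⁻¹ * (s₁ * z₀)) +
    F (X (-2⁻¹) * (s₁ * z₀)))) * delta_negI_sq hχ

/-- Elements of K permute the left cosets of s₁ and x(1)s₁. Those with even upper right entry pass
through s₁ without changing χ, and a correction by x(±1) reduces to this case. -/
theorem sum_s₁_mul_left (hχ : IsChiTwo χ) (hF : RightCovariant χ F) {m : Mp} (hm : m ∈ K) :
    F (m * s₁) + F (m * (X 1 * s₁)) = (delta χ m)⁻¹ * (F s₁ + F (X 1 * s₁)) := by
  have h1 : X 1 ∈ K := X_mem norm_one.le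
  have d1 : delta χ (X 1) = 1 := delta_X hχ norm_one.le
  have hn1 : ‖(-1 : ℚ_[2])‖ ≤ 1 := by simp
  have h2 : X (-1) ∈ K := X_mem hn1
  have d2 : delta χ (X (-1)) = 1 := delta_X hχ hn1
  have key : ∀ x, ∀ g ∈ K, ‖g.mat.1 0 1‖ ≤ 2⁻¹ →
      F (x * (g * s₁)) = (delta χ g)⁻¹ * F (x * s₁) := by
    intro x g hg h
    obtain ⟨g', hg', e, hd⟩ := exists_mul_s₁ hχ hg h
    rw [e, ← mul_assoc, hF _ _ hg', hd]
  obtain ⟨ha, hd⟩ := norm_diag_of_mem hm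
  obtain ⟨-, hb, hc, -⟩ := mem_K.1 hm
  have ha' := norm_sub_one_of_norm_eq_one ha
  have hd' := norm_sub_one_of_norm_eq_one hd
  have bX : ∀ (g : Mp) s, (g * X s).mat.1 0 1 = g.mat.1 0 0 * s + g.mat.1 0 1 := fun g s => by
    rw [Mp.mat_mul, mul_b]; simp [X, lift_mat]
  have Xb : ∀ (g : Mp) s, (X s * g).mat.1 0 1 = g.mat.1 0 1 + s * g.mat.1 1 1 := fun g s => by
    rw [Mp.mat_mul, mul_b]; simp [X, lift_mat]
  -- The parity of the upper right entry decides whether the two cosets are fixed or interchanged.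
  rcases even_or_odd_of_norm_le_one hb with h | h
  · have k1 := key 1 m hm h
    have hm' : X (-1) * (m * X 1) ∈ K := mul_mem h2 (mul_mem hm h1)
    have k2 := key (X 1) (X (-1) * (m * X 1)) hm' (by
      have hX : ∀ (g : Mp) s, (g * X s).mat.1 1 1 = g.mat.1 1 0 * s + g.mat.1 1 1 := fun g s => by
        rw [Mp.mat_mul, mul_d]; simp [X, lift_mat]
      rw [Xb, bX, hX, show m.mat.1 0 0 * 1 + m.mat.1 0 1 + -1 * (m.mat.1 1 0 * 1 + m.mat.1 1 1) =
        (m.mat.1 0 0 - 1) + m.mat.1 0 1 - (m.mat.1 1 0 + (m.mat.1 1 1 - 1)) by ring]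
      exact norm_sub_le_of (norm_add_le_of ha' h) (norm_add_le_of (hc.trans (by norm_num)) hd'))
    rw [delta_mul_left h2, delta_mul_left hm, d1, d2, one_mul, mul_one] at k2
    rw [one_mul, one_mul] at k1
    rw [k1, mul_add, ← k2]
    congr 2
    rw [X_neg]; group
  · have k1 := key (X 1) (X (-1) * m) (mul_mem h2 hm) (by
      rw [Xb, show m.mat.1 0 1 + -1 * m.mat.1 1 1 = (m.mat.1 0 1 - 1) - (m.mat.1 1 1 - 1) by ring]
      exact norm_sub_le_of h hd')
    have k2 := key 1 (m * X 1) (mul_mem hm h1) (by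
      rw [bX, show m.mat.1 0 0 * 1 + m.mat.1 0 1 =
        (m.mat.1 0 0 - 1) + (m.mat.1 0 1 - 1) + 2 by ring]
      exact norm_add_le_of (norm_add_le_of ha' h) norm_two.le)
    rw [delta_mul_left h2, d2, one_mul] at k1
    rw [delta_mul_left hm, d1, mul_one, one_mul, one_mul] at k2
    rw [mul_add, ← k1, ← k2, add_comm]
    congr 2
    · group
    · rw [X_neg]; group

/-- The same argument with y(8) in place of x(1): what matters is the parity of c/8, where c is the
lower left entry. -/
theorem sum_s₂_mul_left (hχ : IsChiTwo χ) (hF : RightCovariant χ F) {m : Mp} (hm : m ∈ K) :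
    F (m * s₂) + F (m * (Y 8 * s₂)) = (delta χ m)⁻¹ * (F s₂ + F (Y 8 * s₂)) := by
  have h8 : ‖(8 : ℚ_[2])‖ ≤ 8⁻¹ := norm_eight.le
  have h1 : Y 8 ∈ K := Y_mem h8
  have d1 : delta χ (Y 8) = 1 := delta_Y hχ h8
  have h2 : Y (-8) ∈ K := Y_mem norm_neg_eight
  have d2 : delta χ (Y (-8)) = 1 := delta_Y hχ norm_neg_eight
  have key : ∀ x, ∀ g ∈ K, ‖g.mat.1 1 0‖ ≤ 16⁻¹ →
      F (x * (g * s₂)) = (delta χ g)⁻¹ * F (x * s₂) := by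
    intro x g hg h
    obtain ⟨g', hg', e, hd⟩ := exists_mul_s₂ hχ hg h
    rw [e, ← mul_assoc, hF _ _ hg', hd]
  obtain ⟨ha, hd⟩ := norm_diag_of_mem hm
  obtain ⟨-, hb, hc, -⟩ := mem_K.1 hm
  have ha' := norm_sub_one_of_norm_eq_one ha
  have hd' := norm_sub_one_of_norm_eq_one hd
  have cY : ∀ (g : Mp) s, (g * Y s).mat.1 1 0 = g.mat.1 1 0 + g.mat.1 1 1 * s := fun g s => by
    rw [Mp.mat_mul, mul_c]; simp [Y, lift_mat]
  have Yc : ∀ (g : Mp) s, (Y s * g).mat.1 1 0 = s * g.mat.1 0 0 + g.mat.1 1 0 := fun g s => by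
    rw [Mp.mat_mul, mul_c]; simp [Y, lift_mat]
  have n8 : ∀ {t : ℚ_[2]}, ‖t‖ ≤ 2⁻¹ → ‖8 * t‖ ≤ 16⁻¹ := fun ht =>
    norm_mul_le_of h8 ht (by norm_num)
  have hc8 : ‖m.mat.1 1 0 / 8‖ ≤ 1 := by
    rw [norm_div, norm_eight, div_inv_eq_mul]; linarith
  rcases even_or_odd_of_norm_le_one hc8 with h | h
  · have h16 := n8 h
    rw [mul_div_cancel₀ _ (by norm_num)] at h16
    have k1 := key 1 m hm h16
    have hm' : Y (-8) * (m * Y 8) ∈ K := mul_mem h2 (mul_mem hm h1)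
    have k2 := key (Y 8) (Y (-8) * (m * Y 8)) hm' (by
      have hY : ∀ (g : Mp) s, (g * Y s).mat.1 0 0 = g.mat.1 0 0 + g.mat.1 0 1 * s := fun g s => by
        rw [Mp.mat_mul, mul_a]; simp [Y, lift_mat]
      rw [Yc, cY, hY, show -8 * (m.mat.1 0 0 + m.mat.1 0 1 * 8) + (m.mat.1 1 0 + m.mat.1 1 1 * 8) =
        8 * ((m.mat.1 1 1 - 1) - (m.mat.1 0 0 - 1) - 8 * m.mat.1 0 1 + m.mat.1 1 0 / 8) by ring]
      refine n8 (norm_add_le_of (norm_sub_le_of (norm_sub_le_of hd' ha') ?_) h)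
      exact norm_mul_le_of h8 hb (by norm_num))
    rw [delta_mul_left h2, delta_mul_left hm, d1, d2, one_mul, mul_one] at k2
    rw [one_mul, one_mul] at k1
    rw [k1, mul_add, ← k2]
    congr 2
    rw [Y_neg]; group
  · have k1 := key (Y 8) (Y (-8) * m) (mul_mem h2 hm) (by
      rw [Yc, show -8 * m.mat.1 0 0 + m.mat.1 1 0 =
        8 * ((m.mat.1 1 0 / 8 - 1) - (m.mat.1 0 0 - 1)) by ring]
      exact n8 (norm_sub_le_of h ha'))
    have k2 := key 1 (m * Y 8) (mul_mem hm h1) (by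
      rw [cY, show m.mat.1 1 0 + m.mat.1 1 1 * 8 =
        8 * ((m.mat.1 1 0 / 8 - 1) + (m.mat.1 1 1 - 1) + 2) by ring]
      exact n8 (norm_add_le_of (norm_add_le_of h hd') norm_two.le))
    rw [delta_mul_left h2, d2, one_mul] at k1
    rw [delta_mul_left hm, d1, mul_one, one_mul, one_mul] at k2
    rw [mul_add, ← k1, ← k2, add_comm]
    congr 2
    · group
    · rw [Y_neg]; group

end relations

/-- Functions `f` on the double cover with `f(k g) = δ(k) f(g)` for `k` in `K`. -/
def leftSpace (χ : K →* ℂˣ) : Submodule ℂ (Mp → ℂ) where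
  carrier := {f | ∀ k ∈ K, ∀ g, f (k * g) = delta χ k * f g}
  zero_mem' := by simp
  add_mem' := by
    intro f f' h h' k hk g
    simp only [Pi.add_apply, h k hk, h' k hk]; ring
  smul_mem' := by
    intro c f h k hk g
    simp only [Pi.smul_apply, h k hk, smul_eq_mul]; ring

/-- Through x ↦ f(x⁻¹g), sums of translates of f become sums of values at products of coset
representatives, the form in which the relations were proved. -/
theorem rightCovariant_of_mem {f : Mp → ℂ} (hf : f ∈ leftSpace χ) (g : Mp) :
    RightCovariant χ (fun x => f (x⁻¹ * g)) := by
  intro x k hk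
  have h := delta_mul_inv (χ := χ) hk
  simp only [mul_inv_rev, mul_assoc]
  rw [hf _ (inv_mem hk), eq_inv_of_mul_eq_one_right h]

/-- Left translation of functions. -/
noncomputable def translate (x : Mp) : (Mp → ℂ) →ₗ[ℂ] (Mp → ℂ) := LinearMap.funLeft ℂ ℂ (fun g => x⁻¹ * g)

theorem translate_apply (x : Mp) (f : Mp → ℂ) (g : Mp) : translate x f g = f (x⁻¹ * g) := rfl

/-- Left convolution with the generators, as operators on functions. -/
noncomputable def opFun (χ : K →* ℂˣ) : Gen → (Mp → ℂ) →ₗ[ℂ] (Mp → ℂ)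
  | .U1 => opCoeff χ • (translate s₁ + translate (X 1 * s₁))
  | .U2 => opCoeff χ • (translate s₂ + translate (Y 8 * s₂))
  | .Z => translate z₀

theorem opFun_U1 (f : Mp → ℂ) (g : Mp) : opFun χ .U1 f g =
    opCoeff χ * (f (s₁⁻¹ * g) + f ((X 1 * s₁)⁻¹ * g)) := rfl

theorem opFun_U2 (f : Mp → ℂ) (g : Mp) : opFun χ .U2 f g =
    opCoeff χ * (f (s₂⁻¹ * g) + f ((Y 8 * s₂)⁻¹ * g)) := rfl

theorem opFun_Z (f : Mp → ℂ) (g : Mp) : opFun χ .Z f g = f (z₀⁻¹ * g) := rfl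

theorem opFun_mem (hχ : IsChiTwo χ) (i : Gen) {f : Mp → ℂ} (hf : f ∈ leftSpace χ) :
    opFun χ i f ∈ leftSpace χ := by
  intro k hk g
  have hF := rightCovariant_of_mem hf g
  have hd : (delta χ k⁻¹)⁻¹ = delta χ k :=
    inv_eq_of_mul_eq_one_left (delta_mul_inv hk)
  cases i with
  | U1 =>
    have := sum_s₁_mul_left hχ hF (inv_mem hk)
    rw [hd] at this
    simp only [mul_inv_rev, inv_inv, mul_assoc] at this
    rw [opFun_U1, opFun_U1]
    simp only [mul_inv_rev, mul_assoc]
    rw [this]; ring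
  | U2 =>
    have := sum_s₂_mul_left hχ hF (inv_mem hk)
    rw [hd] at this
    simp only [mul_inv_rev, inv_inv, mul_assoc] at this
    rw [opFun_U2, opFun_U2]
    simp only [mul_inv_rev, mul_assoc]
    rw [this]; ring
  | Z =>
    rw [opFun_Z, opFun_Z]
    have e : z₀⁻¹ * (k * g) = (z₀⁻¹ * k * z₀) * (z₀⁻¹ * g) := by group
    rw [e, hf _ (conj_z₀_mem hk), delta_conj_z₀ hχ hk]

/-- Left convolution with the generators on left equivariant functions. -/
noncomputable def op (hχ : IsChiTwo χ) (i : Gen) : Module.End ℂ (leftSpace χ) :=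
  (opFun χ i).restrict fun _ hf => opFun_mem hχ i hf

theorem op_coe (hχ : IsChiTwo χ) (i : Gen) (f : leftSpace χ) :
    (op hχ i f : Mp → ℂ) = opFun χ i f := rfl

theorem op_relations (hχ : IsChiTwo χ) ⦃a b : FreeAlgebra ℂ Gen⦄ (h : Rel a b) :
    FreeAlgebra.lift ℂ (op hχ) a = FreeAlgebra.lift ℂ (op hχ) b := by
  cases h <;>
  · refine LinearMap.ext fun f => Subtype.ext (funext fun g => ?_)
    -- Evaluated at g, each relation is one of the five identities for F(x) = f(x⁻¹g).
    have hF := rightCovariant_of_mem f.2 g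
    have r1 := relation_U₁_sq hχ hF
    have r2 := relation_U₂_sq hχ hF
    have r3 := relation_U₂_Z hχ hF
    have r4 := relation_Z_U₂ hχ hF
    have r5 := relation_braid hχ hF
    simp only [mul_inv_rev, mul_assoc, inv_one, one_mul] at r1 r2 r3 r4 r5
    simp only [map_mul, map_add, map_one, fgen, FreeAlgebra.lift_ι_apply, Module.End.mul_apply,
      Module.End.one_apply, LinearMap.add_apply, Submodule.coe_add, Pi.add_apply, op_coe, opFun_U1,
      opFun_U2, opFun_Z, mul_inv_rev, mul_assoc]
    first
    | linear_combination r1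
    | linear_combination r2
    | linear_combination opCoeff χ * r3
    | linear_combination opCoeff χ * r4
    | linear_combination r5

/-- The action of the presented algebra on left equivariant functions. -/
noncomputable def act (hχ : IsChiTwo χ) : PresentedAlgebra →ₐ[ℂ] Module.End ℂ (leftSpace χ) :=
  RingQuot.liftAlgHom ℂ ⟨FreeAlgebra.lift ℂ (op hχ), op_relations hχ⟩

theorem act_gen (hχ : IsChiTwo χ) (i : Gen) : act hχ (gen i) = op hχ i := by
  rw [act, gen, RingQuot.liftAlgHom_mkAlgHom_apply, fgen, FreeAlgebra.lift_ι_apply]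

/-! ### Local triviality of the cocycle -/

/-- The matrices congruent to the identity modulo `2ⁿ`. -/
def congruenceSet (n : ℕ) : Set SL2 :=
  {k | ∀ i j, ‖k.1 i j - (1 : Matrix (Fin 2) (Fin 2) ℚ_[2]) i j‖ ≤ 2 ^ (-(n : ℤ))}

theorem congruenceSet_anti {m n : ℕ} (h : m ≤ n) : congruenceSet n ⊆ congruenceSet m :=
  fun _ hk i j => (hk i j).trans (zpow_le_zpow_right₀ (by norm_num) (by omega))

theorem mem_congruenceSet {n : ℕ} {k : SL2} : k ∈ congruenceSet n ↔
    ‖k.1 0 0 - 1‖ ≤ 2 ^ (-(n : ℤ)) ∧ ‖k.1 0 1‖ ≤ 2 ^ (-(n : ℤ)) ∧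
    ‖k.1 1 0‖ ≤ 2 ^ (-(n : ℤ)) ∧ ‖k.1 1 1 - 1‖ ≤ 2 ^ (-(n : ℤ)) := by
  constructor
  · intro h
    exact ⟨by simpa using h 0 0, by simpa using h 0 1, by simpa using h 1 0, by simpa using h 1 1⟩
  · unfold congruenceSet
    generalize (2 : ℝ) ^ (-(n : ℤ)) = r
    rintro ⟨h1, h2, h3, h4⟩ i j
    fin_cases i <;> fin_cases j <;> simp <;> assumption

theorem one_mem_congruenceSet (n : ℕ) : (1 : SL2) ∈ congruenceSet n := by
  intro i j
  rw [Matrix.SpecialLinearGroup.coe_one, sub_self, norm_zero]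
  positivity

theorem mul_mem_congruenceSet {n : ℕ} {g h : SL2} (hg : g ∈ congruenceSet n)
    (hh : h ∈ congruenceSet n) : g * h ∈ congruenceSet n := by
  have h1 : (2 : ℝ) ^ (-(n : ℤ)) ≤ 1 := zpow_le_one_of_nonpos₀ (by norm_num) (by omega)
  have h0 : (0 : ℝ) < 2 ^ (-(n : ℤ)) := by positivity
  rw [mem_congruenceSet] at *
  obtain ⟨a1, a2, a3, a4⟩ := hg
  obtain ⟨b1, b2, b3, b4⟩ := hh
  have a5 : ‖g.1 0 0‖ ≤ 1 := by
    rw [show g.1 0 0 = (g.1 0 0 - 1) + 1 by ring]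
    exact norm_add_le_of (a1.trans h1) norm_one.le
  have a6 : ‖g.1 1 1‖ ≤ 1 := by
    rw [show g.1 1 1 = (g.1 1 1 - 1) + 1 by ring]
    exact norm_add_le_of (a4.trans h1) norm_one.le
  refine ⟨?_, ?_, ?_, ?_⟩
  · rw [mul_a, show g.1 0 0 * h.1 0 0 + g.1 0 1 * h.1 1 0 - 1 =
      g.1 0 0 * (h.1 0 0 - 1) + (g.1 0 0 - 1) + g.1 0 1 * h.1 1 0 by ring]
    exact norm_add_le_of (norm_add_le_of (norm_mul_le_of a5 b1 (by linarith)) a1)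
      (norm_mul_le_of a2 b3 (by nlinarith))
  · rw [mul_b, show g.1 0 0 * h.1 0 1 + g.1 0 1 * h.1 1 1 =
      g.1 0 0 * h.1 0 1 + g.1 0 1 * (h.1 1 1 - 1) + g.1 0 1 by ring]
    exact norm_add_le_of (norm_add_le_of (norm_mul_le_of a5 b2 (by linarith))
      (norm_mul_le_of a2 b4 (by nlinarith))) a2
  · rw [mul_c, show g.1 1 0 * h.1 0 0 + g.1 1 1 * h.1 1 0 =
      g.1 1 0 * (h.1 0 0 - 1) + g.1 1 1 * h.1 1 0 + g.1 1 0 by ring]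
    exact norm_add_le_of (norm_add_le_of (norm_mul_le_of a3 b1 (by nlinarith))
      (norm_mul_le_of a6 b3 (by linarith))) a3
  · rw [mul_d, show g.1 1 0 * h.1 0 1 + g.1 1 1 * h.1 1 1 - 1 =
      g.1 1 1 * (h.1 1 1 - 1) + (g.1 1 1 - 1) + g.1 1 0 * h.1 0 1 by ring]
    exact norm_add_le_of (norm_add_le_of (norm_mul_le_of a6 b4 (by linarith)) a4)
      (norm_mul_le_of a3 b2 (by nlinarith))

theorem valuation_eq_of_norm_eq {x y : ℚ_[2]} (hx : x ≠ 0) (hy : y ≠ 0) (h : ‖x‖ = ‖y‖) :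
    x.valuation = y.valuation := by
  rw [Padic.norm_eq_zpow_neg_valuation hx, Padic.norm_eq_zpow_neg_valuation hy] at h
  have := zpow_right_injective₀ (a := ((2 : ℕ) : ℝ)) (by norm_num) (by norm_num) h
  simpa using this

/-- A unit congruent to one modulo four generates an unramified extension. -/
theorem hilbert_of_even {d e : ℚ_[2]} (hd : ‖d - 1‖ ≤ 4⁻¹) (he : e ≠ 0) (h : Even e.valuation) :
    hilbert e d = 1 := by
  obtain ⟨k, hk⟩ := h
  have h2 : (2 : ℚ_[2]) ^ k ≠ 0 := zpow_ne_zero _ two_ne_zero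
  obtain ⟨u, hu⟩ : ∃ u, e = u * (2 ^ k) ^ 2 := ⟨e / (2 ^ k) ^ 2, by field_simp⟩
  have hu1 : ‖u‖ = 1 := by
    have := Padic.norm_eq_zpow_neg_valuation he
    rw [hu, norm_mul, norm_pow, norm_zpow, norm_two, ← hu, hk] at this
    have e1 : ((2⁻¹ : ℝ) ^ k) ^ 2 = ((2 : ℕ) : ℝ) ^ (-(k + k)) := by
      rw [inv_zpow', ← zpow_natCast, ← zpow_mul]
      push_cast; ring_nf
    rw [e1] at this
    have h3 : (((2 : ℕ) : ℝ) ^ (-(k + k))) ≠ 0 := by positivity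
    exact mul_right_cancel₀ h3 (by rw [this, one_mul])
  rw [hu, hilbert_sq_mul h2]
  obtain ⟨t, ht⟩ : ∃ t, d = 1 + 4 * t := ⟨(d - 1) / 4, by ring⟩
  have ht1 : ‖t‖ ≤ 1 := by
    rw [ht, add_sub_cancel_left, norm_mul, norm_four] at hd; linarith
  rcases even_or_odd_of_norm_le_one ht1 with h | h
  · apply hilbert_eq_one_of_near_one
    rw [ht, add_sub_cancel_left]
    exact norm_mul_le_of norm_four.le h (by norm_num)
  · obtain ⟨s, -, hs⟩ := exists_sq_of_norm_sub_one (a := 4 * u + d) (by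
      rw [ht, show 4 * u + (1 + 4 * t) - 1 = 4 * ((t - 1) + (u - 1) + 2) by ring]
      exact norm_mul_le_of norm_four.le (norm_add_le_of (norm_add_le_of h
        (norm_sub_one_of_norm_eq_one hu1)) norm_two.le) (by norm_num))
    exact if_pos ⟨2, 1, s, by simp, by rw [← hs]; ring⟩

theorem exists_zpow_le {r : ℝ} (hr : 0 < r) : ∃ m : ℕ, (2 : ℝ) ^ (-(m : ℤ)) ≤ r := by
  obtain ⟨m, hm⟩ := exists_pow_lt_of_lt_one hr (show (2⁻¹ : ℝ) < 1 by norm_num)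
  refine ⟨m, ?_⟩
  rw [zpow_neg, zpow_natCast, ← inv_pow]
  exact hm.le

/-- The cocycle is trivial near the identity in its second argument. -/
theorem exists_sigma_eq_one {u : SL2} (hc : ‖u.1 1 0‖ ≤ 1) (hd : ‖u.1 1 1 - 1‖ ≤ 4⁻¹) :
    ∃ m, ∀ v ∈ congruenceSet m, sigma u v = 1 := by
  have hd1 : ‖u.1 1 1‖ = 1 := norm_eq_one_of_sub_one (hd.trans (by norm_num))
  have hd0 : u.1 1 1 ≠ 0 := by
    intro h; rw [h] at hd1; simp at hd1
  have sv : ∀ v : SL2, ‖v.1 1 1 - 1‖ ≤ 8⁻¹ → sgn v = 1 := fun v hv =>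
    sgn_eq_one (hilbert_eq_one_of_near_one hv)
  by_cases h0 : u.1 1 0 = 0
  -- If c(u) = 0, then `tau` jumps as soon as c(v) is nonzero. The cocycle reduces to (τ(v), d(u))
  -- times `sgn (u * v)`; both factors are 1 for c(v) = 0 or of even valuation, and both equal
  -- (c(v), d(u)) for odd valuation.
  · refine ⟨3, fun v hv => ?_⟩
    rw [mem_congruenceSet, show (2 : ℝ) ^ (-((3 : ℕ) : ℤ)) = 8⁻¹ by norm_num] at hv
    obtain ⟨-, -, -, v4⟩ := hv
    have v11 : v.1 1 1 ≠ 0 := by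
      intro h; rw [h] at v4; norm_num at v4
    have ec : (u * v).1 1 0 = u.1 1 1 * v.1 1 0 := by rw [mul_c, h0]; ring
    have ed : (u * v).1 1 1 = u.1 1 1 * v.1 1 1 := by rw [mul_d, h0]; ring
    have su : sgn u = 1 := sgn_of_mul_eq_zero (by rw [h0, zero_mul])
    have et : tau (u * v) = u.1 1 1 * tau v := by
      by_cases hv0 : v.1 1 0 = 0
      · rw [tau_of_c_eq hv0, tau_of_c_eq (by rw [ec, hv0, mul_zero]), ed]
      · rw [tau_of_c_ne hv0, tau_of_c_ne (by rw [ec]; exact mul_ne_zero hd0 hv0), ec]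
    simp only [sigma]
    rw [su, sv v v4, et, tau_of_c_eq h0, show u.1 1 1 * tau v * u.1 1 1 = tau v * u.1 1 1 ^ 2 by ring,
      show u.1 1 1 * tau v * tau v = u.1 1 1 * tau v ^ 2 by ring, hilbert_sq_mul hd0,
      hilbert_mul_sq (tau_ne_zero v), mul_one, mul_one]
    by_cases hv0 : v.1 1 0 = 0
    · rw [tau_of_c_eq hv0, sgn_of_mul_eq_zero (by rw [ec, hv0]; ring), hilbert_comm,
        hilbert_eq_one_of_near_one v4, one_mul]
    · have hval : (u.1 1 1 * v.1 1 0).valuation = (v.1 1 0).valuation :=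
        valuation_eq_of_norm_eq (mul_ne_zero hd0 hv0) hv0 (by rw [norm_mul, hd1, one_mul])
      rw [tau_of_c_ne hv0]
      rcases Int.even_or_odd (v.1 1 0).valuation with h | h
      · rw [hilbert_of_even hd hv0 h, sgn_of_even (by rw [ec, hval]; exact h), one_mul]
      · have hdd : hilbert (u.1 1 1) (u.1 1 1) = 1 := by
          refine hilbert_of_even hd hd0 ?_
          rw [valuation_eq_of_norm_eq hd0 one_ne_zero (by rw [hd1, norm_one])]
          simp
        have hne : (u * v).1 1 0 * (u * v).1 1 1 ≠ 0 := by
          rw [ec, ed]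
          exact mul_ne_zero (mul_ne_zero hd0 hv0) (mul_ne_zero hd0 v11)
        rw [sgn_of_odd hne (by rw [ec, hval]; exact h), ec, ed,
          hilbert_congr_right (b := u.1 1 1) (b' := u.1 1 1 * v.1 1 1) hd0
            (by rw [mul_div_cancel_left₀ _ hd0]; exact v4),
          hilbert_mul_left hd0 hv0 hd0, hdd, one_mul, Int.units_mul_self]
  · have hn : 0 < ‖u.1 1 0‖ := norm_pos_iff.2 h0
    -- The bound ‖c‖/8 makes both bottom entries of uv agree with those of u up to factors that are
    -- 1 modulo 8, hence squares. The level m therefore depends on u.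
    obtain ⟨m, hm⟩ := exists_zpow_le (r := ‖u.1 1 0‖ / 8) (by positivity)
    refine ⟨m, fun v hv => ?_⟩
    obtain ⟨v1, v2, v3, v4⟩ := mem_congruenceSet.1 hv
    have hm8 : (2 : ℝ) ^ (-(m : ℤ)) ≤ 8⁻¹ := by linarith
    have v4' := v4.trans hm8
    have rc : ‖(u * v).1 1 0 / u.1 1 0 - 1‖ ≤ 8⁻¹ := by
      rw [mul_c, show (u.1 1 0 * v.1 0 0 + u.1 1 1 * v.1 1 0) / u.1 1 0 - 1 =
        (v.1 0 0 - 1) + u.1 1 1 * (v.1 1 0 / u.1 1 0) by field_simp; ring]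
      refine norm_add_le_of (v1.trans hm8) (norm_mul_le_of hd1.le (s := 8⁻¹) ?_ (by norm_num))
      rw [norm_div, div_le_iff₀ hn]
      linarith
    have rd : ‖(u * v).1 1 1 / u.1 1 1 - 1‖ ≤ 8⁻¹ := by
      rw [mul_d, show (u.1 1 0 * v.1 0 1 + u.1 1 1 * v.1 1 1) / u.1 1 1 - 1 =
        (v.1 1 1 - 1) + u.1 1 0 * (v.1 0 1 / u.1 1 1) by field_simp; ring]
      refine norm_add_le_of v4' (norm_mul_le_of hc (s := 8⁻¹) ?_ (by norm_num))
      rw [norm_div, hd1, div_one]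
      exact v2.trans hm8
    have nz : ∀ {x y : ℚ_[2]}, y ≠ 0 → ‖x / y - 1‖ ≤ 8⁻¹ → x ≠ 0 := by
      rintro x y - h rfl
      norm_num at h
    have cz := nz h0 rc
    have dz := nz hd0 rd
    have hval : ((u * v).1 1 0).valuation = (u.1 1 0).valuation := by
      apply valuation_eq_of_norm_eq cz h0
      have := norm_eq_one_of_sub_one (rc.trans (by norm_num))
      rwa [norm_div, div_eq_one_iff_eq hn.ne'] at this
    have hs : sgn (u * v) = sgn u := by
      rcases Int.even_or_odd (u.1 1 0).valuation with h | h
      · rw [sgn_of_even h, sgn_of_even (hval.symm ▸ h)]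
      · rw [sgn_of_odd (mul_ne_zero h0 hd0) h, sgn_of_odd (mul_ne_zero cz dz) (hval.symm ▸ h),
          hilbert_congr_right hd0 rd, hilbert_comm, hilbert_congr_right h0 rc, hilbert_comm]
    have ht : hilbert (tau (u * v) * tau u) (tau (u * v) * tau v) = 1 := by
      obtain ⟨s, hs, e⟩ := exists_sq_of_norm_sub_one rc
      rw [div_eq_iff h0] at e
      rw [tau_of_c_ne h0, tau_of_c_ne cz]
      nth_rewrite 1 [e]
      rw [show s ^ 2 * u.1 1 0 * u.1 1 0 = (s * u.1 1 0) ^ 2 by ring, hilbert_sq_left]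
    simp only [sigma]
    rw [ht, hs, sv v v4', mul_one, one_mul, Int.units_mul_self]

/-! ### The topology of the double cover -/

theorem smallNhd_eq (n : ℕ) : Mp.smallNhd n = lift '' congruenceSet n := by
  ext x
  constructor
  · rintro ⟨h1, h2⟩
    exact ⟨x.mat, h2, by ext1 <;> simp [lift, h1]⟩
  · rintro ⟨k, hk, rfl⟩
    exact ⟨rfl, hk⟩

theorem isOpen_translate_smallNhd (g : Mp) {n : ℕ} (hn : 2 ≤ n) :
    IsOpen ((fun x => g * x) '' Mp.smallNhd n) :=
  TopologicalSpace.isOpen_generateFrom_of_mem ⟨g, n, hn, rfl⟩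

theorem continuous_mul_left_Mp (g : Mp) : Continuous (fun x : Mp => g * x) := by
  refine continuous_generateFrom_iff.2 ?_
  rintro _ ⟨g', n, hn, rfl⟩
  have : (fun x : Mp => g * x) ⁻¹' ((fun x => g' * x) '' Mp.smallNhd n) =
      (fun x => (g⁻¹ * g') * x) '' Mp.smallNhd n := by
    ext x
    constructor
    · rintro ⟨y, hy, e⟩
      refine ⟨y, hy, ?_⟩
      simp only at e ⊢
      rw [mul_assoc, e, inv_mul_cancel_left]
    · rintro ⟨y, hy, rfl⟩
      exact ⟨y, hy, by simp only; group⟩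
  rw [this]
  exact isOpen_translate_smallNhd _ hn

/-- Left translation as a homeomorphism of the double cover. -/
noncomputable def mulLeftHomeo (g : Mp) : Mp ≃ₜ Mp where
  toEquiv := Equiv.mulLeft g
  continuous_toFun := continuous_mul_left_Mp g
  continuous_invFun := continuous_mul_left_Mp g⁻¹

theorem continuous_entry (i j : Fin 2) : Continuous (fun g : SL2 => g.1 i j) :=
  (continuous_subtype_val : Continuous (fun g : SL2 => g.1)).matrix_elem i j

theorem isOpen_congruenceSet (n : ℕ) : IsOpen (congruenceSet n) := by
  have : congruenceSet n = ⋂ i, ⋂ j, (fun g : SL2 => g.1 i j) ⁻¹'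
      Metric.closedBall ((1 : Matrix (Fin 2) (Fin 2) ℚ_[2]) i j) (2 ^ (-(n : ℤ))) := by
    ext k
    simp [congruenceSet, dist_eq_norm]
  rw [this]
  refine isOpen_iInter_of_finite fun i => isOpen_iInter_of_finite fun j => ?_
  exact (IsUltrametricDist.isOpen_closedBall _ (by positivity)).preimage (continuous_entry i j)

theorem isClosed_congruenceSet (n : ℕ) : IsClosed (congruenceSet n) := by
  have : congruenceSet n = ⋂ i, ⋂ j, (fun g : SL2 => g.1 i j) ⁻¹'
      Metric.closedBall ((1 : Matrix (Fin 2) (Fin 2) ℚ_[2]) i j) (2 ^ (-(n : ℤ))) := by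
    ext k
    simp [congruenceSet, dist_eq_norm]
  rw [this]
  exact isClosed_iInter fun i => isClosed_iInter fun j =>
    Metric.isClosed_closedBall.preimage (continuous_entry i j)

theorem isCompact_integral : IsCompact {g : SL2 | ∀ i j, ‖g.1 i j‖ ≤ 1} := by
  have h1 : IsCompact (Set.pi Set.univ fun _ : Fin 2 => Set.pi Set.univ fun _ : Fin 2 =>
      Metric.closedBall (0 : ℚ_[2]) 1) :=
    isCompact_univ_pi fun _ => isCompact_univ_pi fun _ => isCompact_closedBall _ _
  have h2 : IsClosed {A : Matrix (Fin 2) (Fin 2) ℚ_[2] | A.det = 1} :=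
    isClosed_eq (continuous_id.matrix_det) continuous_const
  have h3 := h2.isClosedEmbedding_subtypeVal.isCompact_preimage h1
  have e : {g : SL2 | ∀ i j, ‖g.1 i j‖ ≤ 1} = Subtype.val ⁻¹' (Set.pi Set.univ fun _ : Fin 2 =>
      Set.pi Set.univ fun _ : Fin 2 => Metric.closedBall (0 : ℚ_[2]) 1) := by
    ext g
    exact ⟨fun h i _ j _ => mem_closedBall_zero_iff.2 (h i j),
      fun h i j => mem_closedBall_zero_iff.1 (h i trivial j trivial)⟩
  rw [e]
  exact h3

/-- Local triviality of the cocycle at both u and k₀ makes `lift` continuous on the compact group of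
matrices congruent to 1 modulo 8, and the set is its image. -/
theorem isCompact_smallNhd_three : IsCompact (Mp.smallNhd 3) := by
  have hc : IsCompact (congruenceSet 3) := by
    refine isCompact_integral.of_isClosed_subset (isClosed_congruenceSet 3) fun g hg i j => ?_
    have h1 : ‖(1 : Matrix (Fin 2) (Fin 2) ℚ_[2]) i j‖ ≤ 1 := by
      rw [Matrix.one_apply]; split_ifs <;> simp
    rw [show g.1 i j = (g.1 i j - (1 : Matrix (Fin 2) (Fin 2) ℚ_[2]) i j) +
      (1 : Matrix (Fin 2) (Fin 2) ℚ_[2]) i j by ring]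
    exact norm_add_le_of ((hg i j).trans (by norm_num)) h1
  rw [smallNhd_eq]
  rw [isCompact_iff_isCompact_univ] at hc
  have hcont : Continuous (fun k : congruenceSet 3 => lift k) := by
    refine continuous_generateFrom_iff.2 ?_
    rintro _ ⟨g, n, hn, rfl⟩
    rw [isOpen_iff_mem_nhds]
    rintro k₀ ⟨x, hx, he⟩
    rw [smallNhd_eq] at hx
    obtain ⟨u, hu, rfl⟩ := hx
    simp only at he
    have hd : ∀ {v : SL2}, v ∈ congruenceSet 2 → ‖v.1 1 0‖ ≤ 1 ∧ ‖v.1 1 1 - 1‖ ≤ 4⁻¹ := by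
      intro v hv
      rw [mem_congruenceSet, show (2 : ℝ) ^ (-((2 : ℕ) : ℤ)) = 4⁻¹ by norm_num] at hv
      exact ⟨hv.2.2.1.trans (by norm_num), hv.2.2.2⟩
    obtain ⟨m₁, h₁⟩ := exists_sigma_eq_one (hd (congruenceSet_anti hn hu)).1
      (hd (congruenceSet_anti hn hu)).2
    obtain ⟨m₂, h₂⟩ := exists_sigma_eq_one (hd (congruenceSet_anti (by norm_num) k₀.2)).1
      (hd (congruenceSet_anti (by norm_num) k₀.2)).2
    have hopen : IsOpen ((fun k : congruenceSet 3 => (k₀ : SL2)⁻¹ * (k : SL2)) ⁻¹'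
        congruenceSet (max n (max m₁ m₂))) :=
      (isOpen_congruenceSet _).preimage (continuous_const.mul continuous_subtype_val)
    refine Filter.mem_of_superset (hopen.mem_nhds ?_) ?_
    · simp only [Set.mem_preimage, inv_mul_cancel]
      exact one_mem_congruenceSet _
    · intro k hk
      set v := (k₀ : SL2)⁻¹ * (k : SL2) with hv
      have hkv : (k : SL2) = k₀ * v := by rw [hv, mul_inv_cancel_left]
      have hvn : v ∈ congruenceSet n := congruenceSet_anti (le_max_left _ _) hk
      have hv1 : v ∈ congruenceSet m₁ :=
        congruenceSet_anti ((le_max_left _ _).trans (le_max_right _ _)) hk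
      have hv2 : v ∈ congruenceSet m₂ :=
        congruenceSet_anti ((le_max_right _ _).trans (le_max_right _ _)) hk
      refine ⟨lift (u * v), ?_, ?_⟩
      · rw [smallNhd_eq]; exact ⟨_, mul_mem_congruenceSet hu hvn, rfl⟩
      · simp only
        rw [hkv, ← lift_mul_lift_of (h₂ v hv2), ← he, ← lift_mul_lift_of (h₁ v hv1), mul_assoc]
  have := hc.image hcont
  rwa [Set.image_univ, ← Set.image_eq_range] at this

theorem smallNhd_three_subset : Mp.smallNhd 3 ⊆ K := by
  rintro x ⟨-, hx⟩
  have := mem_congruenceSet.1 hx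
  rw [show (2 : ℝ) ^ (-((3 : ℕ) : ℤ)) = 8⁻¹ by norm_num] at this
  obtain ⟨h1, h2, h3, h4⟩ := this
  have key : ∀ {a : ℚ_[2]}, ‖a - 1‖ ≤ 8⁻¹ → ‖a‖ ≤ 1 := fun h =>
    (norm_eq_one_of_sub_one (h.trans (by norm_num))).le
  exact mem_K.2 ⟨key h1, h2.trans (by norm_num), h3, key h4⟩

theorem one_mem_smallNhd (n : ℕ) : (1 : Mp) ∈ Mp.smallNhd n := by
  refine ⟨rfl, fun i j => ?_⟩
  simp only [Mp.mat_one, Matrix.SpecialLinearGroup.coe_one, sub_self, norm_zero]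
  positivity

/-- A set that is stable under right multiplication by `K` is open. -/
theorem isOpen_of_mul_mem {S : Set Mp} (h : ∀ g ∈ S, ∀ k ∈ K, g * k ∈ S) : IsOpen S := by
  rw [isOpen_iff_mem_nhds]
  intro g hg
  refine Filter.mem_of_superset ((isOpen_translate_smallNhd g (n := 3) (by norm_num)).mem_nhds
    ⟨1, one_mem_smallNhd 3, mul_one g⟩) ?_
  rintro _ ⟨x, hx, rfl⟩
  exact h g hg x (smallNhd_three_subset hx)

theorem isClosed_of_mul_mem {S : Set Mp} (h : ∀ g ∈ S, ∀ k ∈ K, g * k ∈ S) : IsClosed S := by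
  rw [← isOpen_compl_iff]
  refine isOpen_of_mul_mem fun g hg k hk hgk => hg ?_
  have := h _ hgk _ (inv_mem hk)
  rwa [mul_inv_cancel_right] at this

/-- Finitely many translates of the compact set `smallNhd 3`, taken with both signs, cover K. -/
theorem isCompact_K : IsCompact (K : Set Mp) := by
  have hKc : IsCompact (K0 3 : Set SL2) := by
    refine isCompact_integral.of_isClosed_subset ?_ fun g hg => hg.1
    have : (K0 3 : Set SL2) = {g | ∀ i j, ‖g.1 i j‖ ≤ 1} ∩
        {g | ‖g.1 1 0‖ ≤ 2 ^ (-((3 : ℕ) : ℤ))} := rfl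
    rw [this]
    refine IsClosed.inter isCompact_integral.isClosed ?_
    exact isClosed_le (continuous_entry 1 0).norm continuous_const
  obtain ⟨t, ht⟩ := hKc.elim_finite_subcover
    (fun k : K0 3 => (fun g : SL2 => (k : SL2)⁻¹ * g) ⁻¹' congruenceSet 3)
    (fun k => (isOpen_congruenceSet 3).preimage (continuous_const.mul continuous_id))
    (fun g hg => Set.mem_iUnion.2 ⟨⟨g, hg⟩, by
      simp only [Set.mem_preimage, inv_mul_cancel]
      exact one_mem_congruenceSet _⟩)
  have hcomp : IsCompact (⋃ k ∈ t, ⋃ e : ℤˣ,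
      (fun x => (central e * lift (k : SL2)) * x) '' Mp.smallNhd 3) :=
    t.isCompact_biUnion fun k _ => isCompact_iUnion fun e =>
      isCompact_smallNhd_three.image (continuous_mul_left_Mp _)
  refine hcomp.of_isClosed_subset (isClosed_of_mul_mem fun g hg k hk => mul_mem hg hk) ?_
  intro g hg
  have := ht (show g.mat ∈ (K0 3 : Set SL2) from hg)
  simp only [Set.mem_iUnion] at this ⊢
  obtain ⟨k, hk, hgk⟩ := this
  obtain ⟨e, he⟩ := exists_central (g := g) (h := lift (k : SL2) * lift ((k : SL2)⁻¹ * g.mat)) (by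
    simp [Mp.mat_mul, lift])
  refine ⟨k, hk, e, lift ((k : SL2)⁻¹ * g.mat), ?_, ?_⟩
  · rw [smallNhd_eq]; exact ⟨_, hgk, rfl⟩
  · simp only
    rw [mul_assoc, central_comm, ← he]

/-! ### An algebraic description of the Hecke space -/

/-- Right equivariant functions whose support is contained in finitely many left cosets of `K`. -/
def rightSpace (χ : K →* ℂˣ) : Submodule ℂ (Mp → ℂ) where
  carrier := {f | (∀ k ∈ K, ∀ g, f (g * k) = f g * delta χ k) ∧
    ∃ t : Set Mp, t.Finite ∧ ∀ g, f g ≠ 0 → ∃ x ∈ t, x⁻¹ * g ∈ K}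
  zero_mem' := ⟨by simp, ∅, Set.finite_empty, by simp⟩
  add_mem' := by
    rintro f f' ⟨h, t, ht, hs⟩ ⟨h', t', ht', hs'⟩
    refine ⟨fun k hk g => ?_, t ∪ t', ht.union ht', fun g hg => ?_⟩
    · simp only [Pi.add_apply, h k hk, h' k hk]; ring
    · by_cases h0 : f g = 0
      · obtain ⟨x, hx, hxg⟩ := hs' g (by
          intro h1
          exact hg (by simp [h0, h1]))
        exact ⟨x, Or.inr hx, hxg⟩
      · obtain ⟨x, hx, hxg⟩ := hs g h0
        exact ⟨x, Or.inl hx, hxg⟩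
  smul_mem' := by
    rintro c f ⟨h, t, ht, hs⟩
    refine ⟨fun k hk g => ?_, t, ht, fun g hg => hs g fun h0 => hg (by simp [h0])⟩
    simp only [Pi.smul_apply, h k hk, smul_eq_mul]; ring

theorem translate_mem_rightSpace (x : Mp) {f : Mp → ℂ} (hf : f ∈ rightSpace χ) :
    translate x f ∈ rightSpace χ := by
  obtain ⟨h, t, ht, hs⟩ := hf
  refine ⟨fun k hk g => ?_, (fun y => x * y) '' t, ht.image _, fun g hg => ?_⟩
  · rw [translate_apply, translate_apply, ← mul_assoc, h k hk]
  · obtain ⟨y, hy, hyg⟩ := hs _ hg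
    exact ⟨x * y, ⟨y, hy, rfl⟩, by rwa [mul_inv_rev, mul_assoc]⟩

theorem opFun_mem_rightSpace (i : Gen) {f : Mp → ℂ} (hf : f ∈ rightSpace χ) :
    opFun χ i f ∈ rightSpace χ := by
  cases i with
  | U1 => exact Submodule.smul_mem _ _ (Submodule.add_mem _ (translate_mem_rightSpace _ hf)
      (translate_mem_rightSpace _ hf))
  | U2 => exact Submodule.smul_mem _ _ (Submodule.add_mem _ (translate_mem_rightSpace _ hf)
      (translate_mem_rightSpace _ hf))
  | Z => exact translate_mem_rightSpace _ hf

theorem heckeSpace_le_leftSpace {f : Mp → ℂ} (hf : f ∈ heckeSpace K χ) : f ∈ leftSpace χ := by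
  intro k hk g
  have := hf.2.2 g ⟨k, hk⟩ 1
  simpa [delta_coe ⟨k, hk⟩] using this

theorem isOpen_leftCoset (x : Mp) : IsOpen {g : Mp | x⁻¹ * g ∈ K} :=
  isOpen_of_mul_mem fun g hg k hk => by
    simp only [Set.mem_ofPred_eq] at hg ⊢
    rw [← mul_assoc]; exact mul_mem hg hk

theorem heckeSpace_le_rightSpace {f : Mp → ℂ} (hf : f ∈ heckeSpace K χ) : f ∈ rightSpace χ := by
  refine ⟨fun k hk g => ?_, ?_⟩
  · have := hf.2.2 g 1 ⟨k, hk⟩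
    rw [delta_coe ⟨k, hk⟩, mul_comm]
    simpa using this
  · obtain ⟨t, ht⟩ := hf.2.1.isCompact.elim_finite_subcover (fun x : Mp => {g : Mp | x⁻¹ * g ∈ K})
      isOpen_leftCoset (fun g _ => Set.mem_iUnion.2 ⟨g, by simp⟩)
    refine ⟨t, t.finite_toSet, fun g hg => ?_⟩
    have := ht (subset_tsupport _ hg)
    simpa using this

/-- The analytic conditions are automatic: χ is trivial on `smallNhd 3`, which gives local
constancy, and finitely many left cosets of the compact open subgroup K give compact support. -/
theorem mem_heckeSpace (hχ : IsChiTwo χ) {f : Mp → ℂ} (hl : f ∈ leftSpace χ)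
    (hr : f ∈ rightSpace χ) : f ∈ heckeSpace K χ := by
  obtain ⟨hr, t, ht, hs⟩ := hr
  refine ⟨?_, ?_, fun g k k' => ?_⟩
  · rw [IsLocallyConstant.iff_exists_open]
    intro x
    refine ⟨_, isOpen_translate_smallNhd x (n := 3) (by norm_num),
      ⟨1, one_mem_smallNhd 3, mul_one x⟩, ?_⟩
    rintro _ ⟨y, hy, rfl⟩
    have hyK := smallNhd_three_subset hy
    rw [smallNhd_eq] at hy
    obtain ⟨k, hk, rfl⟩ := hy
    have h1 := (mem_congruenceSet.1 hk).1
    simp only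
    rw [hr _ hyK, delta_near_one hχ hyK, mul_one]
    refine h1.trans ?_
    norm_num
  · refine HasCompactSupport.intro'
      (ht.isCompact_biUnion fun x _ => isCompact_K.image (continuous_mul_left_Mp x))
      (ht.isClosed_biUnion fun x _ => isClosed_of_mul_mem ?_) ?_
    · rintro _ ⟨y, hy, rfl⟩ k hk
      exact ⟨y * k, mul_mem hy hk, by simp only [mul_assoc]⟩
    · intro g hg
      by_contra h0
      obtain ⟨x, hx, hxg⟩ := hs g h0
      exact hg (Set.mem_biUnion hx ⟨_, hxg, by simp⟩)
  · rw [hr _ k'.2, hl _ k.2, delta_coe, delta_coe]; ring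

theorem delta_mem_leftSpace : delta χ ∈ leftSpace χ := fun _ hk g => delta_mul_left hk g

theorem delta_mem_rightSpace : delta χ ∈ rightSpace χ := by
  refine ⟨fun _ hk g => delta_mul_right hk g, {1}, Set.finite_singleton _, fun g hg => ?_⟩
  refine ⟨1, rfl, ?_⟩
  by_contra h
  rw [inv_one, one_mul] at h
  exact hg (delta_of_notMem h)

/-! ### Convolution -/

section convolution
open MeasureTheory

variable {μ : Measure Mp}

theorem convolve_smul (c : ℂ) (f₁ f₂ : Mp → ℂ) :
    convolve μ (c • f₁) f₂ = c • convolve μ f₁ f₂ := by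
  ext h
  simp only [convolve, Pi.smul_apply, smul_eq_mul, mul_assoc]
  exact integral_const_mul _ _

/-- The two characters cancel in the integrand, which is therefore constant on K and zero elsewhere;
K has volume 1. -/
theorem convolve_delta (hμ : μ (K : Set Mp) = 1) {f : Mp → ℂ} (hf : f ∈ leftSpace χ) :
    convolve μ (delta χ) f = f := by
  ext h
  have e : (fun g => delta χ g * f (g⁻¹ * h)) = (K : Set Mp).indicator fun _ => f h := by
    ext g
    by_cases hg : g ∈ K
    · rw [Set.indicator_of_mem hg, hf _ (inv_mem hg), ← mul_assoc, delta_mul_inv hg, one_mul]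
    · rw [Set.indicator_of_notMem hg, delta_of_notMem hg, zero_mul]
  have hm : MeasurableSet (K : Set Mp) :=
    (isOpen_of_mul_mem fun g hg k hk => mul_mem hg hk).measurableSet
  rw [convolve, e, integral_indicator_const _ hm, measureReal_def, hμ]
  simp

variable [μ.IsHaarMeasure]

theorem integral_mul_left_Mp (f : Mp → ℂ) (x : Mp) : ∫ g, f (x * g) ∂μ = ∫ g, f g ∂μ := by
  conv_rhs => rw [← map_mul_left_eq_self μ x]
  exact ((mulLeftHomeo x).measurableEmbedding.integral_map f).symm

/-- The characters of the two factors cancel, so the integrand is invariant under right translation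
by K, hence continuous, and it is supported on finitely many left cosets. -/
theorem integrable_convolution {f₁ f₂ : Mp → ℂ} (h₁ : f₁ ∈ rightSpace χ) (h₂ : f₂ ∈ leftSpace χ)
    (h : Mp) : Integrable (fun g => f₁ g * f₂ (g⁻¹ * h)) μ := by
  obtain ⟨h₁, t, ht, hs⟩ := h₁
  have inv : ∀ g, ∀ k ∈ K, f₁ (g * k) * f₂ ((g * k)⁻¹ * h) = f₁ g * f₂ (g⁻¹ * h) := by
    intro g k hk
    rw [h₁ k hk, mul_inv_rev, mul_assoc k⁻¹, h₂ _ (inv_mem hk)]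
    linear_combination f₁ g * f₂ (g⁻¹ * h) * delta_mul_inv (χ := χ) hk
  refine Continuous.integrable_of_hasCompactSupport ?_ ?_
  · refine continuous_def.2 fun U _ => isOpen_of_mul_mem fun g hg k hk => ?_
    rw [Set.mem_preimage] at hg ⊢
    rwa [inv g k hk]
  · refine HasCompactSupport.intro'
      (ht.isCompact_biUnion fun x _ => isCompact_K.image (continuous_mul_left_Mp x))
      (ht.isClosed_biUnion fun x _ => isClosed_of_mul_mem ?_) ?_
    · rintro _ ⟨y, hy, rfl⟩ k hk
      exact ⟨y * k, mul_mem hy hk, by simp only [mul_assoc]⟩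
    · intro g hg
      by_contra h0
      obtain ⟨x, hx, hxg⟩ := hs g (left_ne_zero_of_mul h0)
      exact hg (Set.mem_biUnion hx ⟨_, hxg, by simp⟩)

theorem convolve_translate (x : Mp) (f₁ f₂ : Mp → ℂ) :
    convolve μ (translate x f₁) f₂ = translate x (convolve μ f₁ f₂) := by
  ext h
  rw [translate_apply, convolve, convolve,
    ← integral_mul_left_Mp (fun g => f₁ g * f₂ (g⁻¹ * (x⁻¹ * h))) x⁻¹]
  refine integral_congr_ae (Filter.Eventually.of_forall fun g => ?_)
  simp only [translate_apply, mul_inv_rev, inv_inv]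
  congr 2
  group

theorem convolve_add {f₁ f₁' f₂ : Mp → ℂ} (h₁ : f₁ ∈ rightSpace χ) (h₁' : f₁' ∈ rightSpace χ)
    (h₂ : f₂ ∈ leftSpace χ) :
    convolve μ (f₁ + f₁') f₂ = convolve μ f₁ f₂ + convolve μ f₁' f₂ := by
  ext h
  simp only [convolve, Pi.add_apply, add_mul]
  exact integral_add (integrable_convolution h₁ h₂ h) (integrable_convolution h₁' h₂ h)

theorem convolve_opFun (i : Gen) {f₁ f₂ : Mp → ℂ} (h₁ : f₁ ∈ rightSpace χ)
    (h₂ : f₂ ∈ leftSpace χ) :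
    convolve μ (opFun χ i f₁) f₂ = opFun χ i (convolve μ f₁ f₂) := by
  cases i with
  | U1 =>
    simp only [opFun, LinearMap.smul_apply, LinearMap.add_apply]
    rw [convolve_smul, convolve_add (translate_mem_rightSpace _ h₁) (translate_mem_rightSpace _ h₁)
      h₂, convolve_translate, convolve_translate]
  | U2 =>
    simp only [opFun, LinearMap.smul_apply, LinearMap.add_apply]
    rw [convolve_smul, convolve_add (translate_mem_rightSpace _ h₁) (translate_mem_rightSpace _ h₁)
      h₂, convolve_translate, convolve_translate]
  | Z => exact convolve_translate _ _ _

theorem convolve_mem_leftSpace {f₁ : Mp → ℂ} (h₁ : f₁ ∈ leftSpace χ) (f₂ : Mp → ℂ) :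
    convolve μ f₁ f₂ ∈ leftSpace χ := by
  intro k hk g
  have e : translate k⁻¹ f₁ = delta χ k • f₁ := by
    ext x
    rw [translate_apply, inv_inv, h₁ k hk]; rfl
  have := congrFun (convolve_translate (μ := μ) k⁻¹ f₁ f₂) g
  rw [e, convolve_smul, translate_apply, inv_inv] at this
  rw [← this]; rfl

theorem presented_induction {p : PresentedAlgebra → Prop} (hc : ∀ c : ℂ, p (algebraMap _ _ c))
    (hg : ∀ i, p (gen i)) (hm : ∀ a b, p a → p b → p (a * b)) (ha : ∀ a b, p a → p b → p (a + b))
    (a : PresentedAlgebra) : p a := by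
  obtain ⟨x, rfl⟩ := RingQuot.mkAlgHom_surjective ℂ Rel a
  induction x using FreeAlgebra.induction with
  | grade0 r => rw [AlgHom.commutes]; exact hc r
  | grade1 i => exact hg i
  | mul a b h1 h2 => rw [map_mul]; exact hm _ _ h1 h2
  | add a b h1 h2 => rw [map_add]; exact ha _ _ h1 h2

theorem act_mem_rightSpace (hχ : IsChiTwo χ) (a : PresentedAlgebra) :
    ∀ f : leftSpace χ, (f : Mp → ℂ) ∈ rightSpace χ → (act hχ a f : Mp → ℂ) ∈ rightSpace χ := by
  induction a using presented_induction with
  | hc c =>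
    intro f hf
    rw [AlgHom.commutes]
    exact Submodule.smul_mem _ c hf
  | hg i =>
    intro f hf
    rw [act_gen]
    exact opFun_mem_rightSpace i hf
  | hm a b h1 h2 =>
    intro f hf
    rw [map_mul]
    exact h1 _ (h2 f hf)
  | ha a b h1 h2 =>
    intro f hf
    rw [map_add]
    exact Submodule.add_mem _ (h1 f hf) (h2 f hf)

/-- The generators act by combinations of left translations, and these commute with convolution on
the right. Membership in `rightSpace` supplies the integrability needed for additivity. -/
theorem convolve_act (hχ : IsChiTwo χ) (a : PresentedAlgebra) {f₂ : Mp → ℂ}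
    (h₂ : f₂ ∈ leftSpace χ) : ∀ f : leftSpace χ, (f : Mp → ℂ) ∈ rightSpace χ →
      convolve μ (act hχ a f : Mp → ℂ) f₂ =
        act hχ a ⟨convolve μ f f₂, convolve_mem_leftSpace f.2 f₂⟩ := by
  induction a using presented_induction with
  | hc c =>
    intro f hf
    rw [AlgHom.commutes]
    exact convolve_smul c f f₂
  | hg i =>
    intro f hf
    rw [act_gen]
    exact convolve_opFun i hf h₂
  | hm a b h1 h2 =>
    intro f hf
    rw [map_mul, Module.End.mul_apply, Module.End.mul_apply,
      h1 _ (act_mem_rightSpace hχ b f hf)]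
    congr 2
    exact Subtype.ext (h2 f hf)
  | ha a b h1 h2 =>
    intro f hf
    rw [map_add, LinearMap.add_apply, LinearMap.add_apply, Submodule.coe_add, Submodule.coe_add,
      convolve_add (act_mem_rightSpace hχ a f hf) (act_mem_rightSpace hχ b f hf) h₂, h1 f hf,
      h2 f hf]

/-- The unit of the Hecke algebra as a left equivariant function. -/
noncomputable def deltaLeft (χ : K →* ℂˣ) : leftSpace χ := ⟨delta χ, delta_mem_leftSpace⟩

/-- The homomorphism from the presented algebra to the Hecke algebra. -/
noncomputable def toHecke (hχ : IsChiTwo χ) : PresentedAlgebra →ₗ[ℂ] heckeSpace K χ where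
  toFun a := ⟨act hχ a (deltaLeft χ), mem_heckeSpace hχ (act hχ a (deltaLeft χ)).2
    (act_mem_rightSpace hχ a _ delta_mem_rightSpace)⟩
  map_add' a b := by ext1; simp
  map_smul' c a := by ext1; simp

theorem toHecke_coe (hχ : IsChiTwo χ) (a : PresentedAlgebra) :
    (toHecke hχ a : Mp → ℂ) = act hχ a (deltaLeft χ) := rfl

/-- Since δ is a left unit, (ab)·δ = a·(b·δ) = a·(δ * (b·δ)) = (a·δ) * (b·δ). -/
theorem toHecke_mul (hχ : IsChiTwo χ) (hμ : μ (K : Set Mp) = 1) (a b : PresentedAlgebra) :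
    (toHecke hχ (a * b) : Mp → ℂ) = convolve μ (toHecke hχ a) (toHecke hχ b) := by
  rw [toHecke_coe, toHecke_coe, toHecke_coe,
    convolve_act hχ a (act hχ b (deltaLeft χ)).2 _ delta_mem_rightSpace, map_mul,
    Module.End.mul_apply]
  congr 2
  exact Subtype.ext (convolve_delta hμ (act hχ b (deltaLeft χ)).2).symm

theorem toHecke_gen_mul (hχ : IsChiTwo χ) (i : Gen) (a : PresentedAlgebra) :
    (toHecke hχ (gen i * a) : Mp → ℂ) = opFun χ i (toHecke hχ a) := by
  rw [toHecke_coe, map_mul, act_gen]; rfl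

theorem toHecke_one (hχ : IsChiTwo χ) : (toHecke hχ 1 : Mp → ℂ) = delta χ := by
  rw [toHecke_coe, map_one]; rfl

theorem toHecke_gen (hχ : IsChiTwo χ) (i : Gen) :
    (toHecke hχ (gen i) : Mp → ℂ) = opFun χ i (delta χ) := by
  have := toHecke_gen_mul hχ i 1
  rwa [mul_one, toHecke_one] at this

end convolution

/-! ### Double coset representatives -/

/-- The product `w(1/4) w(1/2)`, a lift of `h(-1/2)`. -/
noncomputable def T₀ : Mp := s₂ * s₁

/-- The elements `T₀ ^ r x` with `x` among `1`, `x(1/2)`, `w(1/4)`. -/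
noncomputable def tail (r : ℕ) (j : Fin 3) : Mp := T₀ ^ r * ![1, z₀, s₂] j

/-- Representatives for the double cosets of `K` that support functions in the Hecke algebra. -/
noncomputable def pt (i : Fin 3) (r : ℕ) (j : Fin 3) : Mp :=
  ![tail r j, s₁ * tail r j, z₀ * (s₁ * tail r j)] i

theorem tail_zero_zero : tail 0 0 = 1 := by simp [tail]
theorem tail_zero_one : tail 0 1 = z₀ := by simp [tail]
theorem tail_zero_two : tail 0 2 = s₂ := by simp [tail]

theorem tail_succ (r : ℕ) (j : Fin 3) : tail (r + 1) j = s₂ * (s₁ * tail r j) := by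
  rw [tail, pow_succ', T₀, tail, T₀]; simp only [mul_assoc]

theorem s₁_mul_Y (c : ℚ_[2]) : s₁ * Y c = X (-4⁻¹ * c) * s₁ := by
  rw [X_s₁]; congr 2; ring

theorem s₂_mul_X (b : ℚ_[2]) : s₂ * X b = Y (-16 * b) * s₂ := by
  rw [Y_s₂]; congr 2; ring

/-- T₀ lifts h(-1/2), so moving upper unipotents to the right through T₀ contracts them; for lower
unipotents the contraction is towards the left. Both directions keep elements of K in K. -/
theorem X_mul_T_pow (r : ℕ) (b : ℚ_[2]) : X b * T₀ ^ r = T₀ ^ r * X (4 ^ r * b) := by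
  induction r generalizing b with
  | zero => simp
  | succ r ih =>
    rw [pow_succ', ← mul_assoc, T₀, ← mul_assoc, X_s₂, mul_assoc s₂, Y_s₁, ← mul_assoc s₂,
      mul_assoc _ (X _), ← T₀, ih]
    rw [← mul_assoc]
    congr 2; ring

theorem T_pow_mul_Y (r : ℕ) (c : ℚ_[2]) : T₀ ^ r * Y c = Y (4 ^ r * c) * T₀ ^ r := by
  induction r generalizing c with
  | zero => simp
  | succ r ih =>
    rw [pow_succ, mul_assoc, T₀, mul_assoc s₂, s₁_mul_Y, ← mul_assoc s₂, s₂_mul_X, mul_assoc (Y _),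
      ← T₀, ← mul_assoc, ih, mul_assoc]
    congr 2; ring

theorem norm_four_pow_mul_le (r : ℕ) {b : ℚ_[2]} {s : ℝ} (h : ‖b‖ ≤ s) : ‖4 ^ r * b‖ ≤ s := by
  rw [norm_mul, norm_pow, norm_four]
  have : (4⁻¹ : ℝ) ^ r ≤ 1 := pow_le_one₀ (by norm_num) (by norm_num)
  nlinarith [norm_nonneg b]

/-- Elements of `K` on which the character is trivial. -/
def kerSubgroup (χ : K →* ℂˣ) : Subgroup Mp where
  carrier := {k | k ∈ K ∧ delta χ k = 1}
  one_mem' := ⟨one_mem _, delta_one⟩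
  mul_mem' := fun ⟨h1, h2⟩ ⟨h3, h4⟩ => ⟨mul_mem h1 h3, by rw [delta_mul_left h1, h2, h4, one_mul]⟩
  inv_mem' := fun {k} ⟨h1, h2⟩ => ⟨inv_mem h1, by
    have := delta_mul_inv (χ := χ) h1
    rwa [h2, one_mul] at this⟩

theorem X_mem_ker (hχ : IsChiTwo χ) {b : ℚ_[2]} (h : ‖b‖ ≤ 1) : X b ∈ kerSubgroup χ :=
  ⟨X_mem h, delta_X hχ h⟩

theorem Y_mem_ker (hχ : IsChiTwo χ) {c : ℚ_[2]} (h : ‖c‖ ≤ 8⁻¹) : Y c ∈ kerSubgroup χ :=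
  ⟨Y_mem h, delta_Y hχ h⟩

theorem norm_neg_sixteen_mul {b : ℚ_[2]} {s t : ℝ} (h : ‖b‖ ≤ s) (hs : 16⁻¹ * s ≤ t) :
    ‖-16 * b‖ ≤ t :=
  norm_mul_le_of (by rw [norm_neg, norm_sixteen]) h hs

theorem z₀_commute_X (b : ℚ_[2]) : z₀ * X b = X b * z₀ := by
  rw [z₀, ← X_add, ← X_add, add_comm]

/-- Integral upper unipotents cross every tail into the kernel of χ. Combined with the commutator of
x(1) and y(4), this yields vanishing at y(4) times a tail. -/
theorem X_mul_tail (hχ : IsChiTwo χ) (r : ℕ) (j : Fin 3) {b : ℚ_[2]} (hb : ‖b‖ ≤ 1) :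
    ∃ k ∈ kerSubgroup χ, X b * tail r j = tail r j * k := by
  have h4 := norm_four_pow_mul_le r hb
  rw [tail, ← mul_assoc, X_mul_T_pow]
  fin_cases j
  · exact ⟨_, X_mem_ker hχ h4, by simp⟩
  · refine ⟨_, X_mem_ker hχ h4, ?_⟩
    simp only [Fin.mk_one, Matrix.cons_val_one, Matrix.cons_val_zero, mul_assoc]
    rw [z₀_commute_X]
  · refine ⟨_, Y_mem_ker hχ (norm_neg_sixteen_mul h4 (by norm_num)), ?_⟩
    simp only [Fin.reduceFinMk, Matrix.cons_val, mul_assoc]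
    rw [X_s₂]

/-- The permutation of the representatives by left multiplication with `x(1/2)`. -/
def swapTail (r : ℕ) (j : Fin 3) : Fin 3 := if r = 0 then ![1, 0, 2] j else j

/-- For r > 0, x(1/2) crosses one T₀ and becomes the integral x(2), which is absorbed. For r = 0 it
interchanges 1 and z₀ and fixes the left coset of s₂. -/
theorem z₀_mul_tail (hχ : IsChiTwo χ) (r : ℕ) (j : Fin 3) :
    ∃ k ∈ kerSubgroup χ, z₀ * tail r j = tail r (swapTail r j) * k := by
  rcases Nat.eq_zero_or_pos r with rfl | hr
  · fin_cases j
    · exact ⟨1, one_mem _, by simp [swapTail, tail]⟩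
    · exact ⟨X 1, X_mem_ker hχ norm_one.le, by simp [swapTail, tail, z₀_sq]⟩
    · exact ⟨Y (-8), Y_mem_ker hχ norm_neg_eight, by simp [swapTail, tail, z₀_s₂]⟩
  · obtain ⟨s, rfl⟩ : ∃ s, r = s + 1 := ⟨r - 1, by omega⟩
    have e : z₀ * tail (s + 1) j = T₀ * (X 2 * tail s j) := by
      have h := X_mul_T_pow 1 2⁻¹
      rw [pow_one, pow_one] at h
      change X 2⁻¹ * tail (s + 1) j = _
      rw [tail, pow_succ', mul_assoc, ← mul_assoc (X 2⁻¹), h, mul_assoc, tail,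
        show (4 * 2⁻¹ : ℚ_[2]) = 2 by norm_num]
    obtain ⟨k, hk, h⟩ := X_mul_tail hχ s j (b := 2) (by rw [norm_two]; norm_num)
    refine ⟨k, hk, ?_⟩
    rw [e, h, swapTail, if_neg (by omega), tail, tail, pow_succ']
    simp only [mul_assoc]

theorem mat_pow (r : ℕ) : (T₀ ^ r).mat.1 0 0 = (-2⁻¹) ^ r ∧ (T₀ ^ r).mat.1 0 1 = 0 ∧
    (T₀ ^ r).mat.1 1 0 = 0 ∧ (T₀ ^ r).mat.1 1 1 = (-2) ^ r := by
  induction r with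
  | zero => simp [Mp.mat_one]
  | succ r ih =>
    obtain ⟨h1, h2, h3, h4⟩ := ih
    rw [pow_succ, Mp.mat_mul, mul_a, mul_b, mul_c, mul_d, h1, h2, h3, h4, T₀, Mp.mat_mul, mul_a,
      mul_b, mul_c, mul_d]
    simp only [s₁, s₂, W, lift_mat, matW_a, matW_b, matW_c, matW_d, coe_half, coe_quarter]
    refine ⟨?_, by ring, by ring, ?_⟩
    · rw [pow_succ]; norm_num
    · rw [pow_succ]; norm_num

theorem norm_half_pow (r : ℕ) : ‖((-2⁻¹ : ℚ_[2])) ^ r‖ = 2 ^ r := by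
  rw [norm_pow, norm_neg, norm_two_inv]

theorem one_le_two_pow_real (r : ℕ) : (1 : ℝ) ≤ 2 ^ r := one_le_pow₀ (by norm_num)

theorem tail_mem_iff (r : ℕ) (j : Fin 3) : tail r j ∈ K ↔ r = 0 ∧ j = 0 := by
  constructor
  · intro h
    obtain ⟨h1, h2, -, -⟩ := mem_K.1 h
    obtain ⟨t1, t2, -, -⟩ := mat_pow r
    have hr := one_le_two_pow_real r
    rw [tail, Mp.mat_mul, mul_a, t1, t2, zero_mul, add_zero] at h1
    rw [tail, Mp.mat_mul, mul_b, t1, t2, zero_mul, add_zero] at h2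
    rw [norm_mul, norm_half_pow] at h1 h2
    fin_cases j
    · refine ⟨?_, rfl⟩
      by_contra h0
      have : (2 : ℝ) ≤ 2 ^ r := le_self_pow₀ (by norm_num) h0
      simp [Mp.mat_one] at h1
      linarith
    · exfalso
      simp [z₀, X, lift_mat, norm_two] at h2
      linarith
    · exfalso
      simp only [Fin.reduceFinMk, Matrix.cons_val, s₂, W, lift_mat, matW_b, coe_quarter, norm_inv,
        norm_four, inv_inv] at h2
      linarith
  · rintro ⟨rfl, rfl⟩
    rw [tail_zero_zero]; exact one_mem _

/-- An entry of the bottom row already violates membership in K, and left multiplication by z₀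
leaves that row alone, so this settles two families at once. -/
theorem s₁_tail_entries (r : ℕ) (j : Fin 3) : 8⁻¹ < ‖(s₁ * tail r j).mat.1 1 0‖ ∨
    1 < ‖(s₁ * tail r j).mat.1 1 1‖ := by
  obtain ⟨t1, t2, t3, t4⟩ := mat_pow r
  have hr := one_le_two_pow_real r
  have e1 : (s₁ * T₀ ^ r).mat.1 1 0 = -2 * (-2⁻¹) ^ r := by
    rw [Mp.mat_mul, mul_c, t1, t3]
    simp only [s₁, W, lift_mat, matW_c, coe_half, inv_inv]; ring
  have e2 : (s₁ * T₀ ^ r).mat.1 1 1 = 0 := by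
    rw [Mp.mat_mul, mul_d, t2, t4]
    simp only [s₁, W, lift_mat, matW_d]; ring
  rw [tail, ← mul_assoc, Mp.mat_mul, mul_c, mul_d, e1, e2]
  fin_cases j
  · left
    simp only [Fin.zero_eta, Matrix.cons_val_zero, Mp.mat_one, one_entries, mul_one, mul_zero,
      add_zero]
    rw [norm_mul, norm_half_pow, norm_neg, norm_two]; linarith
  · left
    simp only [Fin.mk_one, Matrix.cons_val_one, Matrix.cons_val_zero, z₀, X, lift_mat, matX_a,
      matX_c, mul_one, mul_zero, add_zero]
    rw [norm_mul, norm_half_pow, norm_neg, norm_two]; linarith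
  · right
    simp only [Fin.reduceFinMk, Matrix.cons_val, s₂, W, lift_mat, matW_b, matW_d, coe_quarter,
      mul_zero, add_zero]
    rw [norm_mul, norm_mul, norm_half_pow, norm_neg, norm_two, norm_inv, norm_four]
    linarith

theorem s₁_tail_notMem (r : ℕ) (j : Fin 3) : s₁ * tail r j ∉ K := by
  intro h
  obtain ⟨-, -, h3, h4⟩ := mem_K.1 h
  rcases s₁_tail_entries r j with h | h <;> linarith

theorem z₀_s₁_tail_notMem (r : ℕ) (j : Fin 3) : z₀ * (s₁ * tail r j) ∉ K := by
  intro h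
  obtain ⟨-, -, h3, h4⟩ := mem_K.1 h
  rw [Mp.mat_mul, mul_c] at h3
  rw [Mp.mat_mul, mul_d] at h4
  simp only [z₀, X, lift_mat, matX_c, matX_d, one_mul, zero_mul, zero_add] at h3 h4
  rcases s₁_tail_entries r j with h | h <;> linarith

/-! ### Values at the representatives -/

section values

/-- Functions that are equivariant on both sides. -/
structure BiEquivariant (χ : K →* ℂˣ) (f : Mp → ℂ) : Prop where
  left : ∀ k ∈ K, ∀ g, f (k * g) = delta χ k * f g
  right : ∀ k ∈ K, ∀ g, f (g * k) = f g * delta χ k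

variable {f : Mp → ℂ}

theorem BiEquivariant.ker_left (hf : BiEquivariant χ f) {k : Mp} (hk : k ∈ kerSubgroup χ) (g : Mp) :
    f (k * g) = f g := by rw [hf.left k hk.1, hk.2, one_mul]

theorem BiEquivariant.ker_right (hf : BiEquivariant χ f) {k : Mp} (hk : k ∈ kerSubgroup χ)
    (g : Mp) : f (g * k) = f g := by rw [hf.right k hk.1, hk.2, mul_one]

theorem BiEquivariant.zero_left (hf : BiEquivariant χ f) {k : Mp} (hk : k ∈ K) {g : Mp}
    (h : f g = 0) : f (k * g) = 0 := by rw [hf.left k hk, h, mul_zero]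

theorem BiEquivariant.zero_right (hf : BiEquivariant χ f) {k : Mp} (hk : k ∈ K) {g : Mp}
    (h : f g = 0) : f (g * k) = 0 := by rw [hf.right k hk, h, zero_mul]

theorem BiEquivariant.opFun (hχ : IsChiTwo χ) (hf : BiEquivariant χ f) (i : Gen) :
    BiEquivariant χ (opFun χ i f) where
  left := opFun_mem hχ i (f := f) hf.left
  right := by
    intro k hk g
    cases i with
    | U1 =>
      rw [opFun_U1, opFun_U1, ← mul_assoc, ← mul_assoc, hf.right k hk, hf.right k hk]; ring
    | U2 =>
      rw [opFun_U2, opFun_U2, ← mul_assoc, ← mul_assoc, hf.right k hk, hf.right k hk]; ring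
    | Z => rw [opFun_Z, opFun_Z, ← mul_assoc, hf.right k hk]

theorem s₁_inv : s₁⁻¹ = negI⁻¹ * s₁ := by rw [← s₁_mul_self]; group

theorem s₂_inv : s₂⁻¹ = negI⁻¹ * s₂ := by rw [← s₂_mul_self]; group

theorem BiEquivariant.zero_s₁_inv (hf : BiEquivariant χ f) {g : Mp} (h : f (s₁ * g) = 0) :
    f (s₁⁻¹ * g) = 0 := by
  rw [s₁_inv, mul_assoc]; exact hf.zero_left (inv_mem negI_mem) h

theorem BiEquivariant.zero_s₂_inv (hf : BiEquivariant χ f) {g : Mp} (h : f (s₂ * g) = 0) :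
    f (s₂⁻¹ * g) = 0 := by
  rw [s₂_inv, mul_assoc]; exact hf.zero_left (inv_mem negI_mem) h

theorem z₀_inv : z₀⁻¹ = X (-1) * z₀ := by rw [X_neg, ← z₀_sq]; group

theorem X_neg_one_mem_ker (hχ : IsChiTwo χ) : X (-1) ∈ kerSubgroup χ :=
  X_mem_ker hχ (by simp)

theorem BiEquivariant.z₀_inv_left (hχ : IsChiTwo χ) (hf : BiEquivariant χ f) (g : Mp) :
    f (z₀⁻¹ * g) = f (z₀ * g) := by
  rw [z₀_inv, mul_assoc, hf.ker_left (X_neg_one_mem_ker hχ)]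

/-- If `x(1)` can be moved through `g` then equivariant functions vanish at `y(4) g`. -/
theorem BiEquivariant.Y_four_mul (hχ : IsChiTwo χ) (hf : BiEquivariant χ f) {g k : Mp}
    (hk : k ∈ kerSubgroup χ) (h : X 1 * g = g * k) : f (Y 4 * g) = 0 := by
  obtain ⟨m, hm, e, hd⟩ := exists_Y_four_mul_X hχ
  have h1 : f (Y 4 * X 1 * g) = -f (Y 4 * g) := by
    rw [e, mul_assoc, hf.left m hm, hd]; ring
  have h2 : f (Y 4 * X 1 * g) = f (Y 4 * g) := by
    rw [mul_assoc, h, ← mul_assoc, hf.ker_right hk]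
  linear_combination (h1 - h2) / 2

theorem BiEquivariant.mul_Y_four (hχ : IsChiTwo χ) (hf : BiEquivariant χ f) {g k : Mp}
    (hk : k ∈ kerSubgroup χ) (h : g * X 1 = k * g) : f (g * Y 4) = 0 := by
  obtain ⟨m, hm, e, hd⟩ := exists_X_mul_Y_four hχ
  have h1 : f (g * (X 1 * Y 4)) = -f (g * Y 4) := by
    rw [e, ← mul_assoc, hf.right m hm, hd]; ring
  have h2 : f (g * (X 1 * Y 4)) = f (g * Y 4) := by
    rw [← mul_assoc, h, mul_assoc, hf.ker_left hk]
  linear_combination (h1 - h2) / 2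

/-! ### The generators evaluated at the representatives. -/

theorem opU1_tail (hχ : IsChiTwo χ) (hf : BiEquivariant χ f) {r : ℕ} {j : Fin 3}
    (h : f (s₁ * tail r j) = 0) : opFun χ .U1 f (tail r j) = 0 := by
  obtain ⟨k, hk, e⟩ := X_mul_tail hχ r j (b := -1) (by simp)
  have h1 := hf.zero_s₁_inv h
  rw [opFun_U1, h1, mul_inv_rev, ← X_neg, mul_assoc, e, ← mul_assoc, hf.ker_right hk, h1]
  ring

/-- The second coset contributes the value at y(4) times the tail, which vanishes by the commutator.
-/
theorem opU1_s₁_tail (hχ : IsChiTwo χ) (hf : BiEquivariant χ f) (r : ℕ) (j : Fin 3) :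
    opFun χ .U1 f (s₁ * tail r j) = opCoeff χ * f (tail r j) := by
  obtain ⟨k, hk, e⟩ := X_mul_tail hχ r j norm_one.le
  have h1 : (X 1 * s₁)⁻¹ * (s₁ * tail r j) = Y 4 * tail r j := by
    rw [mul_inv_rev, ← X_neg, mul_assoc, ← mul_assoc (X _), X_s₁]
    norm_num [mul_assoc]
  rw [opFun_U1, h1, hf.Y_four_mul hχ hk e, inv_mul_cancel_left, add_zero]

/-- The braid relation in the group: both translates of z₀ s₁ · tail have, up to K, the form z₀ s₁
z₀ · tail, and z₀ permutes the tails. -/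
theorem opU1_z₀_s₁_tail (hχ : IsChiTwo χ) (hf : BiEquivariant χ f) {r : ℕ} {j : Fin 3}
    (h : f (z₀ * (s₁ * tail r (swapTail r j))) = 0) :
    opFun χ .U1 f (z₀ * (s₁ * tail r j)) = 0 := by
  obtain ⟨k, hk, e⟩ := z₀_mul_tail hχ r j
  have h0 : f (z₀ * (s₁ * (z₀ * tail r j))) = 0 := by
    rw [e, ← mul_assoc, ← mul_assoc, hf.ker_right hk, mul_assoc, h]
  have h1 : s₁⁻¹ * (z₀ * (s₁ * tail r j)) = z₀⁻¹ * (s₁ * (z₀⁻¹ * tail r j)) := by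
    have : s₁⁻¹ * z₀ * s₁ = z₀⁻¹ * s₁ * z₀⁻¹ := by
      rw [← Y_neg_two, mul_assoc, z₀, X_s₁, inv_mul_cancel_left]; norm_num
    calc _ = s₁⁻¹ * z₀ * s₁ * tail r j := by group
      _ = _ := by rw [this]; group
  have h2 : (X 1 * s₁)⁻¹ * (z₀ * (s₁ * tail r j)) = negI⁻¹ * (z₀ * (s₁ * (z₀ * tail r j))) := by
    have e1 : (X 1 * s₁)⁻¹ * z₀ * s₁ = z₀ * s₁⁻¹ * z₀ := by
      rw [← Y_two, mul_inv_rev, ← X_neg, z₀, mul_assoc s₁⁻¹, ← X_add, mul_assoc, X_s₁,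
        inv_mul_cancel_left]
      norm_num
    have e2 : z₀ * negI⁻¹ = negI⁻¹ * z₀ := by
      have := X_negI 2⁻¹
      rw [← z₀] at this
      rw [mul_inv_eq_iff_eq_mul, mul_assoc, this, inv_mul_cancel_left]
    calc _ = (X 1 * s₁)⁻¹ * z₀ * s₁ * tail r j := by group
      _ = z₀ * negI⁻¹ * s₁ * z₀ * tail r j := by rw [e1, s₁_inv]; group
      _ = _ := by rw [e2]; group
  have h3 : f (z₀⁻¹ * (s₁ * (z₀⁻¹ * tail r j))) = 0 := by
    obtain ⟨k', hk', e'⟩ := X_mul_tail hχ r j (b := -1) (by simp)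
    rw [hf.z₀_inv_left hχ, z₀_inv, ← z₀_commute_X, mul_assoc, e', ← mul_assoc, ← mul_assoc,
      ← mul_assoc, hf.ker_right hk', mul_assoc, mul_assoc, h0]
  rw [opFun_U1, h1, h2, h3, hf.zero_left (inv_mem negI_mem) h0]
  ring

theorem z₀_eq_conj : s₂⁻¹ * (Y (-8) * s₂) = z₀ := by
  rw [Y_s₂, inv_mul_cancel_left, z₀]; norm_num

/-- The second coset of U₂ introduces s₂⁻¹ y(-8) s₂ = z₀. -/
theorem opU2_tail_succ (r : ℕ) (j : Fin 3) : opFun χ .U2 f (tail (r + 1) j) =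
    opCoeff χ * (f (s₁ * tail r j) + f (z₀ * (s₁ * tail r j))) := by
  rw [opFun_U2, tail_succ, inv_mul_cancel_left, mul_inv_rev, ← Y_neg, ← z₀_eq_conj]
  simp only [mul_assoc]

theorem opU2_tail_two : opFun χ .U2 f (tail 0 2) =
    opCoeff χ * (f (tail 0 0) + f (tail 0 1)) := by
  rw [opFun_U2, tail_zero_two, tail_zero_zero, tail_zero_one, inv_mul_cancel, mul_inv_rev, ← Y_neg,
    ← z₀_eq_conj, mul_assoc]

theorem opU2_tail_zero (hχ : IsChiTwo χ) (hf : BiEquivariant χ f) (h : f (tail 0 2) = 0) {j : Fin 3}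
    (hj : j ≠ 2) : opFun χ .U2 f (tail 0 j) = 0 := by
  rw [tail_zero_two] at h
  have h8 : Y (-8) ∈ K := Y_mem norm_neg_eight
  have key : ∀ k ∈ K, f (s₂⁻¹ * k) = 0 := fun k hk =>
    hf.zero_s₂_inv (hf.zero_right hk h)
  have h1 : f (s₂⁻¹ * z₀) = 0 := by
    apply hf.zero_s₂_inv
    rw [s₂_z₀]
    exact hf.zero_left h8 h
  rw [opFun_U2, mul_inv_rev, ← Y_neg, mul_assoc]
  fin_cases j
  · change _ * (f (s₂⁻¹ * tail 0 0) + f (s₂⁻¹ * (Y (-8) * tail 0 0))) = 0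
    rw [tail_zero_zero, key _ (one_mem _), key _ (mul_mem h8 (one_mem _))]
    ring
  · change _ * (f (s₂⁻¹ * tail 0 1) + f (s₂⁻¹ * (Y (-8) * tail 0 1))) = 0
    obtain ⟨k, hk, e, -⟩ := exists_mul_z₀ hχ h8
    rw [tail_zero_one, h1, e, ← mul_assoc, hf.zero_right hk h1]
    ring
  · exact absurd rfl hj

theorem opU2_s₁_tail (hχ : IsChiTwo χ) (hf : BiEquivariant χ f) {r : ℕ} {j : Fin 3}
    (h : f (tail (r + 1) j) = 0) : opFun χ .U2 f (s₁ * tail r j) = 0 := by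
  rw [tail_succ] at h
  have h1 := hf.zero_s₂_inv h
  obtain ⟨k, hk, e⟩ := X_mul_tail hχ r j (b := -4⁻¹ * -8) (by
    rw [show (-4⁻¹ * -8 : ℚ_[2]) = 2 by norm_num, norm_two]; norm_num)
  rw [opFun_U2, h1, mul_inv_rev, ← Y_neg, mul_assoc, ← mul_assoc (Y _), Y_s₁, mul_assoc s₁, e,
    ← mul_assoc, ← mul_assoc, hf.ker_right hk, mul_assoc, h1]
  ring

/-- A form of the relation Z U₂ = U₂. -/
theorem opU2_z₀_mul (hχ : IsChiTwo χ) (hf : BiEquivariant χ f) (g : Mp) :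
    opFun χ .U2 f (z₀ * g) = opFun χ .U2 f g := by
  have := relation_Z_U₂ hχ (rightCovariant_of_mem (f := f) hf.left (z₀ * g))
  simp only [mul_inv_rev, mul_assoc, inv_mul_cancel_left] at this
  rw [opFun_U2, opFun_U2, mul_inv_rev, mul_assoc, mul_assoc, ← this]

theorem opZ_z₀_mul (g : Mp) : opFun χ .Z f (z₀ * g) = f g := by
  rw [opFun_Z, inv_mul_cancel_left]

theorem opZ_tail (hχ : IsChiTwo χ) (hf : BiEquivariant χ f) (r : ℕ) (j : Fin 3) :
    opFun χ .Z f (tail r j) = f (tail r (swapTail r j)) := by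
  obtain ⟨k, hk, e⟩ := z₀_mul_tail hχ r j
  rw [opFun_Z, hf.z₀_inv_left hχ, e, hf.ker_right hk]

theorem opZ_eq (hχ : IsChiTwo χ) (hf : BiEquivariant χ f) (g : Mp) :
    opFun χ .Z f g = f (z₀ * g) := by
  rw [opFun_Z, hf.z₀_inv_left hχ]

end values

/-- Among the representatives, `f` is nonzero precisely at `pt i r j`. -/
def SupportedAt (f : Mp → ℂ) (i : Fin 3) (r : ℕ) (j : Fin 3) : Prop :=
  ∀ i' r' j', f (pt i' r' j') ≠ 0 ↔ i' = i ∧ r' = r ∧ j' = j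

theorem pt_zero (r : ℕ) (j : Fin 3) : pt 0 r j = tail r j := rfl
theorem pt_one (r : ℕ) (j : Fin 3) : pt 1 r j = s₁ * tail r j := rfl
theorem pt_two (r : ℕ) (j : Fin 3) : pt 2 r j = z₀ * (s₁ * tail r j) := rfl

theorem supportedAt_iff {f : Mp → ℂ} {i : Fin 3} {r : ℕ} {j : Fin 3} : SupportedAt f i r j ↔
    (∀ r' j', f (tail r' j') ≠ 0 ↔ 0 = i ∧ r' = r ∧ j' = j) ∧
    (∀ r' j', f (s₁ * tail r' j') ≠ 0 ↔ 1 = i ∧ r' = r ∧ j' = j) ∧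
    (∀ r' j', f (z₀ * (s₁ * tail r' j')) ≠ 0 ↔ 2 = i ∧ r' = r ∧ j' = j) := by
  refine ⟨fun h => ⟨h 0, h 1, h 2⟩, fun ⟨h0, h1, h2⟩ i' => ?_⟩
  fin_cases i'
  exacts [h0, h1, h2]

theorem SupportedAt.eq_zero {f : Mp → ℂ} {i i' : Fin 3} {r r' : ℕ} {j j' : Fin 3}
    (h : SupportedAt f i r j) (hne : ¬(i' = i ∧ r' = r ∧ j' = j)) : f (pt i' r' j') = 0 := by
  by_contra h0
  exact hne ((h i' r' j').1 h0)

theorem supportedAt_delta : SupportedAt (delta χ) 0 0 0 := by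
  rw [supportedAt_iff]
  have key : ∀ g, delta χ g ≠ 0 ↔ g ∈ K := fun g =>
    ⟨fun h => by by_contra h0; exact h (delta_of_notMem h0), fun h => delta_ne_zero h⟩
  simp only [key, tail_mem_iff, s₁_tail_notMem, z₀_s₁_tail_notMem]
  simp

theorem swapTail_swapTail (r : ℕ) (j : Fin 3) : swapTail r (swapTail r j) = j := by
  unfold swapTail
  split_ifs
  · fin_cases j <;> rfl
  · rfl

/-! ### How the generators move the supporting representative. -/

theorem supportedAt_opZ_even (hχ : IsChiTwo χ) {f : Mp → ℂ} (hf : BiEquivariant χ f) {r : ℕ}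
    {j : Fin 3} (h : SupportedAt f 0 r j) :
    SupportedAt (opFun χ .Z f) 0 r (swapTail r j) := by
  rw [supportedAt_iff]
  refine ⟨fun r' j' => ?_, fun r' j' => ?_, fun r' j' => ?_⟩
  · rw [opZ_tail hχ hf, ← pt_zero, h]
    simp only [true_and]
    constructor
    · rintro ⟨rfl, rfl⟩
      exact ⟨rfl, (swapTail_swapTail _ _).symm⟩
    · rintro ⟨rfl, rfl⟩
      exact ⟨rfl, swapTail_swapTail _ _⟩
  · rw [opZ_eq hχ hf, ← pt_two, h]
    simp
  · rw [opZ_z₀_mul, ← pt_one, h]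
    simp

theorem supportedAt_opZ_odd (hχ : IsChiTwo χ) {f : Mp → ℂ} (hf : BiEquivariant χ f) {r : ℕ}
    {j : Fin 3} (h : SupportedAt f 1 r j) : SupportedAt (opFun χ .Z f) 2 r j := by
  rw [supportedAt_iff]
  refine ⟨fun r' j' => ?_, fun r' j' => ?_, fun r' j' => ?_⟩
  · rw [opZ_tail hχ hf, ← pt_zero, h]
    simp
  · rw [opZ_eq hχ hf, ← pt_two, h]
    simp
  · rw [opZ_z₀_mul, ← pt_one, h]
    simp

theorem supportedAt_opU1 (hχ : IsChiTwo χ) {f : Mp → ℂ} (hf : BiEquivariant χ f) {r : ℕ}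
    {j : Fin 3} (h : SupportedAt f 0 r j) : SupportedAt (opFun χ .U1 f) 1 r j := by
  rw [supportedAt_iff]
  refine ⟨fun r' j' => ?_, fun r' j' => ?_, fun r' j' => ?_⟩
  · rw [opU1_tail hχ hf (h.eq_zero (i' := 1) (by simp))]
    simp
  · rw [opU1_s₁_tail hχ hf, mul_ne_zero_iff, ← pt_zero, h]
    simp [opCoeff_ne_zero hχ]
  · rw [opU1_z₀_s₁_tail hχ hf (h.eq_zero (i' := 2) (by simp))]
    simp

theorem supportedAt_opU2 (hχ : IsChiTwo χ) {f : Mp → ℂ} (hf : BiEquivariant χ f) {r : ℕ}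
    {j : Fin 3} (h : SupportedAt f 1 r j) : SupportedAt (opFun χ .U2 f) 0 (r + 1) j := by
  have h0 : ∀ r' j', f (tail r' j') = 0 := fun r' j' => h.eq_zero (i' := 0) (by simp)
  rw [supportedAt_iff]
  refine ⟨fun r' j' => ?_, fun r' j' => ?_, fun r' j' => ?_⟩
  · rcases r' with _ | r'
    · have : opFun χ .U2 f (tail 0 j') = 0 := by
        by_cases hj : j' = 2
        · subst hj
          rw [opU2_tail_two, h0, h0, add_zero, mul_zero]
        · exact opU2_tail_zero hχ hf (h0 0 2) hj
      rw [this]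
      simp
    · rw [opU2_tail_succ, ← pt_two, h.eq_zero (i' := 2) (by simp), add_zero, mul_ne_zero_iff,
        ← pt_one, h]
      simp [opCoeff_ne_zero hχ]
  · rw [opU2_s₁_tail hχ hf (h0 _ _)]
    simp
  · rw [opU2_z₀_mul hχ hf, opU2_s₁_tail hχ hf (h0 _ _)]
    simp

theorem supportedAt_opU2_delta (hχ : IsChiTwo χ) (hf : BiEquivariant χ (delta χ)) :
    SupportedAt (opFun χ .U2 (delta χ)) 0 0 2 := by
  have h := supportedAt_delta (χ := χ)
  rw [supportedAt_iff]
  refine ⟨fun r' j' => ?_, fun r' j' => ?_, fun r' j' => ?_⟩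
  · rcases r' with _ | r'
    · by_cases hj : j' = 2
      · subst hj
        rw [opU2_tail_two, ← pt_zero 0 1, h.eq_zero (i' := 0) (j' := 1) (by simp), add_zero,
          tail_zero_zero, delta_one, mul_one]
        simp [opCoeff_ne_zero hχ]
      · rw [opU2_tail_zero hχ hf (h.eq_zero (i' := 0) (j' := 2) (by simp)) hj]
        simp [hj]
    · rw [opU2_tail_succ, ← pt_two, h.eq_zero (i' := 2) (by simp), add_zero, ← pt_one,
        h.eq_zero (i' := 1) (by simp)]
      simp
  · rw [opU2_s₁_tail hχ hf (h.eq_zero (i' := 0) (by simp))]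
    simp
  · rw [opU2_z₀_mul hχ hf, opU2_s₁_tail hχ hf (h.eq_zero (i' := 0) (by simp))]
    simp

/-- The words `(U₂ U₁)ʳ x` with `x` among `1`, `Z`, `U₂`. -/
noncomputable def tailWord (r : ℕ) (j : Fin 3) : PresentedAlgebra :=
  (gen .U2 * gen .U1) ^ r * ![1, gen .Z, gen .U2] j

/-- The words that form a basis of the presented algebra. -/
noncomputable def word (i : Fin 3) (r : ℕ) (j : Fin 3) : PresentedAlgebra :=
  ![tailWord r j, gen .U1 * tailWord r j, gen .Z * (gen .U1 * tailWord r j)] i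

theorem tailWord_succ (r : ℕ) (j : Fin 3) :
    tailWord (r + 1) j = gen .U2 * (gen .U1 * tailWord r j) := by
  rw [tailWord, pow_succ', tailWord]; simp only [mul_assoc]

theorem biEquivariant_of_mem {f : Mp → ℂ} (hf : f ∈ heckeSpace K χ) : BiEquivariant χ f :=
  ⟨heckeSpace_le_leftSpace hf, (heckeSpace_le_rightSpace hf).1⟩

theorem biEquivariant_delta : BiEquivariant χ (delta χ) :=
  ⟨delta_mem_leftSpace, delta_mem_rightSpace.1⟩

/-- Prepending U₁ and then U₂ to a word moves its point by s₁ and then s₂, without creating values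
at other representatives. -/
theorem supportedAt_tailWord (hχ : IsChiTwo χ) (r : ℕ) (j : Fin 3) :
    SupportedAt (toHecke hχ (tailWord r j)) 0 r j := by
  induction r with
  | zero =>
    fin_cases j
    · simpa [tailWord, toHecke_one] using supportedAt_delta
    · simpa [tailWord, toHecke_gen, swapTail] using
        supportedAt_opZ_even hχ biEquivariant_delta supportedAt_delta
    · simpa [tailWord, toHecke_gen] using supportedAt_opU2_delta hχ biEquivariant_delta
  | succ r ih =>
    rw [tailWord_succ, toHecke_gen_mul]
    refine supportedAt_opU2 hχ (biEquivariant_of_mem (toHecke hχ _).2) ?_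
    rw [toHecke_gen_mul]
    exact supportedAt_opU1 hχ (biEquivariant_of_mem (toHecke hχ _).2) ih

theorem supportedAt_word (hχ : IsChiTwo χ) (i : Fin 3) (r : ℕ) (j : Fin 3) :
    SupportedAt (toHecke hχ (word i r j)) i r j := by
  have h0 := supportedAt_tailWord hχ r j
  have h1 : SupportedAt (toHecke hχ (gen .U1 * tailWord r j)) 1 r j := by
    rw [toHecke_gen_mul]
    exact supportedAt_opU1 hχ (biEquivariant_of_mem (toHecke hχ _).2) h0
  fin_cases i
  · exact h0
  · exact h1
  · change SupportedAt (toHecke hχ (gen .Z * (gen .U1 * tailWord r j))) 2 r j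
    rw [toHecke_gen_mul]
    exact supportedAt_opZ_odd hχ (biEquivariant_of_mem (toHecke hχ _).2) h1

/-! ### The words span the presented algebra -/

theorem gen_U1_sq : gen .U1 * gen .U1 = 1 := by
  simpa [gen] using RingQuot.mkAlgHom_rel ℂ Rel.U1_sq

theorem gen_U2_sq : gen .U2 * gen .U2 = 1 + gen .Z := by
  simpa [gen] using RingQuot.mkAlgHom_rel ℂ Rel.U2_sq

theorem gen_U2_Z : gen .U2 * gen .Z = gen .U2 := by
  simpa [gen] using RingQuot.mkAlgHom_rel ℂ Rel.U2_Z

theorem gen_Z_U2 : gen .Z * gen .U2 = gen .U2 := by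
  simpa [gen] using RingQuot.mkAlgHom_rel ℂ Rel.Z_U2

theorem gen_braid : gen .U1 * gen .Z * gen .U1 = gen .Z * gen .U1 * gen .Z := by
  simpa [gen] using RingQuot.mkAlgHom_rel ℂ Rel.braid

/-- U₂²Z = U₂² reads (1 + Z)Z = 1 + Z. -/
theorem gen_Z_sq : gen .Z * gen .Z = 1 := by
  have h : (gen .U2 * gen .U2) * gen .Z = gen .U2 * gen .U2 := by rw [mul_assoc, gen_U2_Z]
  rw [gen_U2_sq, add_mul, one_mul, add_comm] at h
  exact add_right_cancel h

/-- The span of the basis words. -/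
noncomputable def wordSpan : Submodule ℂ PresentedAlgebra :=
  Submodule.span ℂ (Set.range fun p : Fin 3 × ℕ × Fin 3 => word p.1 p.2.1 p.2.2)

theorem word_mem (i : Fin 3) (r : ℕ) (j : Fin 3) : word i r j ∈ wordSpan :=
  Submodule.subset_span ⟨(i, r, j), rfl⟩

theorem tailWord_mem (r : ℕ) (j : Fin 3) : tailWord r j ∈ wordSpan := word_mem 0 r j

theorem gen_U1_mul_tailWord_mem (r : ℕ) (j : Fin 3) : gen .U1 * tailWord r j ∈ wordSpan :=
  word_mem 1 r j

theorem tailWord_zero (j : Fin 3) : tailWord 0 j = ![1, gen .Z, gen .U2] j := by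
  rw [tailWord, pow_zero, one_mul]

theorem gen_Z_mul_tailWord (r : ℕ) (j : Fin 3) :
    gen .Z * tailWord r j = tailWord r (swapTail r j) := by
  rcases r with _ | r
  · rw [tailWord_zero, tailWord_zero]
    fin_cases j
    · simp [swapTail]
    · simp [swapTail, gen_Z_sq]
    · simp [swapTail, gen_Z_U2]
  · rw [tailWord_succ, ← mul_assoc, gen_Z_U2, swapTail, if_neg (by omega), tailWord_succ]

/-- The braid relation `u z u = z u z` applied to words. -/
theorem gen_U1_mul_Z_mul_U1 (a : PresentedAlgebra) :
    gen .U1 * (gen .Z * (gen .U1 * a)) = gen .Z * (gen .U1 * (gen .Z * a)) := by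
  have := congrArg (· * a) gen_braid
  simpa only [mul_assoc] using this

/-- The relations rewrite a letter times a word: U₁² = 1, Z² = 1 and U₂² = 1 + Z shorten it, U₂Z =
U₂ and Z U₂ = U₂ remove Z, and the braid relation treats U₁ Z U₁. -/
theorem gen_mul_word_mem (x : Gen) (i : Fin 3) (r : ℕ) (j : Fin 3) :
    gen x * word i r j ∈ wordSpan := by
  cases x with
  | U1 =>
    fin_cases i
    · exact gen_U1_mul_tailWord_mem r j
    · change gen .U1 * (gen .U1 * tailWord r j) ∈ _
      rw [← mul_assoc, gen_U1_sq, one_mul]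
      exact tailWord_mem r j
    · change gen .U1 * (gen .Z * (gen .U1 * tailWord r j)) ∈ _
      rw [gen_U1_mul_Z_mul_U1, gen_Z_mul_tailWord]
      exact word_mem 2 r _
  | U2 =>
    fin_cases i
    · change gen .U2 * tailWord r j ∈ _
      rcases r with _ | r
      · rw [tailWord_zero]
        fin_cases j
        · simpa [tailWord] using tailWord_mem 0 2
        · simpa [tailWord, gen_U2_Z] using tailWord_mem 0 2
        · simpa [tailWord, gen_U2_sq] using
            Submodule.add_mem _ (tailWord_mem 0 0) (tailWord_mem 0 1)
      · rw [tailWord_succ, ← mul_assoc, gen_U2_sq, add_mul, one_mul]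
        exact Submodule.add_mem _ (word_mem 1 r j) (word_mem 2 r j)
    · change gen .U2 * (gen .U1 * tailWord r j) ∈ _
      rw [← tailWord_succ]
      exact tailWord_mem (r + 1) j
    · change gen .U2 * (gen .Z * (gen .U1 * tailWord r j)) ∈ _
      rw [← mul_assoc, gen_U2_Z, ← tailWord_succ]
      exact tailWord_mem (r + 1) j
  | Z =>
    fin_cases i
    · change gen .Z * tailWord r j ∈ _
      rw [gen_Z_mul_tailWord]
      exact tailWord_mem r _
    · exact word_mem 2 r j
    · change gen .Z * (gen .Z * (gen .U1 * tailWord r j)) ∈ _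
      rw [← mul_assoc, gen_Z_sq, one_mul]
      exact word_mem 1 r j

/-- The span is stable under left multiplication by the generators, hence a left ideal, and it
contains 1. -/
theorem wordSpan_eq_top : wordSpan = ⊤ := by
  have key : ∀ a : PresentedAlgebra, ∀ m ∈ wordSpan, a * m ∈ wordSpan := by
    intro a
    induction a using presented_induction with
    | hc c =>
      intro m hm
      rw [← Algebra.smul_def]
      exact Submodule.smul_mem _ c hm
    | hg x =>
      intro m hm
      have : wordSpan ≤ wordSpan.comap (LinearMap.mulLeft ℂ (gen x)) := by
        rw [wordSpan, Submodule.span_le]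
        rintro _ ⟨p, rfl⟩
        exact gen_mul_word_mem x _ _ _
      exact this hm
    | hm a b h1 h2 =>
      intro m hm
      rw [mul_assoc]
      exact h1 _ (h2 _ hm)
    | ha a b h1 h2 =>
      intro m hm
      rw [add_mul]
      exact Submodule.add_mem _ (h1 _ hm) (h2 _ hm)
  rw [eq_top_iff]
  intro a _
  have h1 : (1 : PresentedAlgebra) ∈ wordSpan := by
    simpa [tailWord] using tailWord_mem 0 0
  simpa using key a 1 h1

/-! ### Equivariant functions are determined by their values at the representatives -/

section vanishing

variable {f : Mp → ℂ}

/-- The classes of half-integral arguments modulo the integral ones are 0 and 1/2. -/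
theorem exists_reduce_X {s : ℚ_[2]} (hs : ‖s‖ ≤ 2) :
    ∃ b : ℚ_[2], ‖b‖ ≤ 1 ∧ (X s = X b ∨ X s = X b * z₀) := by
  have h1 : ‖2 * s‖ ≤ 1 := norm_mul_le_of norm_two.le hs (by norm_num)
  have h2 : ∀ x : ℚ_[2], ‖2 * x‖ ≤ 2⁻¹ → ‖x‖ ≤ 1 := fun x hx => by
    rw [norm_mul, norm_two] at hx; linarith
  rcases even_or_odd_of_norm_le_one h1 with h | h
  · exact ⟨s, h2 s h, Or.inl rfl⟩
  · refine ⟨s - 2⁻¹, h2 _ ?_, Or.inr ?_⟩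
    · rwa [mul_sub, mul_inv_cancel₀ two_ne_zero]
    · rw [z₀, ← X_add, sub_add_cancel]

/-- The classes of 4ℤ₂ modulo 8ℤ₂ are 0 and 4. -/
theorem exists_reduce_Y {s : ℚ_[2]} (hs : ‖s‖ ≤ 4⁻¹) :
    ∃ c : ℚ_[2], ‖c‖ ≤ 8⁻¹ ∧ (Y s = Y c ∨ Y s = Y c * Y 4) := by
  have h4 : ‖(4⁻¹ : ℚ_[2])‖ = 4 := by rw [norm_inv, norm_four, inv_inv]
  have h1 : ‖4⁻¹ * s‖ ≤ 1 := norm_mul_le_of h4.le hs (by norm_num)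
  have h2 : ∀ x : ℚ_[2], ‖4⁻¹ * x‖ ≤ 2⁻¹ → ‖x‖ ≤ 8⁻¹ := fun x hx => by
    rw [norm_mul, h4] at hx; linarith
  rcases even_or_odd_of_norm_le_one h1 with h | h
  · exact ⟨s, h2 s h, Or.inl rfl⟩
  · refine ⟨s - 4, h2 _ ?_, Or.inr ?_⟩
    · rwa [mul_sub, inv_mul_cancel₀ (by norm_num)]
    · rw [← Y_add, sub_add_cancel]

theorem BiEquivariant.zero_X_left (hf : BiEquivariant χ f) {s : ℚ_[2]} (hs : ‖s‖ ≤ 2) {g : Mp}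
    (h : f g = 0) (h' : f (z₀ * g) = 0) : f (X s * g) = 0 := by
  obtain ⟨b, hb, e | e⟩ := exists_reduce_X hs <;> rw [e]
  · exact hf.zero_left (X_mem hb) h
  · rw [mul_assoc]; exact hf.zero_left (X_mem hb) h'

theorem BiEquivariant.zero_X_right (hf : BiEquivariant χ f) {s : ℚ_[2]} (hs : ‖s‖ ≤ 2) {g : Mp}
    (h : f g = 0) (h' : f (g * z₀) = 0) : f (g * X s) = 0 := by
  obtain ⟨b, hb, e | e⟩ := exists_reduce_X hs <;> rw [e]
  · exact hf.zero_right (X_mem hb) h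
  · rw [← z₀_commute_X, ← mul_assoc]; exact hf.zero_right (X_mem hb) h'

theorem BiEquivariant.zero_Y_left (hf : BiEquivariant χ f) {s : ℚ_[2]} (hs : ‖s‖ ≤ 4⁻¹) {g : Mp}
    (h : f g = 0) (h' : f (Y 4 * g) = 0) : f (Y s * g) = 0 := by
  obtain ⟨c, hc, e | e⟩ := exists_reduce_Y hs <;> rw [e]
  · exact hf.zero_left (Y_mem hc) h
  · rw [mul_assoc]; exact hf.zero_left (Y_mem hc) h'

theorem Y_mul_comm (s t : ℚ_[2]) : Y s * Y t = Y t * Y s := by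
  rw [← Y_add, ← Y_add, add_comm]

theorem BiEquivariant.zero_Y_right (hf : BiEquivariant χ f) {s : ℚ_[2]} (hs : ‖s‖ ≤ 4⁻¹) {g : Mp}
    (h : f g = 0) (h' : f (g * Y 4) = 0) : f (g * Y s) = 0 := by
  obtain ⟨c, hc, e | e⟩ := exists_reduce_Y hs <;> rw [e]
  · exact hf.zero_right (Y_mem hc) h
  · rw [Y_mul_comm, ← mul_assoc]; exact hf.zero_right (Y_mem hc) h'

/-- `f` vanishes at `ω`, `x ω`, `ω y` and `x ω y`. -/
def VanishesAround (f : Mp → ℂ) (x ω y : Mp) : Prop :=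
  f ω = 0 ∧ f (x * ω) = 0 ∧ f (ω * y) = 0 ∧ f (x * (ω * y)) = 0

/-- Vanishing is insensitive to the sign in the cover and to the unit torus, so the factorizations
below may be checked on matrices. -/
theorem BiEquivariant.of_mat_eq (hf : BiEquivariant χ f) {g h : Mp} {u : ℚ_[2]ˣ}
    (hu : ‖(u : ℚ_[2])‖ = 1) (e : (H u * g).mat = h.mat) (h0 : f h = 0) : f g = 0 := by
  obtain ⟨ε, e⟩ := exists_central e
  have h1 : f (H u * g) = 0 := by rw [e]; exact hf.zero_right (central_mem ε) h0
  rw [hf.left _ (H_mem hu)] at h1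
  exact (mul_eq_zero.1 h1).resolve_left (delta_ne_zero (H_mem hu))

theorem norm_div_le_of {a b : ℚ_[2]} {s : ℝ} (hb : b ≠ 0) (h : ‖a‖ ≤ s * ‖b‖) : ‖a / b‖ ≤ s := by
  rw [norm_div]; exact (div_le_iff₀ (norm_pos_iff.2 hb)).2 h

theorem exists_unit_scaling {p q : ℚ_[2]} (hp : p ≠ 0) (h : ‖p‖ = ‖q‖) :
    ∃ u : ℚ_[2]ˣ, ‖(u : ℚ_[2])‖ = 1 ∧ u * p = q := by
  have hq : q ≠ 0 := by rwa [← norm_ne_zero_iff, ← h, norm_ne_zero_iff]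
  refine ⟨Units.mk0 (q / p) (div_ne_zero hq hp), ?_, ?_⟩
  · rw [Units.val_mk0, norm_div, h, div_self (norm_ne_zero_iff.2 hq)]
  · rw [Units.val_mk0, div_mul_cancel₀ _ hp]

/-! ### Factorization around a dominant entry. -/

/-- Up to a unit torus element, g is x(s) ω x(d/c) with ω antidiagonal. The bounds put both
arguments in (1/2)ℤ₂, so modulo K only 1 and z₀ occur on either side. -/
theorem pivot_c (hf : BiEquivariant χ f) {ω g : Mp} (ha : ω.mat.1 0 0 = 0) (hd : ω.mat.1 1 1 = 0)
    (h : VanishesAround f z₀ ω z₀) (hn : ‖g.mat.1 1 0‖ = ‖ω.mat.1 1 0‖)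
    (h1 : ‖g.mat.1 0 0‖ ≤ 2 * ‖g.mat.1 1 0‖) (h2 : ‖g.mat.1 1 1‖ ≤ 2 * ‖g.mat.1 1 0‖) :
    f g = 0 := by
  have hω := det_eq ω.mat
  have hg := det_eq g.mat
  rw [ha, hd] at hω
  have hc' : ω.mat.1 1 0 ≠ 0 := by rintro h0; rw [h0] at hω; simp at hω
  have hc : g.mat.1 1 0 ≠ 0 := by rwa [← norm_ne_zero_iff, hn, norm_ne_zero_iff]
  obtain ⟨u, hu, e⟩ := exists_unit_scaling hc' hn.symm
  obtain ⟨k1, k2, k3, k4⟩ := h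
  have hs : ‖u * g.mat.1 0 0 / ω.mat.1 1 0‖ ≤ 2 :=
    norm_div_le_of hc' (by rw [norm_mul, hu, one_mul, ← hn]; exact h1)
  have hs' : ‖g.mat.1 1 1 / g.mat.1 1 0‖ ≤ 2 := norm_div_le_of hc h2
  refine hf.of_mat_eq hu (h := X (u * g.mat.1 0 0 / ω.mat.1 1 0) *
    (ω * X (g.mat.1 1 1 / g.mat.1 1 0))) ?_ (hf.zero_X_left hs (hf.zero_X_right hs' k1 k3) ?_)
  · have hu0 : (u : ℚ_[2]) ≠ 0 := u.ne_zero
    have hb : ω.mat.1 0 1 = -(ω.mat.1 1 0)⁻¹ := by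
      field_simp; linear_combination -hω
    rw [SL2.ext_iff']
    simp only [Mp.mat_mul, mul_a, mul_b, mul_c, mul_d, X, H, lift_mat, matX_a, matX_b, matX_c,
      matX_d, matH_a, matH_b, matH_c, matH_d, ha, hd, hb, ← e]
    refine ⟨by field_simp; ring, ?_, by field_simp; ring, by field_simp; ring⟩
    rw [← e] at hg
    field_simp
    linear_combination -(u : ℚ_[2]) * hg
  · rw [← mul_assoc]; exact hf.zero_X_right hs' k2 (by rwa [mul_assoc])

/-- The opposite Bruhat form y(s) ω y(a/b), with arguments in 4ℤ₂, so that only 1 and y(4) remain.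
-/
theorem pivot_b (hf : BiEquivariant χ f) {ω g : Mp} (ha : ω.mat.1 0 0 = 0) (hd : ω.mat.1 1 1 = 0)
    (h : VanishesAround f (Y 4) ω (Y 4)) (hn : ‖g.mat.1 0 1‖ = ‖ω.mat.1 0 1‖)
    (h1 : ‖g.mat.1 0 0‖ ≤ 4⁻¹ * ‖g.mat.1 0 1‖) (h2 : ‖g.mat.1 1 1‖ ≤ 4⁻¹ * ‖g.mat.1 0 1‖) :
    f g = 0 := by
  have hω := det_eq ω.mat
  have hg := det_eq g.mat
  rw [ha, hd] at hω
  have hb' : ω.mat.1 0 1 ≠ 0 := by rintro h0; rw [h0] at hω; simp at hω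
  have hb : g.mat.1 0 1 ≠ 0 := by rwa [← norm_ne_zero_iff, hn, norm_ne_zero_iff]
  obtain ⟨u, hu, e⟩ := exists_unit_scaling hb hn
  have hu0 : (u : ℚ_[2]) ≠ 0 := u.ne_zero
  obtain ⟨k1, k2, k3, k4⟩ := h
  have hs : ‖g.mat.1 1 1 / (u * ω.mat.1 0 1)‖ ≤ 4⁻¹ :=
    norm_div_le_of (mul_ne_zero hu0 hb') (by rw [norm_mul, hu, one_mul, ← hn]; exact h2)
  have hs' : ‖g.mat.1 0 0 / g.mat.1 0 1‖ ≤ 4⁻¹ := norm_div_le_of hb h1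
  refine hf.of_mat_eq hu (h := Y (g.mat.1 1 1 / (u * ω.mat.1 0 1)) *
    (ω * Y (g.mat.1 0 0 / g.mat.1 0 1))) ?_ (hf.zero_Y_left hs (hf.zero_Y_right hs' k1 k3) ?_)
  · have hc : ω.mat.1 1 0 = -(ω.mat.1 0 1)⁻¹ := by
      field_simp; linear_combination -hω
    rw [SL2.ext_iff']
    simp only [Mp.mat_mul, mul_a, mul_b, mul_c, mul_d, Y, H, lift_mat, matY_a, matY_b, matY_c,
      matY_d, matH_a, matH_b, matH_c, matH_d, ha, hd, hc, ← e]
    refine ⟨by field_simp; ring, by field_simp; ring, ?_, by field_simp; ring⟩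
    field_simp
    linear_combination -(u : ℚ_[2]) * hg
  · rw [← mul_assoc]; exact hf.zero_Y_right hs' k2 (by rwa [mul_assoc])

/-- A Gauss factorization y(s) ω x(b/a) around the diagonal matrix ω; `pivot_d` uses the order x(s)
ω y(c/d). -/
theorem pivot_a (hf : BiEquivariant χ f) {ω g : Mp} (hb : ω.mat.1 0 1 = 0) (hc : ω.mat.1 1 0 = 0)
    (h : VanishesAround f (Y 4) ω z₀) (hn : ‖g.mat.1 0 0‖ = ‖ω.mat.1 0 0‖)
    (h1 : ‖g.mat.1 1 0‖ ≤ 4⁻¹ * ‖g.mat.1 0 0‖) (h2 : ‖g.mat.1 0 1‖ ≤ 2 * ‖g.mat.1 0 0‖) :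
    f g = 0 := by
  have hω := det_eq ω.mat
  have hg := det_eq g.mat
  rw [hb, hc] at hω
  have ha' : ω.mat.1 0 0 ≠ 0 := by rintro h0; rw [h0] at hω; simp at hω
  have ha : g.mat.1 0 0 ≠ 0 := by rwa [← norm_ne_zero_iff, hn, norm_ne_zero_iff]
  obtain ⟨u, hu, e⟩ := exists_unit_scaling ha hn
  have hu0 : (u : ℚ_[2]) ≠ 0 := u.ne_zero
  obtain ⟨k1, k2, k3, k4⟩ := h
  have hs : ‖g.mat.1 1 0 / (u * ω.mat.1 0 0)‖ ≤ 4⁻¹ :=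
    norm_div_le_of (mul_ne_zero hu0 ha') (by rw [norm_mul, hu, one_mul, ← hn]; exact h1)
  have hs' : ‖g.mat.1 0 1 / g.mat.1 0 0‖ ≤ 2 := norm_div_le_of ha h2
  refine hf.of_mat_eq hu (h := Y (g.mat.1 1 0 / (u * ω.mat.1 0 0)) *
    (ω * X (g.mat.1 0 1 / g.mat.1 0 0))) ?_ (hf.zero_Y_left hs (hf.zero_X_right hs' k1 k3) ?_)
  · have hd : ω.mat.1 1 1 = (ω.mat.1 0 0)⁻¹ := by
      field_simp; linear_combination hω
    rw [SL2.ext_iff']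
    simp only [Mp.mat_mul, mul_a, mul_b, mul_c, mul_d, X, Y, H, lift_mat, matX_a, matX_b, matX_c,
      matX_d, matY_a, matY_b, matY_c, matY_d, matH_a, matH_b, matH_c, matH_d, hb, hc, hd, ← e]
    refine ⟨by field_simp; ring, by field_simp; ring, by field_simp; ring, ?_⟩
    field_simp
    linear_combination (u : ℚ_[2]) * hg
  · rw [← mul_assoc]; exact hf.zero_X_right hs' k2 (by rwa [mul_assoc])

theorem pivot_d (hf : BiEquivariant χ f) {ω g : Mp} (hb : ω.mat.1 0 1 = 0) (hc : ω.mat.1 1 0 = 0)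
    (h : VanishesAround f z₀ ω (Y 4)) (hn : ‖g.mat.1 1 1‖ = ‖ω.mat.1 1 1‖)
    (h1 : ‖g.mat.1 1 0‖ ≤ 4⁻¹ * ‖g.mat.1 1 1‖) (h2 : ‖g.mat.1 0 1‖ ≤ 2 * ‖g.mat.1 1 1‖) :
    f g = 0 := by
  have hω := det_eq ω.mat
  have hg := det_eq g.mat
  rw [hb, hc] at hω
  have hd' : ω.mat.1 1 1 ≠ 0 := by rintro h0; rw [h0] at hω; simp at hω
  have hd : g.mat.1 1 1 ≠ 0 := by rwa [← norm_ne_zero_iff, hn, norm_ne_zero_iff]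
  obtain ⟨u, hu, e⟩ := exists_unit_scaling hd' hn.symm
  have hu0 : (u : ℚ_[2]) ≠ 0 := u.ne_zero
  obtain ⟨k1, k2, k3, k4⟩ := h
  have hs : ‖u * g.mat.1 0 1 / ω.mat.1 1 1‖ ≤ 2 :=
    norm_div_le_of hd' (by rw [norm_mul, hu, one_mul, ← hn]; exact h2)
  have hs' : ‖g.mat.1 1 0 / g.mat.1 1 1‖ ≤ 4⁻¹ := norm_div_le_of hd h1
  refine hf.of_mat_eq hu (h := X (u * g.mat.1 0 1 / ω.mat.1 1 1) *
    (ω * Y (g.mat.1 1 0 / g.mat.1 1 1))) ?_ (hf.zero_X_left hs (hf.zero_Y_right hs' k1 k3) ?_)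
  · have ha : ω.mat.1 0 0 = (ω.mat.1 1 1)⁻¹ := by
      field_simp; linear_combination hω
    rw [SL2.ext_iff']
    simp only [Mp.mat_mul, mul_a, mul_b, mul_c, mul_d, X, Y, H, lift_mat, matX_a, matX_b, matX_c,
      matX_d, matY_a, matY_b, matY_c, matY_d, matH_a, matH_b, matH_c, matH_d, hb, hc, ha, ← e]
    rw [← e] at hg
    refine ⟨?_, by field_simp; ring, by field_simp; ring, by field_simp; ring⟩
    field_simp
    linear_combination (u : ℚ_[2]) * hg
  · rw [← mul_assoc]; exact hf.zero_Y_right hs' k2 (by rwa [mul_assoc])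

/-! The elements `tail r 0`, `tail r 2` and their products with `s₁` -/

theorem tail_two_mul_X (r : ℕ) (b : ℚ_[2]) :
    tail r 2 * X b = Y (4 ^ r * (-16 * b)) * tail r 2 := by
  change T₀ ^ r * s₂ * X b = _ * (T₀ ^ r * s₂)
  rw [mul_assoc, s₂_mul_X, ← mul_assoc, T_pow_mul_Y, mul_assoc]

theorem s₁_tail_two_mul_X (r : ℕ) (b : ℚ_[2]) :
    s₁ * tail r 2 * X b = X (4 ^ r * (4 * b)) * (s₁ * tail r 2) := by
  rw [mul_assoc, tail_two_mul_X, ← mul_assoc, s₁_mul_Y, mul_assoc]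
  congr 2; ring

theorem tail_zero_mul_Y (r : ℕ) (c : ℚ_[2]) : tail r 0 * Y c = Y (4 ^ r * c) * tail r 0 := by
  change T₀ ^ r * 1 * Y c = _ * (T₀ ^ r * 1)
  rw [mul_one, T_pow_mul_Y]

theorem s₁_tail_zero_mul_Y (r : ℕ) (c : ℚ_[2]) :
    s₁ * tail r 0 * Y c = X (4 ^ r * (-4⁻¹ * c)) * (s₁ * tail r 0) := by
  rw [mul_assoc, tail_zero_mul_Y, ← mul_assoc, s₁_mul_Y, mul_assoc]
  congr 2; ring

theorem tail_zero_mul_z₀ (r : ℕ) : tail r 0 * z₀ = tail r 1 := by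
  simp [tail]

theorem BiEquivariant.zero_z₀_mul (hχ : IsChiTwo χ) (hf : BiEquivariant χ f) {k g : Mp}
    (hk : k ∈ K) (h : f (z₀ * g) = 0) : f (z₀ * (k * g)) = 0 := by
  obtain ⟨k', hk', e, -⟩ := exists_z₀_mul hχ hk
  rw [← mul_assoc, e, mul_assoc]
  exact hf.zero_left hk' h

theorem exists_Y_four_mul_X' {b : ℚ_[2]} (hb : ‖b‖ ≤ 1) : ∃ k ∈ K, Y 4 * X b = k * Y 4 := by
  refine ⟨Y 4 * X b * (Y 4)⁻¹, ?_, by group⟩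
  rw [← Y_neg, mem_K]
  simp only [Mp.mat_mul, mul_a, mul_b, mul_c, mul_d, X, Y, lift_mat, matX_a, matX_b, matX_c,
      matX_d, matY_a, matY_b, matY_c, matY_d]
  ring_nf
  have h4 : ‖b * 4‖ ≤ 4⁻¹ := norm_mul_le_of hb norm_four.le (by norm_num)
  have h16 : ‖b * 16‖ ≤ 16⁻¹ := norm_mul_le_of hb norm_sixteen.le (by norm_num)
  refine ⟨norm_sub_le_of (by simp) (h4.trans (by norm_num)), hb, ?_,
    norm_add_le_of (by simp) (h4.trans (by norm_num))⟩
  rw [norm_neg]; exact h16.trans (by norm_num)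

theorem BiEquivariant.zero_Y_four_mul (hf : BiEquivariant χ f) {b : ℚ_[2]} (hb : ‖b‖ ≤ 1) {g : Mp}
    (h : f (Y 4 * g) = 0) : f (Y 4 * (X b * g)) = 0 := by
  obtain ⟨k, hk, e⟩ := exists_Y_four_mul_X' hb
  rw [← mul_assoc, e, mul_assoc]
  exact hf.zero_left hk h

theorem BiEquivariant.zero_Y_four_s₁_tail (hχ : IsChiTwo χ) (hf : BiEquivariant χ f) {r : ℕ}
    {j : Fin 3} (h : f (s₁ * tail r j) = 0) : f (Y 4 * (s₁ * tail r j)) = 0 := by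
  obtain ⟨k, hk, e⟩ := X_mul_tail hχ r j (b := -4⁻¹ * 4) (by norm_num)
  rw [← mul_assoc, Y_s₁, mul_assoc, e, ← mul_assoc]
  exact hf.zero_right hk.1 h

theorem norm_four_pow_mul_neg_sixteen (r : ℕ) : ‖(4 ^ r * (-16 * 1) : ℚ_[2])‖ ≤ 8⁻¹ :=
  norm_four_pow_mul_le r (norm_neg_sixteen_mul norm_one.le (by norm_num))

theorem norm_four_pow_mul_neg_eight (r : ℕ) : ‖(4 ^ r * (-16 * 2⁻¹) : ℚ_[2])‖ ≤ 8⁻¹ :=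
  norm_four_pow_mul_le r (norm_neg_sixteen_mul norm_two_inv.le (by norm_num))

/-! ### Vanishing at the neighbours of the monomial representatives. -/

theorem around_c_s₁_tail (h0 : ∀ i r j, f (pt i r j) = 0) (r : ℕ) :
    VanishesAround f z₀ (s₁ * tail r 0) z₀ := by
  rw [VanishesAround, mul_assoc, tail_zero_mul_z₀]
  exact ⟨h0 1 r 0, h0 2 r 0, h0 1 r 1, h0 2 r 1⟩

theorem around_c_tail (hχ : IsChiTwo χ) (hf : BiEquivariant χ f)
    (h0 : ∀ i r j, f (pt i r j) = 0) (r : ℕ) : VanishesAround f z₀ (tail r 2) z₀ := by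
  have h2 : f (z₀ * tail r 2) = 0 := by
    obtain ⟨k, hk, e⟩ := z₀_mul_tail hχ r 2
    rw [e]
    exact hf.zero_right hk.1 (h0 0 r _)
  have hY := Y_mem (norm_four_pow_mul_neg_eight r)
  have e : tail r 2 * z₀ = _ := tail_two_mul_X r 2⁻¹
  rw [VanishesAround, e]
  exact ⟨h0 0 r 2, h2, hf.zero_left hY (h0 0 r 2), hf.zero_z₀_mul hχ hY h2⟩

theorem around_b_s₁_tail (hχ : IsChiTwo χ) (hf : BiEquivariant χ f)
    (h0 : ∀ i r j, f (pt i r j) = 0) (r : ℕ) : VanishesAround f (Y 4) (s₁ * tail r 0) (Y 4) := by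
  have h2 := hf.zero_Y_four_s₁_tail hχ (h0 1 r 0)
  have hb : ‖(4 ^ r * (-4⁻¹ * 4) : ℚ_[2])‖ ≤ 1 := norm_four_pow_mul_le r (by norm_num)
  rw [VanishesAround, s₁_tail_zero_mul_Y]
  exact ⟨h0 1 r 0, h2, hf.zero_left (X_mem hb) (h0 1 r 0), hf.zero_Y_four_mul hb h2⟩

/-- Here y(4) cannot be absorbed on either side; the commutator with x(1) forces zero instead. -/
theorem around_b_tail (hχ : IsChiTwo χ) (hf : BiEquivariant χ f)
    (h0 : ∀ i r j, f (pt i r j) = 0) (r : ℕ) : VanishesAround f (Y 4) (tail r 2) (Y 4) := by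
  obtain ⟨k, hk, e⟩ := X_mul_tail hχ r 2 norm_one.le
  have hY := Y_mem_ker hχ (norm_four_pow_mul_neg_sixteen r)
  refine ⟨h0 0 r 2, hf.Y_four_mul hχ hk e, hf.mul_Y_four hχ hY (tail_two_mul_X r 1), ?_⟩
  rw [← mul_assoc]
  refine hf.mul_Y_four hχ hY ?_
  rw [mul_assoc, tail_two_mul_X, ← mul_assoc, Y_mul_comm, mul_assoc]

theorem around_a_tail (hχ : IsChiTwo χ) (hf : BiEquivariant χ f)
    (h0 : ∀ i r j, f (pt i r j) = 0) (r : ℕ) : VanishesAround f (Y 4) (tail r 0) z₀ := by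
  rw [VanishesAround, tail_zero_mul_z₀]
  have h : ∀ j, f (Y 4 * tail r j) = 0 := fun j => by
    obtain ⟨k, hk, e⟩ := X_mul_tail hχ r j norm_one.le
    exact hf.Y_four_mul hχ hk e
  exact ⟨h0 0 r 0, h 0, h0 0 r 1, h 1⟩

theorem around_a_s₁_tail (hχ : IsChiTwo χ) (hf : BiEquivariant χ f)
    (h0 : ∀ i r j, f (pt i r j) = 0) (r : ℕ) : VanishesAround f (Y 4) (s₁ * tail r 2) z₀ := by
  have h2 := hf.zero_Y_four_s₁_tail hχ (h0 1 r 2)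
  have hb : ‖(4 ^ r * (4 * 2⁻¹) : ℚ_[2])‖ ≤ 1 := norm_four_pow_mul_le r (by
    rw [norm_mul, norm_four, norm_two_inv]; norm_num)
  have e : s₁ * tail r 2 * z₀ = _ := s₁_tail_two_mul_X r 2⁻¹
  rw [VanishesAround, e]
  exact ⟨h0 1 r 2, h2, hf.zero_left (X_mem hb) (h0 1 r 2), hf.zero_Y_four_mul hb h2⟩

theorem around_d_tail (hχ : IsChiTwo χ) (hf : BiEquivariant χ f)
    (h0 : ∀ i r j, f (pt i r j) = 0) (r : ℕ) : VanishesAround f z₀ (tail r 0) (Y 4) := by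
  have h2 : f (z₀ * tail r 0) = 0 := by
    obtain ⟨k, hk, e⟩ := z₀_mul_tail hχ r 0
    rw [e]
    exact hf.zero_right hk.1 (h0 0 r _)
  refine ⟨h0 0 r 0, h2, ?_⟩
  -- For r = 0 the factor y(4) stays outside K and is killed by the commutator; for r > 0 it crosses
  -- to the left as y(4^(r+1)), an element of K.
  rcases r with _ | r
  · rw [tail_zero_zero, one_mul]
    refine ⟨?_, hf.mul_Y_four hχ (X_mem_ker hχ norm_one.le) (z₀_commute_X 1)⟩
    have := hf.mul_Y_four hχ (g := 1) (X_mem_ker hχ norm_one.le) (by rw [one_mul, mul_one])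
    rwa [one_mul] at this
  · have hY : Y (4 ^ (r + 1) * 4) ∈ K := Y_mem (by
      rw [pow_succ, mul_assoc]
      exact norm_four_pow_mul_le r (by rw [norm_mul, norm_four]; norm_num))
    rw [tail_zero_mul_Y]
    exact ⟨hf.zero_left hY (h0 0 (r + 1) 0), hf.zero_z₀_mul hχ hY h2⟩

theorem around_d_s₁_tail (hχ : IsChiTwo χ) (hf : BiEquivariant χ f)
    (h0 : ∀ i r j, f (pt i r j) = 0) (r : ℕ) : VanishesAround f z₀ (s₁ * tail r 2) (Y 4) := by
  have hX : X (4 ^ r * (4 * 1)) ∈ kerSubgroup χ := X_mem_ker hχ (norm_four_pow_mul_le r (by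
    rw [mul_one, norm_four]; norm_num))
  refine ⟨h0 1 r 2, h0 2 r 2, hf.mul_Y_four hχ hX (s₁_tail_two_mul_X r 1), ?_⟩
  rw [← mul_assoc]
  refine hf.mul_Y_four hχ hX ?_
  rw [mul_assoc, s₁_tail_two_mul_X, ← mul_assoc, z₀_commute_X, mul_assoc]

/-! ### Reduction of an arbitrary matrix to a dominant entry. -/

theorem exists_norm_eq_pow {p : ℚ_[2]} (hp : p ≠ 0) :
    (∃ r : ℕ, ‖p‖ = 2 ^ r) ∨ ∃ r : ℕ, ‖p‖ = 2⁻¹ * (2 ^ r)⁻¹ := by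
  have h := Padic.norm_eq_zpow_neg_valuation hp
  obtain ⟨n, hn | hn⟩ := Int.eq_nat_or_neg (-p.valuation)
  · left
    exact ⟨n, by rw [h, hn]; norm_num⟩
  · rcases n with _ | n
    · left
      exact ⟨0, by rw [h, hn]; norm_num⟩
    · right
      refine ⟨n, ?_⟩
      rw [h, hn, zpow_neg, zpow_natCast, pow_succ, mul_inv_rev]
      norm_num

/-- Norms are powers of 2, so a ratio exceeding 2 is at least 4. These are exactly the bounds under
which x-arguments reduce to 1, z₀ and y-arguments to 1, y(4). -/
theorem norm_dichotomy (x y : ℚ_[2]) : ‖x‖ ≤ 2 * ‖y‖ ∨ ‖y‖ ≤ 4⁻¹ * ‖x‖ := by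
  by_contra! h
  obtain ⟨h1, h2⟩ := h
  have hx : x ≠ 0 := by
    rintro rfl
    rw [norm_zero] at h1
    linarith [norm_nonneg y]
  have hx' := norm_pos_iff.2 hx
  have h3 : ‖2⁻¹ * y / x‖ < 1 := by
    rw [norm_div, norm_mul, norm_two_inv, div_lt_one hx']; exact h1
  have h4 := norm_le_half_of_lt h3
  rw [norm_div, norm_mul, norm_two_inv, div_le_iff₀ hx'] at h4
  linarith

theorem norm_entries_tail_zero (r : ℕ) : (tail r 0).mat.1 0 1 = 0 ∧ (tail r 0).mat.1 1 0 = 0 ∧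
    ‖(tail r 0).mat.1 0 0‖ = 2 ^ r ∧ ‖(tail r 0).mat.1 1 1‖ = (2 ^ r)⁻¹ := by
  obtain ⟨t1, t2, t3, t4⟩ := mat_pow r
  change (T₀ ^ r * 1).mat.1 0 1 = 0 ∧ (T₀ ^ r * 1).mat.1 1 0 = 0 ∧
    ‖(T₀ ^ r * 1).mat.1 0 0‖ = _ ∧ ‖(T₀ ^ r * 1).mat.1 1 1‖ = _
  rw [mul_one, t1, t2, t3, t4]
  simp [norm_two]

theorem norm_entries_tail_two (r : ℕ) : (tail r 2).mat.1 0 0 = 0 ∧ (tail r 2).mat.1 1 1 = 0 ∧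
    ‖(tail r 2).mat.1 0 1‖ = 4 * 2 ^ r ∧ ‖(tail r 2).mat.1 1 0‖ = 4⁻¹ * (2 ^ r)⁻¹ := by
  obtain ⟨t1, t2, t3, t4⟩ := mat_pow r
  change (T₀ ^ r * s₂).mat.1 0 0 = 0 ∧ (T₀ ^ r * s₂).mat.1 1 1 = 0 ∧
    ‖(T₀ ^ r * s₂).mat.1 0 1‖ = _ ∧ ‖(T₀ ^ r * s₂).mat.1 1 0‖ = _
  rw [Mp.mat_mul, mul_a, mul_b, mul_c, mul_d, t1, t2, t3, t4]
  simp only [s₂, W, lift_mat, matW_a, matW_b, matW_c, matW_d, coe_quarter]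
  simp [norm_two, norm_four, mul_comm]

theorem entries_s₁_mul (g : Mp) : ‖(s₁ * g).mat.1 0 0‖ = 2 * ‖g.mat.1 1 0‖ ∧
    ‖(s₁ * g).mat.1 0 1‖ = 2 * ‖g.mat.1 1 1‖ ∧ ‖(s₁ * g).mat.1 1 0‖ = 2⁻¹ * ‖g.mat.1 0 0‖ ∧
    ‖(s₁ * g).mat.1 1 1‖ = 2⁻¹ * ‖g.mat.1 0 1‖ := by
  rw [Mp.mat_mul, mul_a, mul_b, mul_c, mul_d]
  simp only [s₁, W, lift_mat, matW_a, matW_b, matW_c, matW_d, coe_half]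
  simp [norm_two]

/-- Some entry dominates its two neighbours, so a pivot factorization applies. Up to units, the
matrices of the tails with j = 0 and j = 2 and their products with s₁ exhaust all monomial matrices.
-/
theorem BiEquivariant.eq_zero (hχ : IsChiTwo χ) (hf : BiEquivariant χ f)
    (h0 : ∀ i r j, f (pt i r j) = 0) (g : Mp) : f g = 0 := by
  have hdet := det_eq g.mat
  have pos : ∀ x : ℚ_[2], 0 ≤ ‖x‖ := fun x => norm_nonneg x
  have hA := pos (g.mat.1 0 0)
  have hB := pos (g.mat.1 0 1)
  have hC := pos (g.mat.1 1 0)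
  have hD := pos (g.mat.1 1 1)
  have zero : ∀ {x y : ℚ_[2]} {s : ℝ}, ‖x‖ ≤ s * ‖y‖ → y = 0 → x = 0 := by
    rintro x y s h rfl
    rw [norm_zero, mul_zero] at h
    exact norm_le_zero_iff.1 h
  have caseC : ‖g.mat.1 0 0‖ ≤ 2 * ‖g.mat.1 1 0‖ → ‖g.mat.1 1 1‖ ≤ 2 * ‖g.mat.1 1 0‖ → f g = 0 := by
    intro h1 h2
    have hc : g.mat.1 1 0 ≠ 0 := by
      intro hc
      rw [zero h1 hc, hc] at hdet
      simp at hdet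
    -- The rescaling by 1/2 aligns the two ranges of 2‖c‖: the powers 2^r belong to s₁T₀^r, and the
    -- values 2⁻¹·2^(-r) to T₀^r s₂.
    rcases exists_norm_eq_pow (mul_ne_zero (inv_ne_zero (two_ne_zero (α := ℚ_[2]))) hc) with
      ⟨r, hr⟩ | ⟨r, hr⟩ <;> rw [norm_mul, norm_two_inv] at hr
    · obtain ⟨e1, e2, e3, e4⟩ := norm_entries_tail_zero r
      obtain ⟨d1, d2, d3, d4⟩ := entries_s₁_mul (tail r 0)
      refine pivot_c hf ?_ ?_ (around_c_s₁_tail h0 r) ?_ h1 h2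
      · rw [← norm_eq_zero, d1, e2]; simp
      · rw [← norm_eq_zero, d4, e1]; simp
      · rw [d3, e3]; linarith
    · obtain ⟨e1, e2, e3, e4⟩ := norm_entries_tail_two r
      refine pivot_c hf e1 e2 (around_c_tail hχ hf h0 r) ?_ h1 h2
      rw [e4]; linarith
  have caseB : ‖g.mat.1 0 0‖ ≤ 4⁻¹ * ‖g.mat.1 0 1‖ → ‖g.mat.1 1 1‖ ≤ 4⁻¹ * ‖g.mat.1 0 1‖ →
      f g = 0 := by
    intro h1 h2
    have hb : g.mat.1 0 1 ≠ 0 := by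
      intro hb
      rw [zero h1 hb, hb] at hdet
      simp at hdet
    rcases exists_norm_eq_pow (inv_ne_zero (mul_ne_zero (two_ne_zero (α := ℚ_[2])) hb)) with
      ⟨r, hr⟩ | ⟨r, hr⟩ <;> rw [norm_inv, inv_eq_iff_eq_inv, norm_mul, norm_two] at hr
    · obtain ⟨e1, e2, e3, e4⟩ := norm_entries_tail_zero r
      obtain ⟨d1, d2, d3, d4⟩ := entries_s₁_mul (tail r 0)
      refine pivot_b hf ?_ ?_ (around_b_s₁_tail hχ hf h0 r) ?_ h1 h2
      · rw [← norm_eq_zero, d1, e2]; simp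
      · rw [← norm_eq_zero, d4, e1]; simp
      · rw [d2, e4]; linarith
    · obtain ⟨e1, e2, e3, e4⟩ := norm_entries_tail_two r
      refine pivot_b hf e1 e2 (around_b_tail hχ hf h0 r) ?_ h1 h2
      rw [mul_inv, inv_inv, inv_inv] at hr
      rw [e3]; linarith
  have caseA : ‖g.mat.1 1 0‖ ≤ 4⁻¹ * ‖g.mat.1 0 0‖ → ‖g.mat.1 0 1‖ ≤ 2 * ‖g.mat.1 0 0‖ →
      f g = 0 := by
    intro h1 h2
    have ha : g.mat.1 0 0 ≠ 0 := by
      intro ha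
      rw [zero h2 ha, ha] at hdet
      simp at hdet
    rcases exists_norm_eq_pow ha with ⟨r, hr⟩ | ⟨r, hr⟩
    · obtain ⟨e1, e2, e3, e4⟩ := norm_entries_tail_zero r
      exact pivot_a hf e1 e2 (around_a_tail hχ hf h0 r) (by rw [hr, e3]) h1 h2
    · obtain ⟨e1, e2, e3, e4⟩ := norm_entries_tail_two r
      obtain ⟨d1, d2, d3, d4⟩ := entries_s₁_mul (tail r 2)
      refine pivot_a hf ?_ ?_ (around_a_s₁_tail hχ hf h0 r) ?_ h1 h2
      · rw [← norm_eq_zero, d2, e2]; simp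
      · rw [← norm_eq_zero, d3, e1]; simp
      · rw [hr, d1, e4]; ring
  have caseD : ‖g.mat.1 1 0‖ ≤ 4⁻¹ * ‖g.mat.1 1 1‖ → ‖g.mat.1 0 1‖ ≤ 2 * ‖g.mat.1 1 1‖ →
      f g = 0 := by
    intro h1 h2
    have hd : g.mat.1 1 1 ≠ 0 := by
      intro hd
      rw [zero h2 hd, hd] at hdet
      simp at hdet
    rcases exists_norm_eq_pow (inv_ne_zero hd) with ⟨r, hr⟩ | ⟨r, hr⟩ <;>
      rw [norm_inv, inv_eq_iff_eq_inv] at hr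
    · obtain ⟨e1, e2, e3, e4⟩ := norm_entries_tail_zero r
      exact pivot_d hf e1 e2 (around_d_tail hχ hf h0 r) (by rw [hr, e4]) h1 h2
    · obtain ⟨e1, e2, e3, e4⟩ := norm_entries_tail_two r
      obtain ⟨d1, d2, d3, d4⟩ := entries_s₁_mul (tail r 2)
      refine pivot_d hf ?_ ?_ (around_d_s₁_tail hχ hf h0 r) ?_ h1 h2
      · rw [← norm_eq_zero, d2, e2]; simp
      · rw [← norm_eq_zero, d3, e1]; simp
      · rw [hr, d4, e3, mul_inv, inv_inv, inv_inv]; ring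
  -- Each comparison of adjacent entries eliminates one of them, and every branch leaves a dominant
  -- entry.
  rcases norm_dichotomy (g.mat.1 0 0) (g.mat.1 1 0) with h1 | h1
  · rcases norm_dichotomy (g.mat.1 1 1) (g.mat.1 1 0) with h2 | h2
    · exact caseC h1 h2
    · rcases norm_dichotomy (g.mat.1 0 1) (g.mat.1 1 1) with h3 | h3
      · exact caseD h2 h3
      · exact caseB (by linarith) h3
  · rcases norm_dichotomy (g.mat.1 0 1) (g.mat.1 0 0) with h2 | h2
    · exact caseA h1 h2
    · rcases norm_dichotomy (g.mat.1 0 1) (g.mat.1 1 1) with h3 | h3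
      · exact caseD (by linarith) h3
      · exact caseB h2 h3

end vanishing

/-! ### The presented algebra is the Hecke algebra -/

/-- Evaluation at a representative. -/
noncomputable def evalPt (χ : K →* ℂˣ) (p : Fin 3 × ℕ × Fin 3) : heckeSpace K χ →ₗ[ℂ] ℂ :=
  (LinearMap.proj (pt p.1 p.2.1 p.2.2)).comp (heckeSpace K χ).subtype

theorem evalPt_apply (p : Fin 3 × ℕ × Fin 3) (f : heckeSpace K χ) :
    evalPt χ p f = (f : Mp → ℂ) (pt p.1 p.2.1 p.2.2) := rfl

/-- The basis words as a family. -/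
noncomputable def wordFamily (p : Fin 3 × ℕ × Fin 3) : PresentedAlgebra := word p.1 p.2.1 p.2.2

theorem evalPt_toHecke_ne_zero_iff (hχ : IsChiTwo χ) (p q : Fin 3 × ℕ × Fin 3) :
    evalPt χ p (toHecke hχ (wordFamily q)) ≠ 0 ↔ p = q := by
  rw [evalPt_apply, wordFamily, supportedAt_word hχ, Prod.ext_iff, Prod.ext_iff]

theorem evalPt_sum (hχ : IsChiTwo χ) (p : Fin 3 × ℕ × Fin 3) (c : (Fin 3 × ℕ × Fin 3) →₀ ℂ) :
    evalPt χ p (toHecke hχ (c.sum fun q a => a • wordFamily q)) =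
      c p * evalPt χ p (toHecke hχ (wordFamily p)) := by
  simp only [Finsupp.sum, map_sum, map_smul, smul_eq_mul]
  refine (Finset.sum_eq_single p (fun q _ hq => ?_) fun hp => ?_)
  · by_contra h
    exact hq ((evalPt_toHecke_ne_zero_iff hχ p q).1 (right_ne_zero_of_mul h)).symm
  · rw [Finsupp.notMem_support_iff.1 hp, zero_mul]

/-- The matrix of values of the words at the representatives is diagonal with nonzero diagonal. -/
theorem toHecke_injective (hχ : IsChiTwo χ) : Function.Injective (toHecke hχ) := by
  rw [injective_iff_map_eq_zero]
  intro a ha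
  have hmem : a ∈ Submodule.span ℂ (Set.range wordFamily) := by
    have h : a ∈ wordSpan := by rw [wordSpan_eq_top]; trivial
    exact h
  obtain ⟨c, rfl⟩ := Finsupp.mem_span_range_iff_exists_finsupp.1 hmem
  have hc : c = 0 := by
    ext p
    have h := evalPt_sum hχ p c
    rw [ha, map_zero] at h
    exact (mul_eq_zero.1 h.symm).resolve_right ((evalPt_toHecke_ne_zero_iff hχ p p).2 rfl)
  rw [hc, Finsupp.sum_zero_index]

/-- The support meets finitely many left cosets, and distinct representatives lie in distinct left
cosets: the function of a word that is nonzero at one of them vanishes at the other. -/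
theorem finite_setOf_evalPt_ne_zero (hχ : IsChiTwo χ) (f : heckeSpace K χ) :
    {p | evalPt χ p f ≠ 0}.Finite := by
  obtain ⟨-, t, ht, hs⟩ := heckeSpace_le_rightSpace f.2
  have h : ∀ p : {p | evalPt χ p f ≠ 0}, ∃ x ∈ t, x⁻¹ * pt p.1.1 p.1.2.1 p.1.2.2 ∈ K :=
    fun p => hs _ p.2
  choose x hx hxK using h
  have : Finite t := ht
  refine Finite.of_injective (fun p => (⟨x p, hx p⟩ : t)) fun p q hpq => ?_
  have hpq : x p = x q := congrArg Subtype.val hpq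
  have hk := mul_mem (inv_mem (hxK p)) (hxK q)
  rw [hpq, mul_inv_rev, mul_assoc, ← mul_assoc (x q)⁻¹⁻¹, inv_mul_cancel, one_mul] at hk
  have hF := biEquivariant_of_mem (toHecke hχ (wordFamily p.1)).2
  have h1 := hF.right _ hk (pt p.1.1 p.1.2.1 p.1.2.2)
  rw [mul_inv_cancel_left] at h1
  have h2 : evalPt χ q.1 (toHecke hχ (wordFamily p.1)) ≠ 0 := by
    rw [evalPt_apply, h1]
    exact mul_ne_zero ((evalPt_toHecke_ne_zero_iff hχ p.1 p.1).2 rfl) (delta_ne_zero hk)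
  exact Subtype.ext ((evalPt_toHecke_ne_zero_iff hχ _ _).1 h2).symm

/-- Subtract the combination of words with the same values at the representatives; the difference
vanishes at all of them, hence everywhere. -/
theorem toHecke_surjective (hχ : IsChiTwo χ) : Function.Surjective (toHecke hχ) := by
  intro f
  set c : (Fin 3 × ℕ × Fin 3) →₀ ℂ := Finsupp.onFinset (finite_setOf_evalPt_ne_zero hχ f).toFinset
    (fun p => evalPt χ p f / evalPt χ p (toHecke hχ (wordFamily p))) (fun p hp => by
      rw [Set.Finite.mem_toFinset]
      exact (div_ne_zero_iff.1 hp).1) with hc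
  refine ⟨c.sum fun q a => a • wordFamily q, ?_⟩
  set F := f - toHecke hχ (c.sum fun q a => a • wordFamily q) with hF
  have h0 : ∀ p, evalPt χ p F = 0 := fun p => by
    rw [hF, map_sub, evalPt_sum, hc, Finsupp.onFinset_apply,
      div_mul_cancel₀ _ ((evalPt_toHecke_ne_zero_iff hχ p p).2 rfl), sub_self]
  have h1 : F = 0 := Subtype.ext (funext fun g =>
    (biEquivariant_of_mem F.2).eq_zero hχ (fun i r j => h0 (i, r, j)) g)
  exact (sub_eq_zero.1 h1).symm

/-- The isomorphism from the presented algebra to the Hecke algebra. -/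
noncomputable def heckeEquiv (hχ : IsChiTwo χ) : PresentedAlgebra ≃ₗ[ℂ] heckeSpace K χ :=
  LinearEquiv.ofBijective (toHecke hχ) (And.intro (toHecke_injective hχ) (toHecke_surjective hχ))

theorem heckeEquiv_apply (hχ : IsChiTwo χ) (a : PresentedAlgebra) :
    heckeEquiv hχ a = toHecke hχ a := rfl

/-! ### Supports and normalizations of the generators. -/

theorem isSupportedOn_of {f : Mp → ℂ} (hf : BiEquivariant χ f) {x : Mp} {c : ℂ} (hx : f x = c)
    (h : ∀ g, f g ≠ 0 → ∃ k ∈ K, ∃ k' ∈ K, g = k * x * k') : IsSupportedOn K χ x c f := by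
  refine ⟨fun k k' => ?_, fun g hg => ?_⟩
  · rw [hf.right _ k'.2, hf.left _ k.2, hx, delta_coe, delta_coe]
  · by_contra h0
    exact hg (DoubleCoset.mem_doubleCoset.2 (h g h0))

theorem mem_of_delta_ne_zero {g : Mp} (h : delta χ g ≠ 0) : g ∈ K := by
  by_contra h0
  exact h (delta_of_notMem h0)

theorem isSupportedOn_delta : IsSupportedOn K χ 1 1 (delta χ) :=
  isSupportedOn_of biEquivariant_delta delta_one fun g hg =>
    ⟨1, one_mem _, g, mem_of_delta_ne_zero hg, by simp⟩

theorem exists_of_translate_ne_zero {x y g : Mp} (hy : y ∈ K)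
    (h : delta χ ((y * x)⁻¹ * g) ≠ 0) : ∃ k ∈ K, ∃ k' ∈ K, g = k * x * k' :=
  ⟨y, hy, _, mem_of_delta_ne_zero h, by group⟩

theorem isSupportedOn_opFun_Z (hχ : IsChiTwo χ) :
    IsSupportedOn K χ z₀ 1 (opFun χ .Z (delta χ)) := by
  refine isSupportedOn_of (biEquivariant_delta.opFun hχ _) ?_ fun g hg => ?_
  · rw [opFun_Z, inv_mul_cancel, delta_one]
  · rw [opFun_Z] at hg
    exact exists_of_translate_ne_zero (one_mem _) (by rwa [one_mul])

theorem sqrt_two_mul_opCoeff : ((Real.sqrt 2 : ℝ) : ℂ) * opCoeff χ = conj (valW χ) := by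
  have h : ((Real.sqrt 2 : ℝ) : ℂ) * (Real.sqrt 2 : ℝ) = 2 := by
    rw [← Complex.ofReal_mul, Real.mul_self_sqrt (by norm_num)]; norm_num
  have h0 : ((Real.sqrt 2 : ℝ) : ℂ) ≠ 0 := left_ne_zero_of_mul (by rw [h]; norm_num)
  rw [conj_valW, opCoeff, eq_div_iff h0]
  linear_combination (1 + delta χ negI) / 2 * h

theorem isSupportedOn_opFun_U1 (hχ : IsChiTwo χ) : IsSupportedOn K χ s₁ (conj (valW χ))
    (((Real.sqrt 2 : ℝ) : ℂ) • opFun χ .U1 (delta χ)) := by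
  have hf := (biEquivariant_delta (χ := χ)).opFun hχ .U1
  refine isSupportedOn_of ⟨fun k hk g => ?_, fun k hk g => ?_⟩ ?_ fun g hg => ?_
  · simp only [Pi.smul_apply, hf.left k hk, smul_eq_mul]; ring
  · simp only [Pi.smul_apply, hf.right k hk, smul_eq_mul]; ring
  · have h := opU1_s₁_tail hχ (biEquivariant_delta (χ := χ)) 0 0
    rw [tail_zero_zero, mul_one, delta_one, mul_one] at h
    rw [Pi.smul_apply, h, smul_eq_mul, sqrt_two_mul_opCoeff]
  · rw [Pi.smul_apply, opFun_U1] at hg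
    by_cases h : delta χ (s₁⁻¹ * g) = 0
    · rw [h, zero_add] at hg
      exact exists_of_translate_ne_zero (X_mem norm_one.le)
        (right_ne_zero_of_mul (right_ne_zero_of_mul hg))
    · exact exists_of_translate_ne_zero (one_mem _) (by rwa [one_mul])

theorem isSupportedOn_opFun_U2 (hχ : IsChiTwo χ) : IsSupportedOn K χ s₂ (conj (valW χ))
    (((Real.sqrt 2 : ℝ) : ℂ) • opFun χ .U2 (delta χ)) := by
  have hf := (biEquivariant_delta (χ := χ)).opFun hχ .U2
  refine isSupportedOn_of ⟨fun k hk g => ?_, fun k hk g => ?_⟩ ?_ fun g hg => ?_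
  · simp only [Pi.smul_apply, hf.left k hk, smul_eq_mul]; ring
  · simp only [Pi.smul_apply, hf.right k hk, smul_eq_mul]; ring
  · have h := opU2_tail_two (f := delta χ) (χ := χ)
    have h' : delta χ (tail 0 1) = 0 :=
      supportedAt_delta.eq_zero (i' := 0) (r' := 0) (j' := 1) (by simp)
    rw [h', add_zero, tail_zero_zero, tail_zero_two, delta_one, mul_one] at h
    rw [Pi.smul_apply, h, smul_eq_mul, sqrt_two_mul_opCoeff]
  · rw [Pi.smul_apply, opFun_U2] at hg
    by_cases h : delta χ (s₂⁻¹ * g) = 0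
    · rw [h, zero_add] at hg
      exact exists_of_translate_ne_zero (Y_mem norm_eight.le)
        (right_ne_zero_of_mul (right_ne_zero_of_mul hg))
    · exact exists_of_translate_ne_zero (one_mem _) (by rwa [one_mul])

end Metaplectic

theorem theorem2
    (χ : K0bar 3 →* ℂˣ) (hχ : IsChiTwo χ)
    (μ : MeasureTheory.Measure Mp) [μ.IsHaarMeasure]
    (hμ : μ (K0bar 3 : Set Mp) = 1) :
    ∃ U₁ U₂ Z : heckeSpace (K0bar 3) χ,
      IsSupportedOn (K0bar 3) χ
        (lift (matW (two ^ (-1 : ℤ))))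
        (conj (valW χ)) U₁ ∧
      IsSupportedOn (K0bar 3) χ
        (lift (matW (two ^ (-2 : ℤ))))
        (conj (valW χ)) U₂ ∧
      IsSupportedOn (K0bar 3) χ
        (lift (matY 2) *
          lift (matW (two ^ (-1 : ℤ))) *
          lift (matY 2)) 1 Z ∧
      ∃ Φ : PresentedAlgebra ≃ₗ[ℂ]
          heckeSpace (K0bar 3) χ,
        (∀ a b, (Φ (a * b) : Mp → ℂ) = convolve μ (Φ a) (Φ b)) ∧
        IsSupportedOn (K0bar 3) χ 1 1 (Φ 1) ∧
        Φ (gen .U1) = ((Real.sqrt 2 : ℝ) : ℂ)⁻¹ • U₁ ∧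
        Φ (gen .U2) = ((Real.sqrt 2 : ℝ) : ℂ)⁻¹ • U₂ ∧
        Φ (gen .Z) = Z := by
  have h2 : ((Real.sqrt 2 : ℝ) : ℂ) ≠ 0 := by simp
  -- The third representative is x(1/2) itself, with no sign, so the value 1 prescribed there is
  -- δ(1).
  have e : lift (matY 2) * lift (matW (two ^ (-1 : ℤ))) * lift (matY 2) = z₀ := Y_two_s₁_Y_two
  refine ⟨((Real.sqrt 2 : ℝ) : ℂ) • toHecke hχ (gen .U1),
    ((Real.sqrt 2 : ℝ) : ℂ) • toHecke hχ (gen .U2), toHecke hχ (gen .Z), ?_, ?_, ?_,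
    heckeEquiv hχ,
    fun a b => toHecke_mul hχ hμ a b, ?_, ?_, ?_, rfl⟩
  · rw [Submodule.coe_smul, toHecke_gen]
    exact isSupportedOn_opFun_U1 hχ
  · rw [Submodule.coe_smul, toHecke_gen]
    exact isSupportedOn_opFun_U2 hχ
  · rw [toHecke_gen, e]
    exact isSupportedOn_opFun_Z hχ
  · rw [heckeEquiv_apply, toHecke_one]
    exact isSupportedOn_delta
  · rw [inv_smul_smul₀ h2, heckeEquiv_apply]
  · rw [inv_smul_smul₀ h2, heckeEquiv_apply]
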